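/- Let $\mathbb D$ be the open unit disk, $dA=\frac1\pi\,dx\,dy$ the normalized area measure on $\mathbb D$, and $L_a^2$ the Bergman space of analytic functions in $L^2(\mathbb D,dA)$. For $z,w\in\mathbb D$ let $K_z(w)=(1-\bar z w)^{-2}$ be the reproducing kernel, $k_z=K_z/\|K_z\|_{L_a^2}$, and for $r\in(0,1)$ let $E(z,r)=\{w\in\mathbb D:\left|\frac{z-w}{1-\bar z w}\right|<r\}$. Let $\varphi:\mathbb D\to\mathbb D$ be a non-constant analytic map, let $\mu_\varphi(E)=A(\varphi^{-1}(E))$ for Borel sets $E\subseteq\mathbb D$, and set $$C_\varphi f=f\circ\varphi,\qquad T_{\mu_\varphi}f(z)=\int_{\mathbb D}\frac{f(w)}{(1-z\bar w)^2}\,d\mu_\varphi(w),\qquad \widetilde{\mu_\varphi}(z)=\int_{\mathbb D}|k_z(w)|^2\,d\mu_\varphi(w)$$ for $f\in L_a^2$ and $z\in\mathbb D$. Then $C_\varphi$ and $T_{\mu_\varphi}$ are well-defined bounded linear operators on $L_a^2$, $T_{\mu_\varphi}=C_\varphi^*C_\varphi$, and the following are equivalent: (a) $T_{\mu_\varphi}$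 is invertible on $L_a^2$; (b) $\widetilde{\mu_\varphi}$ is bounded below on $\mathbb D$, i.e. there is $\delta>0$ with $\widetilde{\mu_\varphi}(z)\ge\delta$ for all $z\in\mathbb D$; (c) $\mu_\varphi$ satisfies the reverse Carleson condition: there are $r\in(0,1)$ and $C>0$ with $C^{-1}\le \mu_\varphi(E(z,r))/A(E(z,r))\le C$ for all $z\in\mathbb D$; (d) $C_\varphi$ has closed range on $L_a^2$; (e) $\mu_\varphi$ is a reverse Carleson measure for $L_a^2$: there is $C>0$ with $\int_{\mathbb D}|f|^2\,d\mu_\varphi\ge C\int_{\mathbb D}|f|^2\,dA$ for all $f\in L_a^2$. -/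

import Mathlib

open MeasureTheory Metric Set Filter Topology
open scoped ENNReal InnerProduct

noncomputable section

namespace Bergman

/-- The open unit disk of the complex plane. -/
abbrev disk : Set ℂ := ball (0 : ℂ) 1

/-- The normalized area measure `dA = (1/π) dx dy` on the open unit disk, regarded as a Borel
measure on `ℂ` that is carried by the disk. -/
def diskArea : Measure ℂ := (ENNReal.ofReal Real.pi)⁻¹ • volume.restrict disk

/-- The Bergman space `L_a^2`, as a subspace of `L^2(𝔻, dA)`: the classes that contain a function
analytic on the disk. It inherits the norm and the inner product of `L^2(𝔻, dA)`. -/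
def bergmanSpace : Submodule ℂ (Lp ℂ 2 diskArea) where
  carrier := {f | ∃ g : ℂ → ℂ, AnalyticOnNhd ℂ g disk ∧ f =ᵐ[diskArea] g}
  add_mem' := by
    rintro f₁ f₂ ⟨g₁, h₁, e₁⟩ ⟨g₂, h₂, e₂⟩
    exact ⟨g₁ + g₂, h₁.add h₂, (Lp.coeFn_add f₁ f₂).trans (e₁.add e₂)⟩
  zero_mem' := ⟨0, fun _ _ => analyticAt_const, Lp.coeFn_zero ℂ 2 diskArea⟩
  smul_mem' := by
    rintro c f ⟨g, h, e⟩
    exact ⟨c • g, fun z hz => analyticAt_const.smul (h z hz),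
      (Lp.coeFn_smul c f).trans (e.const_smul c)⟩

/-- The analytic function on the disk that represents an element of the Bergman space. Its values
on the disk are determined by the element; the values elsewhere are arbitrary and never used. -/
def toFun (f : bergmanSpace) : ℂ → ℂ := f.2.choose

theorem toFun_analytic (f : bergmanSpace) : AnalyticOnNhd ℂ (toFun f) disk := f.2.choose_spec.1

theorem coe_ae_eq_toFun (f : bergmanSpace) : (f : Lp ℂ 2 diskArea) =ᵐ[diskArea] toFun f :=
  f.2.choose_spec.2

/-! ### The Bergman space is a Hilbert space -/

instance : IsProbabilityMeasure diskArea := by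
  constructor
  have h : ENNReal.ofReal Real.pi = (NNReal.pi : ℝ≥0∞) := by
    rw [← NNReal.coe_real_pi, ENNReal.ofReal_coe_nnreal]
  simp only [diskArea, Measure.smul_apply, Measure.restrict_apply_univ, Complex.volume_ball,
    smul_eq_mul, h]
  simp only [ENNReal.ofReal_one, one_pow, one_mul]
  exact ENNReal.inv_mul_cancel (by simp [NNReal.pi_ne_zero]) (by simp)

theorem diskArea_ball {z : ℂ} {r : ℝ} (h : ball z r ⊆ disk) :
    diskArea (ball z r) = ENNReal.ofReal r ^ 2 := by
  have hp : ENNReal.ofReal Real.pi = (NNReal.pi : ℝ≥0∞) := by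
    rw [← NNReal.coe_real_pi, ENNReal.ofReal_coe_nnreal]
  rw [diskArea, Measure.smul_apply, Measure.restrict_apply measurableSet_ball,
    inter_eq_left.2 h, Complex.volume_ball, smul_eq_mul, hp, mul_comm, mul_assoc,
    ENNReal.mul_inv_cancel (by simp [NNReal.pi_ne_zero]) (by simp), mul_one]

theorem enorm_mul_volume_ball_le {g : ℂ → ℂ} {z : ℂ} {r : ℝ}
    (hg : DifferentiableOn ℂ g (ball z r)) :
    ‖g z‖ₑ * volume (ball z r) ≤ ∫⁻ w in ball z r, ‖g w‖ₑ := by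
  have key : ∀ s : ℝ, 0 < s → s < r →
      ∫⁻ _ in Ioo (-Real.pi) Real.pi, ‖g z‖ₑ ≤
      ∫⁻ θ in Ioo (-Real.pi) Real.pi, ‖g (circleMap z s θ)‖ₑ := by
    intro s hs hsr
    have hd : DiffContOnCl ℂ g (ball z |s|) := by
      rw [abs_of_pos hs]
      exact (hg.mono (closedBall_subset_ball hsr)).diffContOnCl_ball subset_rfl
    have h1 := hd.circleAverage
    rw [Real.circleAverage_eq_integral_add (-Real.pi),
      intervalIntegral.integral_comp_add_right (fun θ => g (circleMap z s θ)) (-Real.pi)] at h1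
    have h2 : ∫ θ in Ioo (-Real.pi) Real.pi, g (circleMap z s θ) = (2 * Real.pi) • g z := by
      rw [← h1, smul_smul, mul_inv_cancel₀ (by positivity), one_smul,
        ← integral_Ioc_eq_integral_Ioo, ← intervalIntegral.integral_of_le (by linarith [Real.pi_pos])]
      congr 1 <;> ring
    calc ∫⁻ _ in Ioo (-Real.pi) Real.pi, ‖g z‖ₑ
        = ‖(2 * Real.pi) • g z‖ₑ := by
          rw [setLIntegral_const, Real.volume_Ioo, enorm_smul, mul_comm,
            Real.enorm_eq_ofReal (by positivity)]
          congr 2; ring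
      _ ≤ _ := by
          rw [← h2]
          exact enorm_integral_le_lintegral_enorm _
  have polar : ∀ F : ℂ → ℝ≥0∞, Measurable F → ∫⁻ w, F w =
      ∫⁻ s in Ioi (0 : ℝ), ∫⁻ θ in Ioo (-Real.pi) Real.pi,
        ENNReal.ofReal s * F (circleMap z s θ) := by
    intro F hF
    rw [← lintegral_add_left_eq_self F z, ← Complex.lintegral_comp_polarCoord_symm]
    rw [polarCoord_target, Measure.volume_eq_prod, ← Measure.prod_restrict, lintegral_prod]
    · refine lintegral_congr fun s => lintegral_congr fun θ => ?_
      rw [Complex.polarCoord_symm_apply, smul_eq_mul, circleMap, Complex.exp_mul_I]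
      push_cast
      rfl
    · simp only [Complex.polarCoord_symm_apply, smul_eq_mul]
      fun_prop
  have hgm : Measurable ((ball z r).indicator fun w => ‖g w‖ₑ) := by
    classical
    rw [← piecewise_eq_indicator]
    have hc : ContinuousOn (fun w => ‖g w‖ₑ) (ball z r) :=
      continuous_enorm.comp_continuousOn hg.continuousOn
    exact hc.measurable_piecewise continuousOn_const measurableSet_ball
  rw [← setLIntegral_const, ← lintegral_indicator measurableSet_ball,
    ← lintegral_indicator measurableSet_ball, polar _ hgm,
    polar _ (measurable_const.indicator measurableSet_ball)]
  refine setLIntegral_mono' measurableSet_Ioi fun s hs => ?_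
  have hs : 0 < s := hs
  rw [lintegral_const_mul' _ _ ENNReal.ofReal_ne_top, lintegral_const_mul' _ _ ENNReal.ofReal_ne_top]
  refine mul_le_mul' le_rfl ?_
  by_cases hsr : s < r
  · have hm : ∀ θ, circleMap z s θ ∈ ball z r := fun θ => by
      simpa [mem_ball, dist_eq_norm, circleMap, abs_of_pos hs] using hsr
    simp only [indicator_of_mem (hm _)]
    exact key s hs hsr
  · have hm : ∀ θ, circleMap z s θ ∉ ball z r := fun θ => by
      simpa [mem_ball, dist_eq_norm, circleMap, abs_of_pos hs] using hsr
    simp only [indicator_of_notMem (hm _), le_refl]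

theorem enorm_mul_sq_le {g : ℂ → ℂ} (hg : AnalyticOnNhd ℂ g disk) {z : ℂ} {r : ℝ}
    (h : ball z r ⊆ disk) :
    ‖g z‖ₑ * ENNReal.ofReal r ^ 2 ≤ eLpNorm g 2 diskArea := by
  have hm : AEStronglyMeasurable g diskArea :=
    (hg.continuousOn.aestronglyMeasurable measurableSet_ball).smul_measure _
  refine le_trans ?_ (eLpNorm_le_eLpNorm_of_exponent_le (p := 1) (by norm_num) hm)
  rw [eLpNorm_one_eq_lintegral_enorm, ← diskArea_ball h]
  calc ‖g z‖ₑ * diskArea (ball z r)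
      = (ENNReal.ofReal Real.pi)⁻¹ * (‖g z‖ₑ * volume (ball z r)) := by
        rw [diskArea, Measure.smul_apply, Measure.restrict_apply measurableSet_ball,
          inter_eq_left.2 h, smul_eq_mul]
        ring
    _ ≤ (ENNReal.ofReal Real.pi)⁻¹ * ∫⁻ w in disk, ‖g w‖ₑ := by
        gcongr
        exact (enorm_mul_volume_ball_le (hg.differentiableOn.mono h)).trans
          (lintegral_mono_set h)
    _ = ∫⁻ w, ‖g w‖ₑ ∂diskArea := by
        rw [diskArea, lintegral_smul_measure, smul_eq_mul]

theorem isClosed_bergmanSpace : IsClosed (bergmanSpace : Set (Lp ℂ 2 diskArea)) := by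
  refine IsSeqClosed.isClosed fun f F hf hF => ?_
  choose g hg hfg using hf
  -- pointwise control of differences by the norm
  have hbound : ∀ z : ℂ, ∀ r : ℝ, 0 < r → ball z r ⊆ disk → ∀ m n,
      dist (g m z) (g n z) ≤ dist (f m) (f n) / r ^ 2 := by
    intro z r hr h m n
    have h1 := enorm_mul_sq_le ((hg m).sub (hg n)) h
    have h2 : eLpNorm (g m - g n) 2 diskArea = ENNReal.ofReal (dist (f m) (f n)) := by
      rw [← edist_dist, Lp.edist_def]
      exact eLpNorm_congr_ae ((hfg m).sub (hfg n)).symm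
    rw [h2, ← ofReal_norm, ← ENNReal.ofReal_pow hr.le, ← ENNReal.ofReal_mul (norm_nonneg _),
      ENNReal.ofReal_le_ofReal_iff dist_nonneg] at h1
    rw [le_div_iff₀ (by positivity), dist_eq_norm (g m z)]
    exact h1
  have hc := Metric.cauchySeq_iff.1 hF.cauchySeq
  have hU : ∀ r : ℝ, 0 < r → UniformCauchySeqOn g atTop (ball 0 (1 - r)) := by
    intro r hr
    rw [Metric.uniformCauchySeqOn_iff]
    intro ε hε
    obtain ⟨N, hN⟩ := hc (ε * r ^ 2) (by positivity)
    refine ⟨N, fun m hm n hn z hz => ?_⟩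
    have hsub : ball z r ⊆ disk := by
      refine ball_subset_ball' ?_
      rw [mem_ball] at hz
      linarith
    refine (hbound z r hr hsub m n).trans_lt ?_
    rw [div_lt_iff₀ (by positivity)]
    exact hN m hm n hn
  have hpt : ∀ z ∈ disk, ∃ l, Tendsto (fun n => g n z) atTop (𝓝 l) := by
    intro z hz
    have hz' : dist z 0 < 1 := hz
    have : CauchySeq fun n => g n z :=
      (hU ((1 - dist z 0) / 2) (by linarith)).cauchySeq (by rw [mem_ball]; linarith)
    exact cauchySeq_tendsto_of_complete this
  choose! G hG using hpt
  have hloc : TendstoLocallyUniformlyOn g G atTop disk := by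
    intro u hu z hz
    have hz' : dist z 0 < 1 := hz
    set r := (1 - dist z 0) / 2 with hr
    have hr0 : 0 < r := by rw [hr]; linarith
    have hsub : ball (0 : ℂ) (1 - r) ⊆ disk := ball_subset_ball (by linarith)
    have := (hU r hr0).tendstoUniformlyOn_of_tendsto (f := G) fun x hx => hG x (hsub hx)
    exact ⟨_, mem_nhdsWithin_of_mem_nhds (isOpen_ball.mem_nhds
      (by rw [mem_ball]; linarith)), this u hu⟩
  have hGd : DifferentiableOn ℂ G disk :=
    hloc.differentiableOn (Eventually.of_forall fun n => (hg n).differentiableOn) isOpen_ball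
  refine ⟨G, hGd.analyticOnNhd isOpen_ball, ?_⟩
  obtain ⟨ns, hns, hae⟩ := (tendstoInMeasure_of_tendsto_Lp hF).exists_seq_tendsto_ae
  have hdisk : ∀ᵐ z ∂diskArea, z ∈ disk :=
    Measure.ae_smul_measure (ae_restrict_mem measurableSet_ball) _
  filter_upwards [hae, ae_all_iff.2 hfg, hdisk] with z h1 h2 h3
  simp only [h2] at h1
  exact tendsto_nhds_unique h1 ((hG z h3).comp hns.tendsto_atTop)

instance : CompleteSpace bergmanSpace := isClosed_bergmanSpace.completeSpace_coe

/-- The representing analytic function is unique on the disk. -/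
theorem toFun_eq_of_ae {f : bergmanSpace} {g : ℂ → ℂ} (hg : AnalyticOnNhd ℂ g disk)
    (h : (f : Lp ℂ 2 diskArea) =ᵐ[diskArea] g) : EqOn (toFun f) g disk := by
  have hd : toFun f - g =ᵐ[diskArea] 0 := by
    filter_upwards [coe_ae_eq_toFun f, h] with z h1 h2
    simp [← h1, h2]
  intro z hz
  have hz' : dist z 0 < 1 := hz
  have h1 := enorm_mul_sq_le ((toFun_analytic f).sub hg) (z := z) (r := 1 - dist z 0)
    (ball_subset_ball' (by linarith))
  rw [eLpNorm_congr_ae hd, eLpNorm_zero, nonpos_iff_eq_zero, mul_eq_zero] at h1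
  rcases h1 with h1 | h1
  · simpa [sub_eq_zero] using h1
  · have := pow_eq_zero_iff (two_ne_zero) |>.1 h1
    rw [ENNReal.ofReal_eq_zero] at this
    linarith

/-- An element of the Bergman space is determined by its values on the disk. -/
theorem ext_of_eqOn {f g : bergmanSpace} (h : EqOn (toFun f) (toFun g) disk) : f = g := by
  refine Subtype.ext (Lp.ext ?_)
  have hdisk : ∀ᵐ z ∂diskArea, z ∈ disk :=
    Measure.ae_smul_measure (ae_restrict_mem measurableSet_ball) _
  filter_upwards [coe_ae_eq_toFun f, coe_ae_eq_toFun g, hdisk] with z h1 h2 h3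
  rw [h1, h2, h h3]

/-! ### Operators -/

/-- `C` is the composition operator `C_φ` on the Bergman space: `C f = f ∘ φ`. -/
def IsCompositionOperator (φ : ℂ → ℂ) (C : bergmanSpace →L[ℂ] bergmanSpace) : Prop :=
  ∀ f : bergmanSpace, ∀ z ∈ disk, toFun (C f) z = toFun f (φ z)

/-- `T` is the Toeplitz operator `T_μ` on the Bergman space:
`T f (z) = ∫ f(w) / (1 - z w̄)^2 dμ(w)`, where the integrals exist. -/
def IsToeplitzOperator (μ : Measure ℂ) (T : bergmanSpace →L[ℂ] bergmanSpace) : Prop :=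
  ∀ f : bergmanSpace, ∀ z ∈ disk,
    IntegrableOn (fun w => toFun f w / (1 - z * starRingEnd ℂ w) ^ 2) disk μ ∧
    toFun (T f) z = ∫ w in disk, toFun f w / (1 - z * starRingEnd ℂ w) ^ 2 ∂μ

/-- There is at most one composition operator with a given symbol. -/
theorem IsCompositionOperator.unique {φ : ℂ → ℂ} {C C' : bergmanSpace →L[ℂ] bergmanSpace}
    (h : IsCompositionOperator φ C) (h' : IsCompositionOperator φ C') : C = C' :=
  ContinuousLinearMap.ext fun f => ext_of_eqOn fun z hz => by rw [h f z hz, h' f z hz]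

/-- There is at most one Toeplitz operator with a given symbol. -/
theorem IsToeplitzOperator.unique {μ : Measure ℂ} {T T' : bergmanSpace →L[ℂ] bergmanSpace}
    (h : IsToeplitzOperator μ T) (h' : IsToeplitzOperator μ T') : T = T' :=
  ContinuousLinearMap.ext fun f => ext_of_eqOn fun z hz => by rw [(h f z hz).2, (h' f z hz).2]

/-! ### Measures -/

/-- The pull-back measure `μ_φ(E) = A(φ⁻¹(E))` of the normalized area measure on the disk. -/
def pullbackArea (φ : ℂ → ℂ) : Measure ℂ := diskArea.map φ

/-- The reproducing kernel `K_z(w) = 1 / (1 - z̄ w)^2` of the Bergman space. -/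
def kernel (z w : ℂ) : ℂ := 1 / (1 - starRingEnd ℂ z * w) ^ 2

/-- The norm of `K_z` in `L^2(𝔻, dA)`. -/
def kernelNorm (z : ℂ) : ℝ := Real.sqrt (∫ w in disk, ‖kernel z w‖ ^ 2 ∂diskArea)

/-- The normalized reproducing kernel `k_z = K_z / ‖K_z‖`. -/
def normalizedKernel (z w : ℂ) : ℂ := kernel z w / (kernelNorm z : ℂ)

/-- The Berezin transform of a finite positive measure on the disk. -/
def berezin (μ : Measure ℂ) (z : ℂ) : ℝ := ∫ w in disk, ‖normalizedKernel z w‖ ^ 2 ∂μ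

/-- The Möbius transform `φ_w(z) = (w - z) / (1 - w̄ z)`. -/
def moebius (w z : ℂ) : ℂ := (w - z) / (1 - starRingEnd ℂ w * z)

/-- The pseudo-hyperbolic distance on the disk. -/
def pseudoDist (z w : ℂ) : ℝ := ‖moebius w z‖

/-- The pseudo-hyperbolic disk `E(w, r)` with center `w` and radius `r`. -/
def pseudoDisk (w : ℂ) (r : ℝ) : Set ℂ := {z ∈ disk | pseudoDist w z < r}

/-- The Berezin transform of `μ` is bounded below on the disk. -/
def BerezinBoundedBelow (μ : Measure ℂ) : Prop :=
  ∃ δ : ℝ, 0 < δ ∧ ∀ z ∈ disk, δ ≤ berezin μ z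

/-- The reverse Carleson condition: for some `r ∈ (0, 1)` and `C > 0`,
`C⁻¹ ≤ μ(E(z, r)) / A(E(z, r)) ≤ C` for all `z` in the disk. -/
def ReverseCarlesonCondition (μ : Measure ℂ) : Prop :=
  ∃ r : ℝ, 0 < r ∧ r < 1 ∧ ∃ C : ℝ, 0 < C ∧ ∀ z ∈ disk,
    ENNReal.ofReal C⁻¹ ≤ μ (pseudoDisk z r) / diskArea (pseudoDisk z r) ∧
    μ (pseudoDisk z r) / diskArea (pseudoDisk z r) ≤ ENNReal.ofReal C

/-- `μ` is a reverse Carleson measure for the Bergman space: for some `C > 0`,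
`∫ |f|^2 dμ ≥ C ∫ |f|^2 dA` for all `f` in the Bergman space. -/
def IsReverseCarleson (μ : Measure ℂ) : Prop :=
  ∃ C : ℝ, 0 < C ∧ ∀ f : bergmanSpace,
    ENNReal.ofReal C * ∫⁻ z in disk, ‖toFun f z‖ₑ ^ 2 ∂diskArea ≤
      ∫⁻ z in disk, ‖toFun f z‖ₑ ^ 2 ∂μ

end Bergman

end

namespace Bergman

/-! Call `∫ (1 - |w|)² / |1 - w̄ φ|⁴ dA` the kernel mass at w. Since ‖K_w‖² is comparable to (1 -
|w|)⁻², it is comparable to the Berezin transform of μ_φ. As T = C*C and ‖C f‖² = ∫ |f|² dμ_φ,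
conditions (a), (d), (e) all say that C is bounded below (for (d) because C is injective), while (b)
and (c) both say that the kernel masses are bounded below. Testing C on kernels gives one
implication between the two groups; the substance is the converse,
`exists_lintegral_le_lintegral_comp`.

Upper estimates come from the real part of (1 + w̄ φ)/(1 - w̄ φ), which is harmonic: with
Schwarz–Pick it bounds the circular means of |1 - w̄ φ|⁻². Hence little kernel mass sits where 1 -
|z| ≤ κ(1 - |w|), or, off that set, where φ(z) is hyperbolically far from w. This yields boundedness
of C, and it localizes a lower bound: for each w some z has φ(z) hyperbolically close to w and 1 -
|z| > κ(1 - |w|).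

Moving such a z inward until its distance to the circle has grown by a fixed factor forces φ, by
Schwarz–Pick, to move by at least 1 - |w|. So on the way there is a point q with φ(q) near w and
|φ'(q)| bounded below (`exists_le_norm_deriv_near`). A quantitative open mapping theorem then makes
φ cover a disc of radius comparable to 1 - |w| about φ(q), on which |f| is controlled by f ∘ φ near
q. A three circles argument propagates smallness from that disc to w: either |f(w)|² is at most ε
times a local mean of |f|², or at most A times a local mean of |f ∘ φ|²
(`exists_enorm_sq_le_or_le`). Integrating in w and absorbing the ε-term gives the lower bound for C.
-/

/-! ### Function theory: Schwarz–Pick, open mapping, propagation of smallness -/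

theorem norm_one_sub_conj_mul_sq_sub (a z : ℂ) :
    ‖1 - starRingEnd ℂ a * z‖ ^ 2 - ‖a - z‖ ^ 2 = (1 - ‖a‖ ^ 2) * (1 - ‖z‖ ^ 2) := by
  simp only [← Complex.normSq_eq_norm_sq, Complex.normSq_apply, Complex.sub_re, Complex.sub_im,
    Complex.mul_re, Complex.mul_im, Complex.conj_re, Complex.conj_im, Complex.one_re,
    Complex.one_im]
  ring

theorem one_sub_conj_mul_ne_zero {a z : ℂ} (ha : ‖a‖ < 1) (hz : ‖z‖ ≤ 1) :
    1 - starRingEnd ℂ a * z ≠ 0 := by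
  intro h
  have h1 : ‖starRingEnd ℂ a * z‖ = 1 := by rw [← sub_eq_zero.1 h, norm_one]
  rw [norm_mul, RCLike.norm_conj] at h1
  nlinarith [norm_nonneg a, norm_nonneg z]

/-- A consequence of the Schwarz–Pick lemma. -/
theorem exists_mul_one_sub_norm_le {φ : ℂ → ℂ} (hφ : DifferentiableOn ℂ φ disk)
    (hm : MapsTo φ disk disk) :
    ∃ c : ℝ, 0 < c ∧ c ≤ 1 ∧ ∀ z ∈ disk, c * (1 - ‖z‖) ≤ 1 - ‖φ z‖ := by
  set a := φ 0 with ha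
  have ha1 : ‖a‖ < 1 := by simpa using hm (mem_ball_self one_pos : (0 : ℂ) ∈ disk)
  have hn := norm_nonneg a
  -- The Schwarz lemma for (a - φ)/(1 - ā φ), which vanishes at 0, leads to `h7`; bounding 1 + |a|
  -- and 1 + |φ z| by 2 there produces the 4.
  refine ⟨(1 - ‖a‖) / 4, by linarith, by linarith, fun z hz => ?_⟩
  have hz1 : ‖z‖ < 1 := by simpa using hz
  have hφn : ∀ x ∈ disk, ‖φ x‖ < 1 := fun x hx => by simpa using hm hx
  have hne : ∀ x ∈ disk, 1 - starRingEnd ℂ a * φ x ≠ 0 := fun x hx =>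
    one_sub_conj_mul_ne_zero ha1 (hφn x hx).le
  have key : ∀ x ∈ disk, ‖a - φ x‖ ≤ ‖1 - starRingEnd ℂ a * φ x‖ := fun x hx => by
    have h1 := norm_one_sub_conj_mul_sq_sub a (φ x)
    have h2 : 0 ≤ (1 - ‖a‖ ^ 2) * (1 - ‖φ x‖ ^ 2) :=
      mul_nonneg (by nlinarith) (by nlinarith [hφn x hx, norm_nonneg (φ x)])
    exact (sq_le_sq₀ (norm_nonneg _) (norm_nonneg _)).1 (by linarith)
  have h1 : ‖(a - φ z) / (1 - starRingEnd ℂ a * φ z)‖ ≤ ‖z‖ := by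
    refine Complex.norm_le_norm_of_mapsTo_ball (R := 1)
      (f := fun x => (a - φ x) / (1 - starRingEnd ℂ a * φ x)) ?_ ?_ ?_ hz1
    · exact (hφ.const_sub _).div ((hφ.const_mul _).const_sub _) hne
    · intro x hx
      rw [mem_closedBall_zero_iff, norm_div]
      exact div_le_one_of_le₀ (key x hx) (norm_nonneg _)
    · simp [← ha]
  rw [norm_div, div_le_iff₀ (norm_pos_iff.2 (hne z hz))] at h1
  have h2 := norm_one_sub_conj_mul_sq_sub a (φ z)
  have h3 : 1 - ‖a‖ ≤ ‖1 - starRingEnd ℂ a * φ z‖ := by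
    have := norm_sub_norm_le 1 (starRingEnd ℂ a * φ z)
    rw [norm_one, norm_mul, RCLike.norm_conj] at this
    nlinarith [hφn z hz]
  have h4 : ‖a - φ z‖ ^ 2 ≤ ‖z‖ ^ 2 * ‖1 - starRingEnd ℂ a * φ z‖ ^ 2 := by
    rw [← mul_pow]; gcongr
  have h5 : (1 - ‖z‖ ^ 2) * (1 - ‖a‖) ^ 2 ≤ (1 - ‖a‖ ^ 2) * (1 - ‖φ z‖ ^ 2) := by
    rw [← h2]
    have : (1 - ‖a‖) ^ 2 ≤ ‖1 - starRingEnd ℂ a * φ z‖ ^ 2 := by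
      gcongr
    have h6 : 0 ≤ 1 - ‖z‖ ^ 2 := by nlinarith [norm_nonneg z]
    nlinarith [mul_le_mul_of_nonneg_left this h6]
  have h7 : (1 - ‖z‖ ^ 2) * (1 - ‖a‖) ≤ (1 + ‖a‖) * (1 - ‖φ z‖ ^ 2) := by
    have : 0 < 1 - ‖a‖ := by linarith
    refine le_of_mul_le_mul_left ?_ this
    nlinarith
  have h8 : 1 - ‖z‖ ≤ 1 - ‖z‖ ^ 2 := by nlinarith [norm_nonneg z]
  have h9 : 1 - ‖φ z‖ ^ 2 ≤ 2 * (1 - ‖φ z‖) := by nlinarith [norm_nonneg (φ z), hφn z hz]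
  have h10 : 0 ≤ 1 - ‖φ z‖ ^ 2 := by nlinarith [norm_nonneg (φ z), hφn z hz]
  nlinarith [mul_le_mul_of_nonneg_right h8 (by linarith : 0 ≤ 1 - ‖a‖)]

/-- A function with values in the disk has controlled oscillation. -/
theorem norm_sub_le_two_mul {φ : ℂ → ℂ} {q : ℂ} {ρ : ℝ} (hφ : DifferentiableOn ℂ φ (ball q ρ))
    (hm : MapsTo φ (ball q ρ) disk) {x : ℂ} (hx : x ∈ ball q ρ) (hx2 : ‖x - q‖ ≤ ρ / 2) :
    ‖φ x - φ q‖ ≤ 2 * (1 - ‖φ q‖) := by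
  have hρ : 0 < ρ := pos_of_mem_ball hx
  have hq1 : ‖φ q‖ < 1 := by simpa using hm (mem_ball_self hρ)
  -- After rotating φ(q) to a nonnegative number, Re(e(φ - φ(q))) ≤ 1 - |φ(q)|. Borel–Carathéodory
  -- needs only this one-sided bound, and its factor 2|x - q|/(ρ - |x - q|) is at most 2 on the half
  -- ball.
  obtain ⟨e, he, hee⟩ : ∃ e : ℂ, ‖e‖ = 1 ∧ e * φ q = ‖φ q‖ := by
    by_cases h : φ q = 0
    · exact ⟨1, by simp, by simp [h]⟩
    · have h0 : (‖φ q‖ : ℂ) ≠ 0 := by simpa using h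
      refine ⟨starRingEnd ℂ (φ q) / ‖φ q‖, by simp [h], ?_⟩
      rw [div_mul_eq_mul_div, ← Complex.normSq_eq_conj_mul_self, Complex.normSq_eq_norm_sq]
      field_simp
      push_cast
      ring
  have hmem : ∀ y ∈ ball (0 : ℂ) ρ, q + y ∈ ball q ρ := fun y hy => by simpa using hy
  have h := Complex.borelCaratheodory_zero (f := fun y => e * (φ (q + y) - φ q)) (R := ρ)
    (M := 1 - ‖φ q‖) (z := x - q) (by linarith) ?_ ?_ hρ (by simpa [dist_eq_norm] using hx) (by simp)
  · simp only [add_sub_cancel, norm_mul, he, one_mul] at h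
    refine h.trans ?_
    rw [div_le_iff₀ (by linarith)]
    have : 0 ≤ 2 * (1 - ‖φ q‖) := by linarith
    rw [mul_assoc, mul_assoc]
    nlinarith
  · refine DifferentiableOn.const_mul (DifferentiableOn.sub_const (c := φ q)
      (hφ.comp (f := fun y => q + y) (by fun_prop) hmem)) _
  · intro y hy
    have h1 : ‖φ (q + y)‖ < 1 := by simpa using hm (hmem y hy)
    have h2 := Complex.re_le_norm (e * φ (q + y))
    rw [norm_mul, he, one_mul] at h2
    simp only [mem_ofPred_eq, mul_sub, hee, Complex.sub_re, Complex.ofReal_re]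
    linarith

/-- A quantitative open mapping theorem. -/
theorem ball_subset_image_of_le_norm_deriv {φ : ℂ → ℂ} {q : ℂ} {R K c : ℝ} (hR : 0 < R)
    (hφ : DifferentiableOn ℂ φ (ball q R)) (hK : ∀ x ∈ ball q R, ‖φ x - φ q‖ ≤ K) (hc : 0 < c)
    (hd : c ≤ ‖deriv φ q‖) :
    0 < K ∧ c * R ^ 2 / (6 * K) ≤ R / 6 ∧
    ball (φ q) (c ^ 2 * R ^ 2 / (24 * K)) ⊆ φ '' closedBall q (c * R ^ 2 / (6 * K)) := by
  have hmaps : MapsTo φ (ball q R) (closedBall (φ q) K) := fun x hx => by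
    rw [mem_closedBall, dist_eq_norm]; exact hK x hx
  have hslope := fun x hx => Complex.norm_dslope_le_div_of_mapsTo_ball hφ hmaps (z := x) hx
  have hq : q ∈ ball q R := mem_ball_self hR
  have hcK : c ≤ K / R := by
    have := hslope q hq
    rw [dslope_same] at this
    linarith
  have hKpos : 0 < K := by
    have := hc.trans_le hcK
    exact (div_pos_iff_of_pos_right hR).1 this
  rw [le_div_iff₀ hR] at hcK
  have hs6 : c * R ^ 2 / (6 * K) ≤ R / 6 := by
    rw [div_le_div_iff₀ (by positivity) (by positivity)]
    nlinarith
  refine ⟨hKpos, hs6, ?_⟩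
  set s := c * R ^ 2 / (6 * K) with hs
  have hspos : 0 < s := by positivity
  have hdiff : DifferentiableOn ℂ (dslope φ q) (ball q R) :=
    (Complex.differentiableOn_dslope (ball_mem_nhds q hR)).2 hφ
  have hsub : closedBall q s ⊆ ball q R := closedBall_subset_ball (by linarith)
  -- The difference quotient is bounded by K/R, so it differs from its value at q by at most 2K/R; a
  -- Schwarz estimate keeps it within 2Ks/R² = c/3 of φ'(q) on the sphere. This is where s comes
  -- from.
  have hlow : ∀ x ∈ sphere q s, c / 2 * s ≤ ‖φ x - φ q‖ := by
    intro x hx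
    have hx' : x ∈ ball q R := hsub (sphere_subset_closedBall hx)
    have h1 : dist (dslope φ q x) (dslope φ q q) ≤ (2 * (K / R)) / R * dist x q := by
      refine Complex.dist_le_div_mul_dist_of_mapsTo_ball hdiff (fun y hy => ?_) hx'
      rw [mem_closedBall, dist_eq_norm]
      have := norm_sub_le (dslope φ q y) (dslope φ q q)
      have := hslope y hy
      have := hslope q hq
      linarith
    rw [mem_sphere] at hx
    rw [hx, dist_eq_norm, dslope_same] at h1
    have h2 : 2 * (K / R) / R * s = c / 3 := by rw [hs]; field_simp; norm_num
    have h3 : c / 2 ≤ ‖dslope φ q x‖ := by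
      have := norm_sub_norm_le (deriv φ q) (dslope φ q x)
      rw [norm_sub_rev] at this
      linarith
    have hne : x ≠ q := fun h => by simp [h] at hx; linarith
    have h4 := sub_smul_dslope φ q x
    rw [← h4, norm_smul, ← dist_eq_norm x q, hx, mul_comm]
    gcongr
  -- The covered radius is half of cs/2, that is c²R²/(24K).
  have h5 := (hφ.diffContOnCl_ball hsub).ball_subset_image_closedBall hspos hlow ?_
  · refine (ball_subset_ball (le_of_eq ?_)).trans h5
    rw [hs]; field_simp; norm_num
  · have hqd : HasDerivAt φ (deriv φ q) q := (hφ.differentiableAt (ball_mem_nhds q hR)).hasDerivAt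
    have hne : deriv φ q ≠ 0 := norm_pos_iff.1 (hc.trans_le hd)
    exact (hqd.eventually_ne hne (c := φ q)).frequently.filter_mono nhdsWithin_le_nhds

/-- A weak form of Hadamard's three circles theorem. -/
theorem norm_le_four_mul_sqrt {f : ℂ → ℂ} {a : ℂ} {r R m M : ℝ} (hr : 0 < r) (hR : 4 * r < R)
    (hf : DifferentiableOn ℂ f (ball a R)) (hM : ∀ x ∈ closedBall a (4 * r), ‖f x‖ ≤ M)
    (hm : ∀ x ∈ closedBall a r, ‖f x‖ ≤ m) {x : ℂ} (hx : ‖x - a‖ ≤ 3 / 2 * r) :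
    ‖f x‖ ≤ 4 * √(m * M) := by
  have hs := Complex.hasSum_taylorSeries_on_ball hf (z := x)
    (by rw [mem_ball, dist_eq_norm]; linarith)
  have hm0 : 0 ≤ m := (norm_nonneg _).trans (hm a (mem_closedBall_self hr.le))
  have hM0 : 0 ≤ M := (norm_nonneg _).trans (hM a (mem_closedBall_self (by linarith)))
  have hterm : ∀ n : ℕ, ‖(n.factorial : ℂ)⁻¹ • (x - a) ^ n • iteratedDeriv n f a‖
      ≤ √(m * M) * (3 / 4) ^ n := by
    intro n
    have h1 := Complex.norm_iteratedDeriv_le_of_forall_mem_sphere_norm_le n hr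
      (hf.diffContOnCl_ball (closedBall_subset_ball (by linarith)))
      (fun z hz => hm z (sphere_subset_closedBall hz))
    have h2 := Complex.norm_iteratedDeriv_le_of_forall_mem_sphere_norm_le n
      (by linarith : 0 < 4 * r)
      (hf.diffContOnCl_ball (closedBall_subset_ball hR))
      (fun z hz => hM z (sphere_subset_closedBall hz))
    have hfac : (0 : ℝ) < n.factorial := by positivity
    -- Geometric mean of the Cauchy estimates on the circles of radii r and 4r. For |x - a| ≤ 3r/2
    -- the Taylor series is then dominated by a geometric series of ratio 3/4, whose sum is 4.
    have h3 : ‖iteratedDeriv n f a‖ / n.factorial ≤ √(m * M) / (2 * r) ^ n := by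
      rw [div_le_div_iff₀ hfac (by positivity)]
      refine abs_le_of_sq_le_sq' (a := ‖iteratedDeriv n f a‖ * (2 * r) ^ n) ?_ (by positivity) |>.2
      rw [le_div_iff₀ (by positivity)] at h1 h2
      have h4 := mul_le_mul h1 h2 (by positivity) (by positivity)
      have h5 : ((2 * r) ^ n) ^ 2 = r ^ n * (4 * r) ^ n := by
        rw [← pow_mul, mul_comm n 2, pow_mul, ← mul_pow]; ring
      rw [mul_pow, h5, mul_pow (√(m * M)), Real.sq_sqrt (by positivity)]
      nlinarith
    rw [norm_smul, norm_smul, norm_inv, norm_pow, Complex.norm_natCast]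
    calc (n.factorial : ℝ)⁻¹ * (‖x - a‖ ^ n * ‖iteratedDeriv n f a‖)
        = ‖x - a‖ ^ n * (‖iteratedDeriv n f a‖ / n.factorial) := by ring
      _ ≤ (3 / 2 * r) ^ n * (√(m * M) / (2 * r) ^ n) := by gcongr
      _ = √(m * M) * (3 / 4) ^ n := by
        rw [mul_comm (√(m * M)), ← mul_div_assoc, mul_comm, mul_div_assoc, ← div_pow, mul_comm]
        congr 2
        field_simp
        norm_num
  have hg : HasSum (fun n : ℕ => √(m * M) * (3 / 4 : ℝ) ^ n) (√(m * M) * 4) := by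
    have := (hasSum_geometric_of_lt_one (r := (3 / 4 : ℝ)) (by norm_num) (by norm_num)).mul_left
      (√(m * M))
    norm_num at this ⊢
    exact this
  rw [← hs.tsum_eq, mul_comm]
  exact tsum_of_norm_bounded hg hterm

/-- Propagation of smallness along a segment. -/
theorem exists_norm_le_mul_of_segment (N : ℕ) {ε : ℝ} (hε : 0 < ε) :
    ∃ η : ℝ, 0 < η ∧ ∀ (f : ℂ → ℂ) (a b : ℂ) (r M : ℝ), 0 < r → ‖b - a‖ ≤ N * (r / 2) →
      (∀ x ∈ segment ℝ a b, DifferentiableOn ℂ f (ball x (5 * r))) →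
      (∀ x ∈ segment ℝ a b, ∀ y ∈ closedBall x (4 * r), ‖f y‖ ≤ M) →
      (∀ x ∈ closedBall a r, ‖f x‖ ≤ η * M) → ‖f b‖ ≤ ε * M := by
  induction N with
  | zero =>
    refine ⟨ε, hε, fun f a b r M hr hab _ _ h => ?_⟩
    have : b = a := by
      simpa [sub_eq_zero] using hab
    exact this ▸ h a (mem_closedBall_self hr.le)
  | succ N ih =>
    obtain ⟨η, hη, h⟩ := ih
    -- Chosen so that 4√((η/4)²M · M) = ηM, the threshold for the remaining N steps. A step advances
    -- by at most r/2, so the closed r-ball about the new point lies within 3r/2 of the old one.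
    refine ⟨(η / 4) ^ 2, by positivity, fun f a b r M hr hab hd hM hm => ?_⟩
    set t : ℝ := 1 / (N + 1) with ht
    have ht1 : t ≤ 1 := by rw [ht, div_le_one (by positivity)]; linarith [N.cast_nonneg (α := ℝ)]
    have ht0 : 0 ≤ t := by positivity
    set a' := AffineMap.lineMap a b t with ha'
    have hmem : a' ∈ segment ℝ a b := by
      rw [segment_eq_image_lineMap]; exact ⟨t, ⟨ht0, ht1⟩, rfl⟩
    have hsub : segment ℝ a' b ⊆ segment ℝ a b :=
      (convex_segment a b).segment_subset hmem (right_mem_segment ℝ a b)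
    have h1 : dist a' a = t * ‖b - a‖ := by
      rw [ha', dist_lineMap_left, Real.norm_of_nonneg ht0, dist_comm, dist_eq_norm]
    have h2 : dist a' b = (1 - t) * ‖b - a‖ := by
      rw [ha', dist_lineMap_right, Real.norm_of_nonneg (by linarith), dist_comm, dist_eq_norm]
    have hM0 : 0 ≤ M := (norm_nonneg _).trans
      (hM a (left_mem_segment ℝ a b) a (mem_closedBall_self (by linarith)))
    push_cast at hab
    refine h f a' b r M hr ?_ (fun x hx => hd x (hsub hx)) (fun x hx => hM x (hsub hx)) ?_
    · rw [← dist_eq_norm, dist_comm, h2]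
      have : 1 - t = N / (N + 1) := by rw [ht]; field_simp; ring
      rw [this, div_mul_eq_mul_div, div_le_iff₀ (by positivity)]
      nlinarith [N.cast_nonneg (α := ℝ)]
    · intro x hx
      have h3 : dist a' a ≤ r / 2 := by
        rw [h1, ht, div_mul_eq_mul_div, div_le_iff₀ (by positivity)]
        linarith
      have h4 : ‖x - a‖ ≤ 3 / 2 * r := by
        rw [← dist_eq_norm]
        linarith [dist_triangle x a' a, mem_closedBall.1 hx]
      refine (norm_le_four_mul_sqrt hr (R := 5 * r) (by linarith)
        (hd a (left_mem_segment ℝ a b)) (hM a (left_mem_segment ℝ a b)) hm h4).trans ?_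
      rw [mul_assoc, ← sq, ← mul_pow, Real.sqrt_sq (by positivity)]
      linarith

/-! ### Area integrals, sub-mean values and polar coordinates -/

theorem ae_mem_disk : ∀ᵐ z ∂diskArea, z ∈ disk :=
  Measure.ae_smul_measure (ae_restrict_mem measurableSet_ball) _

theorem setLIntegral_disk (F : ℂ → ℝ≥0∞) : ∫⁻ z in disk, F z ∂diskArea = ∫⁻ z, F z ∂diskArea := by
  rw [Measure.restrict_eq_self_of_ae_mem ae_mem_disk]

theorem diskArea_ball_le (z : ℂ) (r : ℝ) : diskArea (ball z r) ≤ ENNReal.ofReal r ^ 2 := by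
  have hp : ENNReal.ofReal Real.pi = (NNReal.pi : ℝ≥0∞) := by
    rw [← NNReal.coe_real_pi, ENNReal.ofReal_coe_nnreal]
  calc diskArea (ball z r) ≤ (ENNReal.ofReal Real.pi)⁻¹ * volume (ball z r) := by
        rw [diskArea, Measure.smul_apply, smul_eq_mul]
        exact mul_le_mul' le_rfl (Measure.restrict_apply_le _ _)
    _ = _ := by
        rw [Complex.volume_ball, hp, mul_comm, mul_assoc,
          ENNReal.mul_inv_cancel (by simp [NNReal.pi_ne_zero]) (by simp), mul_one]

/-- The sub-mean value property of `|f|^2`. -/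
theorem enorm_sq_mul_le_setLIntegral {f : ℂ → ℂ} {z : ℂ} {r : ℝ}
    (hf : DifferentiableOn ℂ f (ball z r)) (h : ball z r ⊆ disk) :
    ‖f z‖ₑ ^ 2 * ENNReal.ofReal r ^ 2 ≤ ∫⁻ w in ball z r, ‖f w‖ₑ ^ 2 ∂diskArea := by
  have h1 := enorm_mul_volume_ball_le (hf.mul hf)
  rw [← diskArea_ball h]
  calc ‖f z‖ₑ ^ 2 * diskArea (ball z r)
      = (ENNReal.ofReal Real.pi)⁻¹ * (‖(f * f) z‖ₑ * volume (ball z r)) := by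
        rw [diskArea, Measure.smul_apply, Measure.restrict_apply measurableSet_ball,
          inter_eq_left.2 h, smul_eq_mul, Pi.mul_apply, enorm_mul]
        ring
    _ ≤ (ENNReal.ofReal Real.pi)⁻¹ * ∫⁻ w in ball z r, ‖(f * f) w‖ₑ := by gcongr
    _ = _ := by
        rw [diskArea, Measure.restrict_smul, lintegral_smul_measure, smul_eq_mul,
          Measure.restrict_restrict measurableSet_ball, inter_eq_left.2 h]
        simp only [Pi.mul_apply, enorm_mul, sq]

/-- Integration over the disk in polar coordinates. -/
theorem lintegral_diskArea_eq_polar {F : ℂ → ℝ≥0∞} (hF : Measurable F) :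
    ∫⁻ z, F z ∂diskArea = (ENNReal.ofReal Real.pi)⁻¹ * ∫⁻ s in Ioo (0 : ℝ) 1,
      ENNReal.ofReal s * ∫⁻ θ in Ioo (-Real.pi) Real.pi, F (circleMap 0 s θ) := by
  rw [diskArea, lintegral_smul_measure, smul_eq_mul]
  congr 1
  rw [← lintegral_indicator measurableSet_ball, ← Complex.lintegral_comp_polarCoord_symm,
    polarCoord_target, Measure.volume_eq_prod, ← Measure.prod_restrict, lintegral_prod]
  · have hI : Ioo (0 : ℝ) 1 = Ioi 0 ∩ Iio 1 := rfl
    rw [hI, inter_comm, ← Measure.restrict_restrict measurableSet_Iio,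
      ← lintegral_indicator measurableSet_Iio]
    refine setLIntegral_congr_fun measurableSet_Ioi fun s hs => ?_
    have hs : 0 < s := hs
    have h0 : ∀ θ, Complex.polarCoord.symm (s, θ) = circleMap 0 s θ := fun θ => by
      rw [Complex.polarCoord_symm_apply, circleMap, Complex.exp_mul_I]
      push_cast
      ring
    simp only [h0, smul_eq_mul]
    rw [lintegral_const_mul' _ _ ENNReal.ofReal_ne_top]
    by_cases hs1 : s < 1
    · rw [indicator_of_mem (show s ∈ Iio 1 from hs1)]
      have hm : ∀ θ, circleMap 0 s θ ∈ disk := fun θ => by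
        simpa [circleMap, abs_of_pos hs] using hs1
      simp only [indicator_of_mem (hm _)]
    · rw [indicator_of_notMem (show s ∉ Iio 1 from hs1)]
      have hm : ∀ θ, circleMap 0 s θ ∉ disk := fun θ => by
        simpa [circleMap, abs_of_pos hs] using hs1
      simp only [indicator_of_notMem (hm _), lintegral_zero, mul_zero]
  · have := hF.indicator (measurableSet_ball (x := (0 : ℂ)) (ε := 1))
    simp only [Complex.polarCoord_symm_apply, smul_eq_mul]
    fun_prop

/-- The mean value property on circles about the origin. -/
theorem setIntegral_circleMap_eq {h : ℂ → ℂ} (hh : DifferentiableOn ℂ h disk) {s : ℝ}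
    (hs : 0 < s) (hs1 : s < 1) :
    ∫ θ in Ioo (-Real.pi) Real.pi, h (circleMap 0 s θ) = (2 * Real.pi) • h 0 := by
  have hd : DiffContOnCl ℂ h (ball 0 |s|) := by
    rw [abs_of_pos hs]
    exact (hh.mono (closedBall_subset_ball hs1)).diffContOnCl_ball subset_rfl
  have h1 := hd.circleAverage
  rw [Real.circleAverage_eq_integral_add (-Real.pi),
    intervalIntegral.integral_comp_add_right (fun θ => h (circleMap 0 s θ)) (-Real.pi)] at h1
  rw [← h1, smul_smul, mul_inv_cancel₀ (by positivity), one_smul,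
    ← integral_Ioc_eq_integral_Ioo, ← intervalIntegral.integral_of_le (by linarith [Real.pi_pos])]
  congr 1 <;> ring

theorem continuous_comp_circleMap {h : ℂ → ℂ} (hh : ContinuousOn h disk) {s : ℝ}
    (hs : 0 < s) (hs1 : s < 1) : Continuous fun θ => h (circleMap 0 s θ) :=
  hh.comp_continuous (continuous_circleMap 0 s) fun θ => by
    simpa [circleMap, abs_of_pos hs] using hs1

/-! ### Upper estimates for kernel masses, and boundedness of composition -/

theorem one_sub_norm_le_norm_one_sub {w z : ℂ} (hz : ‖z‖ ≤ 1) :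
    1 - ‖w‖ ≤ ‖1 - starRingEnd ℂ w * z‖ := by
  have := norm_sub_norm_le 1 (starRingEnd ℂ w * z)
  rw [norm_one, norm_mul, RCLike.norm_conj] at this
  nlinarith [norm_nonneg w]

/-- Circular means of `|1 - w̄ φ|⁻²`. -/
theorem exists_setLIntegral_circleMap_le {φ : ℂ → ℂ} (hφ : DifferentiableOn ℂ φ disk)
    (hm : MapsTo φ disk disk) :
    ∃ C : ℝ, 0 < C ∧ ∀ w ∈ disk, ∀ s : ℝ, 0 < s → s < 1 →
      ∫⁻ θ in Ioo (-Real.pi) Real.pi,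
        ENNReal.ofReal ((‖1 - starRingEnd ℂ w * φ (circleMap 0 s θ)‖ ^ 2)⁻¹) ≤
      ENNReal.ofReal (Real.pi * (C / ((1 - ‖w‖) + (1 - s)))) := by
  obtain ⟨c, hc, hc1, hcφ⟩ := exists_mul_one_sub_norm_le hφ hm
  have hφn : ∀ x ∈ disk, ‖φ x‖ < 1 := fun x hx => by simpa using hm hx
  have h0 : ‖φ 0‖ < 1 := hφn 0 (mem_ball_self one_pos)
  have h0' : 0 < 1 - ‖φ 0‖ := by linarith
  refine ⟨2 * (2 / c) * (2 / (1 - ‖φ 0‖)), by positivity, fun w hw s hs hs1 => ?_⟩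
  have hw1 : ‖w‖ < 1 := by simpa using hw
  -- Re h = (1 - |w̄ φ|²)/|1 - w̄ φ|² is harmonic, so its circular means equal Re h(0), which is
  -- bounded uniformly in w.
  set h : ℂ → ℂ := fun z => (1 + starRingEnd ℂ w * φ z) / (1 - starRingEnd ℂ w * φ z) with hh
  have hne : ∀ x ∈ disk, 1 - starRingEnd ℂ w * φ x ≠ 0 := fun x hx =>
    one_sub_conj_mul_ne_zero hw1 (hφn x hx).le
  have hd : DifferentiableOn ℂ h disk :=
    ((hφ.const_mul _).const_add _).div ((hφ.const_mul _).const_sub _) hne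
  have hre : ∀ x ∈ disk, (h x).re * ‖1 - starRingEnd ℂ w * φ x‖ ^ 2 = 1 - (‖w‖ * ‖φ x‖) ^ 2 := by
    intro x hx
    have hn : ‖1 - starRingEnd ℂ w * φ x‖ ^ 2 ≠ 0 := by
      simpa using hne x hx
    have h2 : ‖w‖ * ‖φ x‖ = ‖starRingEnd ℂ w * φ x‖ := by rw [norm_mul, RCLike.norm_conj]
    rw [h2]
    simp only [hh]
    generalize starRingEnd ℂ w * φ x = u at hn ⊢
    rw [← Complex.normSq_eq_norm_sq] at hn ⊢
    rw [← Complex.normSq_eq_norm_sq, Complex.div_re, ← add_div, div_mul_cancel₀ _ hn,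
      Complex.normSq_apply]
    simp only [Complex.add_re, Complex.sub_re, Complex.one_re, Complex.add_im, Complex.sub_im,
      Complex.one_im]
    ring
  have hmem : ∀ θ, circleMap 0 s θ ∈ disk := fun θ => by
    simpa [circleMap, abs_of_pos hs] using hs1
  -- 1 - |w||φ| dominates both 1 - |w| and 1 - |φ| ≥ c(1 - s), hence (as c ≤ 1) also c/2 times the
  -- sum of 1 - |w| and 1 - s.
  set B : ℝ := (2 / c) / ((1 - ‖w‖) + (1 - s)) with hB
  have hBpos : 0 < B := by
    have : 0 < (1 - ‖w‖) + (1 - s) := by linarith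
    positivity
  have hpt : ∀ θ, (‖1 - starRingEnd ℂ w * φ (circleMap 0 s θ)‖ ^ 2)⁻¹ ≤
      B * (h (circleMap 0 s θ)).re := by
    intro θ
    have h1 := hre _ (hmem θ)
    have h2 := hcφ _ (hmem θ)
    have h3 : ‖circleMap 0 s θ‖ = s := by simp [circleMap, abs_of_pos hs]
    rw [h3] at h2
    have h4 := hφn _ (hmem θ)
    have hpos : 0 < ‖1 - starRingEnd ℂ w * φ (circleMap 0 s θ)‖ ^ 2 := by
      have := norm_pos_iff.2 (hne _ (hmem θ))
      positivity
    rw [inv_le_iff_one_le_mul₀ hpos, mul_assoc, h1, hB, div_mul_eq_mul_div,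
      le_div_iff₀ (by linarith), div_mul_eq_mul_div, le_div_iff₀ hc, one_mul]
    have hp := norm_nonneg (φ (circleMap 0 s θ))
    generalize ‖φ (circleMap 0 s θ)‖ = p at *
    have hp0 : 0 ≤ ‖w‖ := norm_nonneg w
    have hp1 : ‖w‖ * p ≤ ‖w‖ := by nlinarith
    have h5 : ‖w‖ * p ≤ p := by nlinarith
    have h6 : (‖w‖ * p) ^ 2 ≤ ‖w‖ * p := by
      have : 0 ≤ ‖w‖ * p := by positivity
      nlinarith
    nlinarith
  have hcont := continuous_comp_circleMap hd.continuousOn hs hs1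
  have hint : Integrable (fun θ => h (circleMap 0 s θ))
      (volume.restrict (Ioo (-Real.pi) Real.pi)) :=
    (hcont.integrableOn_Icc (a := -Real.pi) (b := Real.pi)).mono_set Ioo_subset_Icc_self
  calc _ ≤ ∫⁻ θ in Ioo (-Real.pi) Real.pi, ENNReal.ofReal (B * (h (circleMap 0 s θ)).re) :=
        lintegral_mono fun θ => ENNReal.ofReal_le_ofReal (hpt θ)
    _ = ENNReal.ofReal (∫ θ in Ioo (-Real.pi) Real.pi, B * (h (circleMap 0 s θ)).re) := by
        refine (ofReal_integral_eq_lintegral_ofReal (hint.re.const_mul B) ?_).symm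
        exact Eventually.of_forall fun θ => (by positivity : (0 : ℝ) ≤ _).trans (hpt θ)
    _ ≤ _ := by
        refine ENNReal.ofReal_le_ofReal ?_
        have h1 : ∫ θ in Ioo (-Real.pi) Real.pi, (h (circleMap 0 s θ)).re =
            2 * Real.pi * (h 0).re := by
          have := integral_re hint
          simp only [RCLike.re_to_complex] at this
          rw [this, setIntegral_circleMap_eq hd hs hs1]
          simp
        have h2 : (h 0).re ≤ 2 / (1 - ‖φ 0‖) := by
          refine (Complex.re_le_norm _).trans ?_
          rw [hh]
          simp only [norm_div]
          have h3 : ‖1 + starRingEnd ℂ w * φ 0‖ ≤ 2 := by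
            refine (norm_add_le _ _).trans ?_
            rw [norm_one, norm_mul, RCLike.norm_conj]
            nlinarith [norm_nonneg w, norm_nonneg (φ 0)]
          have h4 : 1 - ‖φ 0‖ ≤ ‖1 - starRingEnd ℂ w * φ 0‖ := by
            have := norm_sub_norm_le 1 (starRingEnd ℂ w * φ 0)
            rw [norm_one, norm_mul, RCLike.norm_conj] at this
            nlinarith [norm_nonneg (φ 0)]
          gcongr
        rw [integral_const_mul, h1]
        calc B * (2 * Real.pi * (h 0).re) ≤ B * (2 * Real.pi * (2 / (1 - ‖φ 0‖))) := by
              gcongr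
          _ = _ := by rw [hB]; ring

/-- Integrals of radial weights against `|1 - w̄ φ|⁻²`. -/
theorem exists_lintegral_radial_le {φ : ℂ → ℂ} (hφ : DifferentiableOn ℂ φ disk)
    (hm : MapsTo φ disk disk) (hφm : Measurable φ) :
    ∃ C : ℝ, 0 < C ∧ ∀ w ∈ disk, ∀ k : ℝ → ℝ≥0∞, Measurable k →
      ∫⁻ z, k ‖z‖ * ENNReal.ofReal ((‖1 - starRingEnd ℂ w * φ z‖ ^ 2)⁻¹) ∂diskArea ≤
      ∫⁻ s in Ioo (0 : ℝ) 1, k s * ENNReal.ofReal (C / ((1 - ‖w‖) + (1 - s))) := by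
  obtain ⟨C, hC, h⟩ := exists_setLIntegral_circleMap_le hφ hm
  refine ⟨C, hC, fun w hw k hk => ?_⟩
  have hp : ENNReal.ofReal Real.pi ≠ 0 := by simp [Real.pi_pos]
  rw [lintegral_diskArea_eq_polar (by fun_prop), ← lintegral_const_mul' _ _ (ENNReal.inv_ne_top.2 hp)]
  refine setLIntegral_mono' measurableSet_Ioo fun s hs => ?_
  have hcm : ∀ θ, ‖circleMap 0 s θ‖ = s := fun θ => by simp [circleMap, abs_of_pos hs.1]
  simp only [hcm]
  have h1 : ENNReal.ofReal s ≤ 1 := ENNReal.ofReal_le_one.2 hs.2.le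
  rw [lintegral_const_mul _ (by fun_prop)]
  calc _ ≤ (ENNReal.ofReal Real.pi)⁻¹ * (1 *
        (k s * ENNReal.ofReal (Real.pi * (C / ((1 - ‖w‖) + (1 - s)))))) := by
        gcongr
        exact h w hw s hs.1 hs.2
    _ = _ := by
        rw [ENNReal.ofReal_mul Real.pi_pos.le, one_mul, mul_left_comm (k s), ← mul_assoc,
          ENNReal.inv_mul_cancel hp ENNReal.ofReal_ne_top, one_mul]

/-- Near the boundary the square of the reproducing kernel composed with `φ` has small mass. -/
theorem exists_setLIntegral_thin_le {φ : ℂ → ℂ} (hφ : DifferentiableOn ℂ φ disk)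
    (hm : MapsTo φ disk disk) (hφm : Measurable φ) :
    ∃ C : ℝ, 0 < C ∧ ∀ w ∈ disk, ∀ κ : ℝ, 0 < κ →
      ∫⁻ z in {z | 1 - ‖z‖ ≤ κ * (1 - ‖w‖)},
        ENNReal.ofReal ((1 - ‖w‖) ^ 2 / ‖1 - starRingEnd ℂ w * φ z‖ ^ 4) ∂diskArea ≤
      ENNReal.ofReal (C * κ) := by
  obtain ⟨C, hC, h⟩ := exists_lintegral_radial_le hφ hm hφm
  refine ⟨C, hC, fun w hw κ hκ => ?_⟩
  have hw1 : ‖w‖ < 1 := by simpa using hw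
  set D := 1 - ‖w‖ with hD
  have hDpos : 0 < D := by linarith
  -- Since D ≤ |1 - w̄ φ|, the integrand is at most |1 - w̄ φ|⁻²; the radial bound C/D is then
  -- integrated over an interval of length κD.
  set k : ℝ → ℝ≥0∞ := (Ici (1 - κ * D)).indicator 1 with hk
  have hkm : Measurable k := measurable_one.indicator measurableSet_Ici
  have hS : MeasurableSet {z : ℂ | 1 - ‖z‖ ≤ κ * D} :=
    measurableSet_le (by fun_prop) (by fun_prop)
  rw [← lintegral_indicator hS]
  calc _ ≤ ∫⁻ z, k ‖z‖ * ENNReal.ofReal ((‖1 - starRingEnd ℂ w * φ z‖ ^ 2)⁻¹) ∂diskArea := by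
        refine lintegral_mono_ae (ae_mem_disk.mono fun z hz => ?_)
        by_cases hz2 : 1 - ‖z‖ ≤ κ * D
        · have h1 : ‖z‖ ∈ Ici (1 - κ * D) := by rw [mem_Ici]; linarith
          rw [indicator_of_mem (show z ∈ {z : ℂ | 1 - ‖z‖ ≤ κ * D} from hz2), hk,
            indicator_of_mem h1, Pi.one_apply, one_mul]
          refine ENNReal.ofReal_le_ofReal ?_
          have h2 : ‖φ z‖ < 1 := by simpa using hm hz
          have h3 : D ≤ ‖1 - starRingEnd ℂ w * φ z‖ := one_sub_norm_le_norm_one_sub h2.le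
          have h4 : 0 < ‖1 - starRingEnd ℂ w * φ z‖ := hDpos.trans_le h3
          rw [div_le_iff₀ (by positivity)]
          have : (‖1 - starRingEnd ℂ w * φ z‖ ^ 2)⁻¹ * ‖1 - starRingEnd ℂ w * φ z‖ ^ 4 =
            ‖1 - starRingEnd ℂ w * φ z‖ ^ 2 := by field_simp
          rw [this]
          gcongr
        · rw [indicator_of_notMem (show z ∉ {z : ℂ | 1 - ‖z‖ ≤ κ * D} from hz2)]
          exact zero_le
    _ ≤ _ := h w hw k hkm
    _ ≤ ∫⁻ s in Ioo (0 : ℝ) 1, (Ici (1 - κ * D)).indicator (fun _ => ENNReal.ofReal (C / D)) s := by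
        refine setLIntegral_mono' measurableSet_Ioo fun s hs => ?_
        by_cases hs2 : s ∈ Ici (1 - κ * D)
        · rw [hk, indicator_of_mem hs2, indicator_of_mem hs2, Pi.one_apply, one_mul]
          refine ENNReal.ofReal_le_ofReal ?_
          gcongr
          linarith [hs.2]
        · rw [hk, indicator_of_notMem hs2, zero_mul]
          exact zero_le
    _ ≤ ENNReal.ofReal (C / D) * volume (Icc (1 - κ * D) 1) := by
        rw [lintegral_indicator measurableSet_Ici, setLIntegral_const,
          Measure.restrict_apply measurableSet_Ici]
        gcongr
        exact fun s hs => ⟨hs.1, hs.2.2.le⟩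
    _ = _ := by
        rw [Real.volume_Icc, ← ENNReal.ofReal_mul (by positivity)]
        congr 1
        field_simp
        ring

/-- Where the hyperbolic distance of `φ z` to `w` is large, the square of the reproducing kernel
composed with `φ` has small mass. -/
theorem exists_setLIntegral_far_le {φ : ℂ → ℂ} (hφ : DifferentiableOn ℂ φ disk)
    (hm : MapsTo φ disk disk) (hφm : Measurable φ) :
    ∃ C : ℝ, 0 < C ∧ ∀ w ∈ disk, ∀ κ : ℝ, 0 < κ → ∀ η : ℝ, 0 ≤ η →
      ∫⁻ z in {z | κ * (1 - ‖w‖) < 1 - ‖z‖ ∧ (1 - ‖w‖ ^ 2) * (1 - ‖φ z‖ ^ 2) ≤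
          η * ‖1 - starRingEnd ℂ w * φ z‖ ^ 2},
        ENNReal.ofReal ((1 - ‖w‖) ^ 2 / ‖1 - starRingEnd ℂ w * φ z‖ ^ 4) ∂diskArea ≤
      ENNReal.ofReal (C * η / κ) := by
  obtain ⟨c, hc, hc1, hcφ⟩ := exists_mul_one_sub_norm_le hφ hm
  obtain ⟨C, hC, h⟩ := exists_lintegral_radial_le hφ hm hφm
  refine ⟨C / c, by positivity, fun w hw κ hκ η hη => ?_⟩
  have hw1 : ‖w‖ < 1 := by simpa using hw
  set D := 1 - ‖w‖ with hD
  have hDpos : 0 < D := by linarith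
  -- With X = |1 - w̄ φ(z)|, Schwarz–Pick gives ηX² ≥ cD(1 - |z|) on the far set, so D²/X⁴ ≤ Dη/(c(1
  -- - |z|)) · X⁻². The radial estimate leaves a multiple of (1 - s)⁻², whose integral over (0, 1 -
  -- κD) is at most 1/(κD).
  set k : ℝ → ℝ≥0∞ := (Iio (1 - κ * D)).indicator
    (fun s => ENNReal.ofReal (D * η / (c * (1 - s)))) with hk
  have hkm : Measurable k := Measurable.indicator (by fun_prop) measurableSet_Iio
  set S := {z | κ * D < 1 - ‖z‖ ∧ (1 - ‖w‖ ^ 2) * (1 - ‖φ z‖ ^ 2) ≤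
          η * ‖1 - starRingEnd ℂ w * φ z‖ ^ 2} with hSdef
  have hS : MeasurableSet S := by
    rw [hSdef, ofPred_and]
    exact (measurableSet_lt (by fun_prop) (by fun_prop)).inter
      (measurableSet_le (by fun_prop) (by fun_prop))
  rw [← lintegral_indicator hS]
  calc _ ≤ ∫⁻ z, k ‖z‖ * ENNReal.ofReal ((‖1 - starRingEnd ℂ w * φ z‖ ^ 2)⁻¹) ∂diskArea := by
        refine lintegral_mono_ae (ae_mem_disk.mono fun z hz => ?_)
        by_cases hz2 : z ∈ S
        · have h1 : ‖z‖ ∈ Iio (1 - κ * D) := by rw [mem_Iio]; linarith [hz2.1]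
          have h2 : ‖φ z‖ < 1 := by simpa using hm hz
          have hz1 : ‖z‖ < 1 := by simpa using hz
          have h3 : D ≤ ‖1 - starRingEnd ℂ w * φ z‖ := one_sub_norm_le_norm_one_sub h2.le
          have h4 : 0 < ‖1 - starRingEnd ℂ w * φ z‖ := hDpos.trans_le h3
          have hz3 : 0 < 1 - ‖z‖ := by linarith
          rw [indicator_of_mem hz2, hk, indicator_of_mem h1, ← ENNReal.ofReal_mul (by positivity)]
          refine ENNReal.ofReal_le_ofReal ?_
          have h5 : D * (c * (1 - ‖z‖)) ≤ η * ‖1 - starRingEnd ℂ w * φ z‖ ^ 2 := by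
            refine le_trans ?_ hz2.2
            have h6 : D ≤ 1 - ‖w‖ ^ 2 := by nlinarith [norm_nonneg w]
            have h7 : c * (1 - ‖z‖) ≤ 1 - ‖φ z‖ ^ 2 := by
              refine (hcφ z hz).trans ?_
              nlinarith [norm_nonneg (φ z)]
            have h8 : 0 ≤ c * (1 - ‖z‖) := by positivity
            exact mul_le_mul h6 h7 h8 (hDpos.le.trans h6)
          rw [div_mul_eq_mul_div, div_le_div_iff₀ (by positivity) (by positivity)]
          generalize ‖1 - starRingEnd ℂ w * φ z‖ = X at *
          have h9 : D * η * (X ^ 2)⁻¹ * X ^ 4 = D * (η * X ^ 2) := by field_simp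
          rw [h9, sq D, mul_assoc]
          gcongr
        · rw [indicator_of_notMem hz2]
          exact zero_le
    _ ≤ _ := h w hw k hkm
    _ ≤ ∫⁻ s in Ioo (0 : ℝ) 1, (Iio (1 - κ * D)).indicator
          (fun s => ENNReal.ofReal (C * D * η / c * ((1 - s) ^ 2)⁻¹)) s := by
        refine setLIntegral_mono' measurableSet_Ioo fun s hs => ?_
        have hs1 : 0 < 1 - s := by linarith [hs.2]
        by_cases hs2 : s ∈ Iio (1 - κ * D)
        · rw [hk, indicator_of_mem hs2, indicator_of_mem hs2, ← ENNReal.ofReal_mul (by positivity)]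
          refine ENNReal.ofReal_le_ofReal ?_
          calc D * η / (c * (1 - s)) * (C / (D + (1 - s))) ≤
              D * η / (c * (1 - s)) * (C / (1 - s)) := by gcongr; linarith
            _ = _ := by field_simp
        · rw [indicator_of_notMem hs2, hk, indicator_of_notMem hs2, zero_mul]
    _ = ∫⁻ s in Ioo (0 : ℝ) (1 - κ * D), ENNReal.ofReal (C * D * η / c * ((1 - s) ^ 2)⁻¹) := by
        rw [lintegral_indicator measurableSet_Iio, Measure.restrict_restrict measurableSet_Iio]
        congr 2
        ext s
        have : 0 < κ * D := by positivity
        simp only [mem_inter_iff, mem_Iio, mem_Ioo]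
        constructor
        · rintro ⟨h1, h2, h3⟩; exact ⟨h2, h1⟩
        · rintro ⟨h1, h2⟩; exact ⟨h2, h1, by linarith⟩
    _ ≤ ENNReal.ofReal (C * D * η / c * (1 / (κ * D))) := by
        have hκD : 0 < κ * D := by positivity
        rcases le_or_gt (1 - κ * D) 0 with h0 | h0
        · rw [Ioo_eq_empty (by linarith)]; simp
        have hne : ∀ s ∈ Icc 0 (1 - κ * D), 1 - s ≠ 0 := fun s hs => by linarith [hs.2]
        have hcont : ContinuousOn (fun s : ℝ => C * D * η / c * ((1 - s) ^ 2)⁻¹)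
            (Icc 0 (1 - κ * D)) :=
          continuousOn_const.mul (ContinuousOn.inv₀ (by fun_prop) fun s hs =>
            pow_ne_zero 2 (hne s hs))
        have hFTC : ∫ s in (0 : ℝ)..(1 - κ * D), C * D * η / c * ((1 - s) ^ 2)⁻¹ =
            C * D * η / c * (1 - (1 - κ * D))⁻¹ - C * D * η / c * (1 - 0)⁻¹ := by
          refine intervalIntegral.integral_eq_sub_of_hasDerivAt
            (f := fun s => C * D * η / c * (1 - s)⁻¹) (fun s hs => ?_) ?_
          · rw [uIcc_of_le h0.le] at hs
            have := (((hasDerivAt_id s).const_sub 1).inv (hne s hs)).const_mul (C * D * η / c)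
            exact this.congr_deriv (by simp [div_eq_mul_inv])
          · exact (by rwa [uIcc_of_le h0.le] : ContinuousOn _ (uIcc 0 (1 - κ * D))).intervalIntegrable
        rw [← ofReal_integral_eq_lintegral_ofReal
          ((hcont.integrableOn_Icc).mono_set Ioo_subset_Icc_self), ← integral_Ioc_eq_integral_Ioo,
          ← intervalIntegral.integral_of_le h0.le, hFTC]
        · refine ENNReal.ofReal_le_ofReal ?_
          have : 0 ≤ C * D * η / c := by positivity
          simp only [sub_sub_cancel, sub_zero, inv_one, mul_one, one_div]
          linarith
        · refine Eventually.of_forall fun s => ?_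
          positivity
    _ = _ := by
        congr 1
        field_simp

theorem mul_le_norm_one_sub_sq {w z : ℂ} :
    (1 - ‖w‖ ^ 2) * (1 - ‖z‖ ^ 2) ≤ ‖1 - starRingEnd ℂ w * z‖ ^ 2 := by
  rw [← norm_one_sub_conj_mul_sq_sub]
  linarith [sq_nonneg ‖w - z‖]

/-- The thin and the far region with κ = η = 1 cover everything, by `mul_le_norm_one_sub_sq`. This
is the kernel test for Carleson measures; for φ = id it bounds ‖K_w‖ from above. -/
theorem exists_lintegral_kernel_comp_le {φ : ℂ → ℂ} (hφ : DifferentiableOn ℂ φ disk)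
    (hm : MapsTo φ disk disk) (hφm : Measurable φ) :
    ∃ C : ℝ, 0 < C ∧ ∀ w ∈ disk,
      ∫⁻ z, ENNReal.ofReal ((1 - ‖w‖) ^ 2 / ‖1 - starRingEnd ℂ w * φ z‖ ^ 4) ∂diskArea ≤
      ENNReal.ofReal C := by
  obtain ⟨C₁, hC₁, h₁⟩ := exists_setLIntegral_thin_le hφ hm hφm
  obtain ⟨C₂, hC₂, h₂⟩ := exists_setLIntegral_far_le hφ hm hφm
  refine ⟨C₁ + C₂, by positivity, fun w hw => ?_⟩
  rw [← setLIntegral_univ, ENNReal.ofReal_add hC₁.le hC₂.le]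
  refine (lintegral_mono_set ?_).trans ((lintegral_union_le _ _ _).trans
    (add_le_add ((h₁ w hw 1 one_pos).trans_eq (by rw [mul_one]))
      ((h₂ w hw 1 one_pos 1 zero_le_one).trans_eq (by rw [mul_one, div_one]))))
  intro z _
  rcases le_or_gt (1 - ‖z‖) (1 * (1 - ‖w‖)) with h | h
  · exact Or.inl h
  · exact Or.inr ⟨h, by rw [one_mul]; exact mul_le_norm_one_sub_sq⟩

theorem measurable_indicator_disk {g : ℂ → ℝ≥0∞} (hg : ContinuousOn g disk) :
    Measurable (disk.indicator g) := by
  classical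
  rw [← piecewise_eq_indicator]
  exact hg.measurable_piecewise continuousOn_const measurableSet_ball

theorem measurable_indicator_enorm_sq {f : ℂ → ℂ} (hf : DifferentiableOn ℂ f disk) :
    Measurable (disk.indicator fun z => ‖f z‖ₑ ^ 2) :=
  measurable_indicator_disk <|
    (ENNReal.continuous_pow 2).comp_continuousOn (continuous_enorm.comp_continuousOn hf.continuousOn)

theorem lintegral_indicator_disk (F : ℂ → ℝ≥0∞) :
    ∫⁻ z, disk.indicator F z ∂diskArea = ∫⁻ z, F z ∂diskArea := by
  rw [lintegral_indicator measurableSet_ball, setLIntegral_disk]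

/-- Because 1 - ū z = (1 - |u|²) + ū(u - z). It makes |1 - ū z| comparable to 1 - |u| for points z
of the disk within a multiple of 1 - |u| from u. -/
theorem norm_one_sub_conj_mul_le {u z : ℂ} (hu : ‖u‖ ≤ 1) :
    ‖1 - starRingEnd ℂ u * z‖ ≤ 2 * (1 - ‖u‖) + ‖u - z‖ := by
  have h : 1 - starRingEnd ℂ u * z = ((1 - ‖u‖ ^ 2 : ℝ) : ℂ) + starRingEnd ℂ u * (u - z) := by
    rw [mul_sub, ← Complex.normSq_eq_conj_mul_self, Complex.normSq_eq_norm_sq]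
    push_cast
    ring
  rw [h]
  refine (norm_add_le _ _).trans ?_
  rw [Complex.norm_real, norm_mul, RCLike.norm_conj, Real.norm_of_nonneg
    (by nlinarith [norm_nonneg u])]
  nlinarith [norm_nonneg u, norm_nonneg (u - z)]

/-- Carleson's embedding for the pull-back measure: `C_φ` is bounded. -/
theorem exists_lintegral_comp_le {φ : ℂ → ℂ} (hφ : DifferentiableOn ℂ φ disk)
    (hm : MapsTo φ disk disk) (hφm : Measurable φ) :
    ∃ C : ℝ, 0 < C ∧ ∀ f : ℂ → ℂ, DifferentiableOn ℂ f disk →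
      ∫⁻ z, ‖f (φ z)‖ₑ ^ 2 ∂diskArea ≤ ENNReal.ofReal C * ∫⁻ z, ‖f z‖ₑ ^ 2 ∂diskArea := by
  obtain ⟨C, hC, h⟩ := exists_lintegral_kernel_comp_le hφ hm hφm
  -- The constant is not sharp; the comparison below already holds with 729.
  refine ⟨2916 * C, by positivity, fun f hf => ?_⟩
  set F := disk.indicator fun z => ‖f z‖ₑ ^ 2 with hF
  have hFm : Measurable F := measurable_indicator_enorm_sq hf
  -- The sub-mean value property at φ(x), on the disc of half the distance to the circle, is
  -- integrated in x and the order of integration exchanged. On S the numbers 1 - |u| and 1 - |φ x|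
  -- are comparable, so for fixed u the x-integral is controlled by the kernel mass at u.
  set S : Set (ℂ × ℂ) := {p | ‖p.2 - φ p.1‖ < (1 - ‖φ p.1‖) / 2} with hS
  have hSm : MeasurableSet S := measurableSet_lt (by fun_prop) (by fun_prop)
  set G : ℂ → ℂ → ℝ≥0∞ := fun x u =>
    S.indicator (fun p => ENNReal.ofReal (4 / (1 - ‖φ p.1‖) ^ 2) * F p.2) (x, u) with hG
  have hGm : Measurable (Function.uncurry G) := by
    have : Function.uncurry G =
        S.indicator (fun p => ENNReal.ofReal (4 / (1 - ‖φ p.1‖) ^ 2) * F p.2) := by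
      ext ⟨x, u⟩; rfl
    rw [this]
    exact Measurable.indicator (by fun_prop) hSm
  calc ∫⁻ z, ‖f (φ z)‖ₑ ^ 2 ∂diskArea ≤ ∫⁻ x, ∫⁻ u, G x u ∂diskArea ∂diskArea := by
        refine lintegral_mono_ae (ae_mem_disk.mono fun x hx => ?_)
        have hφx : ‖φ x‖ < 1 := by simpa using hm hx
        have hD : 0 < 1 - ‖φ x‖ := by linarith
        have hsub : ball (φ x) ((1 - ‖φ x‖) / 2) ⊆ disk :=
          ball_subset_ball' (by rw [dist_zero_right]; linarith)
        have h1 := enorm_sq_mul_le_setLIntegral (hf.mono hsub) hsub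
        have h2 : ∫⁻ u, G x u ∂diskArea = ENNReal.ofReal (4 / (1 - ‖φ x‖) ^ 2) *
            ∫⁻ u in ball (φ x) ((1 - ‖φ x‖) / 2), ‖f u‖ₑ ^ 2 ∂diskArea := by
          rw [← lintegral_const_mul' _ _ ENNReal.ofReal_ne_top, ← lintegral_indicator measurableSet_ball]
          refine lintegral_congr fun u => ?_
          by_cases hu : u ∈ ball (φ x) ((1 - ‖φ x‖) / 2)
          · have hu' : (x, u) ∈ S := by rwa [mem_ball, dist_eq_norm] at hu
            simp only [hG]
            rw [indicator_of_mem hu, indicator_of_mem hu', hF, indicator_of_mem (hsub hu)]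
          · have hu' : (x, u) ∉ S := by rwa [mem_ball, dist_eq_norm] at hu
            simp only [hG]
            rw [indicator_of_notMem hu, indicator_of_notMem hu']
        rw [h2]
        calc ‖f (φ x)‖ₑ ^ 2 = ENNReal.ofReal (4 / (1 - ‖φ x‖) ^ 2) *
              (‖f (φ x)‖ₑ ^ 2 * ENNReal.ofReal ((1 - ‖φ x‖) / 2) ^ 2) := by
              rw [mul_left_comm, ← ENNReal.ofReal_pow (by positivity),
                ← ENNReal.ofReal_mul (by positivity)]
              have : 4 / (1 - ‖φ x‖) ^ 2 * ((1 - ‖φ x‖) / 2) ^ 2 = 1 := by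
                field_simp; norm_num
              rw [this, ENNReal.ofReal_one, mul_one]
          _ ≤ _ := by gcongr
    _ = ∫⁻ u, ∫⁻ x, G x u ∂diskArea ∂diskArea := lintegral_lintegral_swap hGm.aemeasurable
    _ ≤ ∫⁻ u, ENNReal.ofReal (2916 * C) * F u ∂diskArea := by
        refine lintegral_mono_ae (ae_mem_disk.mono fun u hu => ?_)
        have hu1 : ‖u‖ < 1 := by simpa using hu
        calc ∫⁻ x, G x u ∂diskArea ≤ ∫⁻ x, (ENNReal.ofReal 2916 * F u) *
              ENNReal.ofReal ((1 - ‖u‖) ^ 2 / ‖1 - starRingEnd ℂ u * φ x‖ ^ 4) ∂diskArea := by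
              refine lintegral_mono_ae (ae_mem_disk.mono fun x hx => ?_)
              have hφx : ‖φ x‖ < 1 := by simpa using hm hx
              by_cases hxS : (x, u) ∈ S
              · simp only [hG]
                rw [indicator_of_mem hxS, mul_right_comm, ← ENNReal.ofReal_mul (by norm_num)]
                gcongr
                have h1 : ‖u - φ x‖ < (1 - ‖φ x‖) / 2 := hxS
                have h2 : ‖u‖ - ‖φ x‖ ≤ ‖u - φ x‖ := norm_sub_norm_le _ _
                have h3 : ‖φ x‖ - ‖u‖ ≤ ‖u - φ x‖ := by
                  rw [norm_sub_rev]; exact norm_sub_norm_le _ _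
                have h4 := norm_one_sub_conj_mul_le (z := φ x) hu1.le
                have h5 : 0 < ‖1 - starRingEnd ℂ u * φ x‖ :=
                  norm_pos_iff.2 (one_sub_conj_mul_ne_zero hu1 hφx.le)
                have h6 : ‖1 - starRingEnd ℂ u * φ x‖ ≤ 3 * (1 - ‖u‖) := by linarith
                generalize ‖1 - starRingEnd ℂ u * φ x‖ = X at *
                have h7 : 0 < 1 - ‖φ x‖ := by linarith
                have h8 : 1 - ‖u‖ ≤ 3 / 2 * (1 - ‖φ x‖) := by linarith
                have h9 : 0 < 1 - ‖u‖ := by linarith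
                rw [← mul_div_assoc, div_le_div_iff₀ (by positivity) (by positivity)]
                calc 4 * X ^ 4 ≤ 4 * (3 * (1 - ‖u‖)) ^ 4 := by gcongr
                  _ = 324 * (1 - ‖u‖) ^ 2 * (1 - ‖u‖) ^ 2 := by ring
                  _ ≤ 324 * (1 - ‖u‖) ^ 2 * (3 / 2 * (1 - ‖φ x‖)) ^ 2 := by gcongr
                  _ = 729 * ((1 - ‖u‖) ^ 2 * (1 - ‖φ x‖) ^ 2) := by ring
                  _ ≤ 2916 * ((1 - ‖u‖) ^ 2 * (1 - ‖φ x‖) ^ 2) := by gcongr; norm_num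
                  _ = _ := by ring
              · simp only [hG]
                rw [indicator_of_notMem hxS]
                exact zero_le
          _ = (ENNReal.ofReal 2916 * F u) *
              ∫⁻ x, ENNReal.ofReal ((1 - ‖u‖) ^ 2 / ‖1 - starRingEnd ℂ u * φ x‖ ^ 4) ∂diskArea :=
              lintegral_const_mul _ (by fun_prop)
          _ ≤ (ENNReal.ofReal 2916 * F u) * ENNReal.ofReal C := by gcongr; exact h u hu
          _ = _ := by rw [ENNReal.ofReal_mul (by norm_num)]; ring
    _ = _ := by rw [lintegral_const_mul _ hFm, lintegral_indicator_disk]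

/-! ### From kernel mass to points with large derivative -/

/-- The points where `φ` is hyperbolically close to `w` and which are not too close to the boundary
carry a fixed portion of the mass of the reproducing kernel at `w` composed with `φ`. -/
theorem exists_le_setLIntegral_near {φ : ℂ → ℂ} (hφ : DifferentiableOn ℂ φ disk)
    (hm : MapsTo φ disk disk) (hφm : Measurable φ) {δ : ℝ} (hδ : 0 < δ)
    (hb : ∀ w ∈ disk, ENNReal.ofReal δ ≤
      ∫⁻ z, ENNReal.ofReal ((1 - ‖w‖) ^ 2 / ‖1 - starRingEnd ℂ w * φ z‖ ^ 4) ∂diskArea) :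
    ∃ κ η : ℝ, 0 < κ ∧ 0 < η ∧ ∀ w ∈ disk, ENNReal.ofReal (δ / 2) ≤
      ∫⁻ z in {z | κ * (1 - ‖w‖) < 1 - ‖z‖ ∧
          η * ‖1 - starRingEnd ℂ w * φ z‖ ^ 2 < (1 - ‖w‖ ^ 2) * (1 - ‖φ z‖ ^ 2)},
        ENNReal.ofReal ((1 - ‖w‖) ^ 2 / ‖1 - starRingEnd ℂ w * φ z‖ ^ 4) ∂diskArea := by
  obtain ⟨C₁, hC₁, h₁⟩ := exists_setLIntegral_thin_le hφ hm hφm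
  obtain ⟨C₂, hC₂, h₂⟩ := exists_setLIntegral_far_le hφ hm hφm
  -- κ makes the thin part at most δ/4; then η, depending on κ, does the same for the far part.
  refine ⟨δ / (4 * C₁), δ / (4 * C₁) * δ / (4 * C₂), by positivity, by positivity, fun w hw => ?_⟩
  set κ := δ / (4 * C₁) with hκ
  set η := κ * δ / (4 * C₂) with hη
  have hκ0 : 0 < κ := by positivity
  have hη0 : 0 < η := by positivity
  have hT := h₁ w hw κ hκ0
  have hF := h₂ w hw κ hκ0 η hη0.le
  have e1 : C₁ * κ = δ / 4 := by rw [hκ]; field_simp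
  have e2 : C₂ * η / κ = δ / 4 := by rw [hη]; field_simp
  rw [e1] at hT
  rw [e2] at hF
  set I : ℂ → ℝ≥0∞ := fun z =>
    ENNReal.ofReal ((1 - ‖w‖) ^ 2 / ‖1 - starRingEnd ℂ w * φ z‖ ^ 4) with hI
  set S₁ : Set ℂ := {z | 1 - ‖z‖ ≤ κ * (1 - ‖w‖)}
  set S₂ : Set ℂ := {z | κ * (1 - ‖w‖) < 1 - ‖z‖ ∧ (1 - ‖w‖ ^ 2) * (1 - ‖φ z‖ ^ 2) ≤
          η * ‖1 - starRingEnd ℂ w * φ z‖ ^ 2}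
  set S₃ : Set ℂ := {z | κ * (1 - ‖w‖) < 1 - ‖z‖ ∧
          η * ‖1 - starRingEnd ℂ w * φ z‖ ^ 2 < (1 - ‖w‖ ^ 2) * (1 - ‖φ z‖ ^ 2)}
  have hU : (univ : Set ℂ) ⊆ S₁ ∪ S₂ ∪ S₃ := by
    intro z _
    rcases le_or_gt (1 - ‖z‖) (κ * (1 - ‖w‖)) with h | h
    · exact Or.inl (Or.inl h)
    · rcases le_or_gt ((1 - ‖w‖ ^ 2) * (1 - ‖φ z‖ ^ 2))
        (η * ‖1 - starRingEnd ℂ w * φ z‖ ^ 2) with h' | h'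
      · exact Or.inl (Or.inr ⟨h, h'⟩)
      · exact Or.inr ⟨h, h'⟩
  have hle : ENNReal.ofReal δ ≤ ENNReal.ofReal (δ / 2) + ∫⁻ z in S₃, I z ∂diskArea := by
    refine (hb w hw).trans ?_
    rw [← setLIntegral_univ]
    refine (lintegral_mono_set hU).trans ((lintegral_union_le _ _ _).trans ?_)
    gcongr
    refine (lintegral_union_le _ _ _).trans ((add_le_add hT hF).trans_eq ?_)
    rw [← ENNReal.ofReal_add (by positivity) (by positivity)]
    congr 1
    ring
  have hs : ENNReal.ofReal δ = ENNReal.ofReal (δ / 2) + ENNReal.ofReal (δ / 2) := by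
    rw [← ENNReal.ofReal_add (by positivity) (by positivity), add_halves]
  rw [hs] at hle
  exact (ENNReal.add_le_add_iff_left ENNReal.ofReal_ne_top).1 hle

theorem exists_mem_disk_of_setLIntegral_pos {S : Set ℂ} {F : ℂ → ℝ≥0∞}
    (h : 0 < ∫⁻ z in S, F z ∂diskArea) : ∃ z ∈ disk, z ∈ S := by
  by_contra! hne
  have : diskArea S = 0 := measure_mono_null (fun z hz hz' => hne z hz' hz) ae_mem_disk
  rw [Measure.restrict_eq_zero.2 this, lintegral_zero_measure] at h
  exact lt_irrefl _ h

/-- Consequences of a bound on the hyperbolic distance. -/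
theorem near_bounds {w ζ : ℂ} {η : ℝ} (hw : ‖w‖ < 1) (hζ : ‖ζ‖ < 1) (hη : 0 < η)
    (h : η * ‖1 - starRingEnd ℂ w * ζ‖ ^ 2 < (1 - ‖w‖ ^ 2) * (1 - ‖ζ‖ ^ 2)) :
    1 - ‖ζ‖ ≤ 4 / η * (1 - ‖w‖) ∧ 1 - ‖w‖ ≤ 4 / η * (1 - ‖ζ‖) ∧ ‖w - ζ‖ ≤ 4 / η * (1 - ‖w‖) := by
  have h1 : 1 - ‖w‖ ≤ ‖1 - starRingEnd ℂ w * ζ‖ := one_sub_norm_le_norm_one_sub hζ.le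
  have h2 : 1 - ‖ζ‖ ≤ ‖1 - starRingEnd ℂ w * ζ‖ := by
    have := norm_sub_norm_le 1 (starRingEnd ℂ w * ζ)
    rw [norm_one, norm_mul, RCLike.norm_conj] at this
    nlinarith [norm_nonneg ζ]
  have h3 : ‖w - ζ‖ ≤ ‖1 - starRingEnd ℂ w * ζ‖ := by
    have h4 := norm_one_sub_conj_mul_sq_sub w ζ
    have h5 : 0 ≤ (1 - ‖w‖ ^ 2) * (1 - ‖ζ‖ ^ 2) :=
      mul_nonneg (by nlinarith [norm_nonneg w]) (by nlinarith [norm_nonneg ζ])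
    exact (sq_le_sq₀ (norm_nonneg _) (norm_nonneg _)).1 (by linarith)
  have hD : 0 < 1 - ‖w‖ := by linarith
  have hE : 0 < 1 - ‖ζ‖ := by linarith
  have h6 : (1 - ‖w‖ ^ 2) * (1 - ‖ζ‖ ^ 2) ≤ (2 * (1 - ‖w‖)) * (2 * (1 - ‖ζ‖)) := by
    refine mul_le_mul ?_ ?_ ?_ ?_ <;> nlinarith [norm_nonneg w, norm_nonneg ζ]
  -- X dominates 1 - |w|, 1 - |ζ| and |w - ζ|, while ηX² ≤ 4(1 - |w|)(1 - |ζ|). Replacing one factor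
  -- on the right by X bounds X by 4/η times the other.
  generalize ‖1 - starRingEnd ℂ w * ζ‖ = X at *
  have hX : 0 < X := hD.trans_le h1
  have h7 : η * X ^ 2 ≤ 4 * ((1 - ‖w‖) * (1 - ‖ζ‖)) := by linarith
  have h8 : X ≤ 4 / η * (1 - ‖w‖) := by
    rw [div_mul_eq_mul_div, le_div_iff₀ hη]
    refine le_of_mul_le_mul_right ?_ hX
    have : (1 - ‖w‖) * (1 - ‖ζ‖) ≤ (1 - ‖w‖) * X := by gcongr
    nlinarith
  have h9 : X ≤ 4 / η * (1 - ‖ζ‖) := by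
    rw [div_mul_eq_mul_div, le_div_iff₀ hη]
    refine le_of_mul_le_mul_right ?_ hX
    have : (1 - ‖w‖) * (1 - ‖ζ‖) ≤ X * (1 - ‖ζ‖) := by gcongr
    nlinarith
  exact ⟨h2.trans h8, h1.trans h9, h3.trans h8⟩

/-- If `φ` moves by at least `D` along a segment, then there is a point on the segment, whose image
is within `D` of the image of the initial point, where the derivative is not small. -/
theorem exists_mem_segment_le_norm_deriv {φ : ℂ → ℂ} {U : Set ℂ} (hU : IsOpen U)
    (hφ : DifferentiableOn ℂ φ U) {z p : ℂ} (hs : segment ℝ z p ⊆ U) {D : ℝ} (hD : 0 < D)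
    (h : D ≤ ‖φ p - φ z‖) :
    ∃ q ∈ segment ℝ z p, ‖φ q - φ z‖ ≤ D ∧ D / 2 ≤ ‖deriv φ q‖ * ‖p - z‖ := by
  set γ : ℝ → ℂ := fun τ => z + τ • (p - z) with hγ
  have hmem : ∀ τ ∈ Icc (0 : ℝ) 1, γ τ ∈ segment ℝ z p := fun τ hτ => by
    rw [segment_eq_image']
    exact ⟨τ, hτ, rfl⟩
  have hγd : ∀ τ, HasDerivAt γ (p - z) τ := fun τ => by
    have := ((hasDerivAt_id τ).smul_const (p - z)).const_add z
    rwa [one_smul] at this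
  have hder : ∀ τ ∈ Icc (0 : ℝ) 1, HasDerivAt (φ ∘ γ) (deriv φ (γ τ) * (p - z)) τ := fun τ hτ =>
    
    (((hφ.differentiableAt (hU.mem_nhds (hs (hmem τ hτ)))).hasDerivAt.hasFDerivAt.restrictScalars
      ℝ).comp_hasDerivAt τ (hγd τ)).congr_deriv (by simp [mul_comm])
  have hcont : ContinuousOn (φ ∘ γ) (Icc 0 1) := fun τ hτ =>
    (hder τ hτ).continuousAt.continuousWithinAt
  have hγ0 : γ 0 = z := by simp [hγ]
  have hγ1 : γ 1 = p := by simp [hγ]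
  -- The least element τ₁ of T is the first time φ ∘ γ is at distance D from φ(z). Were the
  -- derivative small at all earlier times, the mean value inequality would keep φ(γ τ₁) within D/2.
  set T := Icc (0 : ℝ) 1 ∩ {τ | D ≤ ‖φ (γ τ) - φ z‖} with hT
  have hTc : IsCompact T := by
    refine isCompact_Icc.of_isClosed_subset ?_ inter_subset_left
    have : ContinuousOn (fun τ => ‖φ (γ τ) - φ z‖) (Icc 0 1) := (hcont.sub continuousOn_const).norm
    exact this.preimage_isClosed_of_isClosed isClosed_Icc isClosed_Ici
  have hTne : T.Nonempty := ⟨1, right_mem_Icc.2 zero_le_one, by simpa [hγ1] using h⟩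
  obtain ⟨τ₁, hτ₁, hleast⟩ := hTc.exists_isLeast hTne
  have hlt : ∀ τ ∈ Ico 0 τ₁, ‖φ (γ τ) - φ z‖ ≤ D := by
    intro τ hτ
    by_contra! hc
    have := hleast (⟨⟨hτ.1, hτ.2.le.trans hτ₁.1.2⟩, hc.le⟩ : τ ∈ T)
    exact absurd this (not_le.2 hτ.2)
  by_contra! hcon
  have hb : ∀ τ ∈ Ico 0 τ₁, ‖deriv φ (γ τ) * (p - z)‖ ≤ D / 2 := by
    intro τ hτ
    rw [norm_mul]
    exact (hcon _ (hmem τ ⟨hτ.1, hτ.2.le.trans hτ₁.1.2⟩) (hlt τ hτ)).le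
  have := norm_image_sub_le_of_norm_deriv_le_segment' (f := φ ∘ γ)
    (fun τ hτ => (hder τ ⟨hτ.1, hτ.2.trans hτ₁.1.2⟩).hasDerivWithinAt) hb τ₁
    (right_mem_Icc.2 hτ₁.1.1)
  have h2 : D ≤ ‖φ (γ τ₁) - φ z‖ := hτ₁.2
  simp only [Function.comp_apply, hγ0, sub_zero] at this
  have h3 := hτ₁.1.2
  nlinarith

/-- If the kernels composed with `φ` are bounded below, then near each point `w` there is a point
`φ q` at which `φ` has a large derivative. -/
theorem exists_le_norm_deriv_near {φ : ℂ → ℂ} (hφ : DifferentiableOn ℂ φ disk)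
    (hm : MapsTo φ disk disk) (hφm : Measurable φ) (hconst : ¬ ∃ c : ℂ, ∀ z ∈ disk, φ z = c)
    {δ : ℝ} (hδ : 0 < δ)
    (hb : ∀ w ∈ disk, ENNReal.ofReal δ ≤
      ∫⁻ z, ENNReal.ofReal ((1 - ‖w‖) ^ 2 / ‖1 - starRingEnd ℂ w * φ z‖ ^ 4) ∂diskArea) :
    ∃ c₁ c₂ c₃ : ℝ, 0 < c₁ ∧ 0 < c₂ ∧ 0 < c₃ ∧ ∀ w ∈ disk, ∃ q ∈ disk, c₁ ≤ ‖deriv φ q‖ ∧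
      c₂ * (1 - ‖w‖) ≤ 1 - ‖q‖ ∧ ‖φ q - w‖ ≤ c₃ * (1 - ‖w‖) := by
  obtain ⟨κ, η, hκ, hη, hnear⟩ := exists_le_setLIntegral_near hφ hm hφm hδ hb
  obtain ⟨c, hc, hc1, hcφ⟩ := exists_mul_one_sub_norm_le hφ hm
  obtain ⟨q₀, hq₀, hdq₀⟩ : ∃ q ∈ disk, deriv φ q ≠ 0 := by
    by_contra! h
    obtain ⟨a, ha⟩ := isOpen_ball.exists_is_const_of_deriv_eq_zero
      (convex_ball (0 : ℂ) 1).isPreconnected hφ h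
    exact hconst ⟨a, ha⟩
  have hq₀1 : 0 < 1 - ‖q₀‖ := by
    have : ‖q₀‖ < 1 := by simpa using hq₀
    linarith
  -- Chosen with cΛκ ≥ 4/η + 1: if 1 - |p| = Λ(1 - |z|), then 1 - |φ p| ≥ (4/η + 1)D by
  -- Schwarz–Pick, whereas 1 - |φ z| ≤ (4/η)D, so φ moves by at least D between z and p.
  set Λ : ℝ := (4 / η + 1) / (c * κ) + 1 with hΛ
  have hΛ1 : 1 < Λ := by
    have : 0 < (4 / η + 1) / (c * κ) := by positivity
    linarith
  have hΛ0 : 0 < Λ := by linarith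
  have hΛ2 : 4 / η + 1 ≤ c * Λ * κ := by
    have h1 : c * Λ * κ = (4 / η + 1) + c * κ := by rw [hΛ]; field_simp
    rw [h1]
    have : 0 < c * κ := by positivity
    linarith
  set c₀ : ℝ := c * η / (4 * Λ) with hc₀
  have hc₀pos : 0 < c₀ := by positivity
  refine ⟨min (c * η / (8 * Λ)) ‖deriv φ q₀‖, min κ (1 - ‖q₀‖), max (1 + 4 / η) (2 / c₀),
    lt_min (by positivity) (norm_pos_iff.2 hdq₀), lt_min hκ hq₀1,
    lt_max_of_lt_left (by positivity), fun w hw => ?_⟩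
  have hw1 : ‖w‖ < 1 := by simpa using hw
  set D := 1 - ‖w‖ with hD
  have hDpos : 0 < D := by linarith
  have hD1 : D ≤ 1 := by linarith [norm_nonneg w]
  obtain ⟨z, hz, hzκ, hzη⟩ := exists_mem_disk_of_setLIntegral_pos
    ((ENNReal.ofReal_pos.2 (half_pos hδ)).trans_le (hnear w hw))
  have hz1 : ‖z‖ < 1 := by simpa using hz
  have hφz1 : ‖φ z‖ < 1 := by simpa using hm hz
  obtain ⟨hn1, hn2, hn3⟩ := near_bounds hw1 hφz1 hη hzη
  rw [← hD] at hn1 hn2 hn3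
  have hcz := hcφ z hz
  have hczD : c * (1 - ‖z‖) ≤ 4 / η * D := hcz.trans hn1
  -- Together with `hzκ` this makes 1 - |z| comparable to D, so moving D over the segment from z to
  -- p means a derivative bounded below.
  have hzD : 1 - ‖z‖ ≤ 4 * D / (c * η) := by
    rw [le_div_iff₀ (by positivity)]
    calc (1 - ‖z‖) * (c * η) = c * (1 - ‖z‖) * η := by ring
      _ ≤ (4 / η * D) * η := by gcongr
      _ = _ := by field_simp
  -- This is the condition for the radial point p to exist. If it fails, D is bounded below by c₀,
  -- and the fixed point q₀ with φ'(q₀) ≠ 0 serves for all such w.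
  by_cases hcase : Λ * (1 - ‖z‖) ≤ 1
  · have hz0 : 0 < ‖z‖ := by nlinarith
    set t : ℝ := (1 - Λ * (1 - ‖z‖)) / ‖z‖ with ht
    have ht0 : 0 ≤ t := div_nonneg (by linarith) hz0.le
    have ht1 : t ≤ 1 := by
      rw [ht, div_le_one hz0]
      nlinarith
    set p : ℂ := t • z with hp
    have hpn : ‖p‖ = 1 - Λ * (1 - ‖z‖) := by
      rw [hp, norm_smul, Real.norm_of_nonneg ht0, ht, div_mul_cancel₀ _ hz0.ne']
    have hpz : ‖p - z‖ ≤ Λ * (1 - ‖z‖) := by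
      have h1 : p - z = (t - 1) • z := by rw [hp, sub_smul, one_smul]
      have h2 : ‖p - z‖ = ‖z‖ - ‖p‖ := by
        rw [h1, norm_smul, hp, norm_smul, Real.norm_of_nonneg ht0, norm_sub_rev,
          Real.norm_of_nonneg (by linarith)]
        ring
      rw [h2, hpn]
      linarith
    have hple : ‖p‖ ≤ ‖z‖ := by rw [hpn]; nlinarith
    have hseg : segment ℝ z p ⊆ closedBall 0 ‖z‖ :=
      (convex_closedBall (0 : ℂ) ‖z‖).segment_subset (by simp) (by simpa using hple)
    have hsegU : segment ℝ z p ⊆ disk := hseg.trans (closedBall_subset_ball hz1)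
    have hpd : p ∈ disk := hsegU (right_mem_segment ℝ z p)
    have hmove : D ≤ ‖φ p - φ z‖ := by
      have h1 := hcφ p hpd
      rw [hpn] at h1
      have h2 := norm_sub_norm_le (φ z) (φ p)
      rw [norm_sub_rev] at h2
      have h3 : (4 / η + 1) * D ≤ c * Λ * (1 - ‖z‖) := by
        calc (4 / η + 1) * D ≤ c * Λ * κ * D := by gcongr
          _ = c * Λ * (κ * D) := by ring
          _ ≤ _ := by gcongr
      linarith
    obtain ⟨q, hq, hq1, hq2⟩ := exists_mem_segment_le_norm_deriv isOpen_ball hφ hsegU hDpos hmove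
    have hqz : ‖q‖ ≤ ‖z‖ := by simpa using hseg hq
    refine ⟨q, hsegU hq, (min_le_left _ _).trans ?_, ?_, ?_⟩
    · have h1 : D / 2 ≤ ‖deriv φ q‖ * (Λ * (4 * D / (c * η))) := by
        refine hq2.trans ?_
        gcongr
        exact hpz.trans (by gcongr)
      rw [div_le_iff₀ (by positivity)]
      have h2 : ‖deriv φ q‖ * (Λ * (4 * D / (c * η))) = ‖deriv φ q‖ * (4 * Λ) * D / (c * η) := by
        ring
      rw [h2, le_div_iff₀ (by positivity)] at h1
      refine le_of_mul_le_mul_right ?_ hDpos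
      linarith
    · calc min κ (1 - ‖q₀‖) * D ≤ κ * D := by gcongr; exact min_le_left _ _
        _ ≤ 1 - ‖q‖ := by linarith
    · calc ‖φ q - w‖ ≤ ‖φ q - φ z‖ + ‖w - φ z‖ := by
            rw [norm_sub_rev w]; exact norm_sub_le_norm_sub_add_norm_sub _ _ _
        _ ≤ (1 + 4 / η) * D := by linarith
        _ ≤ _ := by gcongr; exact le_max_left _ _
  · push Not at hcase
    have hDc : c₀ ≤ D := by
      have h1 : Λ * (1 - ‖z‖) ≤ Λ * (4 * D / (c * η)) := by gcongr
      have h2 : 1 ≤ 4 * Λ * D / (c * η) := by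
        refine hcase.le.trans (h1.trans_eq (by ring))
      rw [le_div_iff₀ (by positivity), one_mul] at h2
      rw [hc₀, div_le_iff₀ (by positivity)]
      linarith
    refine ⟨q₀, hq₀, min_le_right _ _, ?_, ?_⟩
    · calc min κ (1 - ‖q₀‖) * D ≤ (1 - ‖q₀‖) * 1 := by
            gcongr
            exact min_le_right _ _
        _ = _ := mul_one _
    · have hφq : ‖φ q₀‖ < 1 := by simpa using hm hq₀
      calc ‖φ q₀ - w‖ ≤ ‖φ q₀‖ + ‖w‖ := norm_sub_le _ _
        _ ≤ 2 := by linarith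
        _ = 2 / c₀ * c₀ := by field_simp
        _ ≤ 2 / c₀ * D := by gcongr
        _ ≤ _ := by gcongr; exact le_max_right _ _

/-! ### The pointwise alternative -/

theorem norm_le_sqrt_div_of_ball_subset {f : ℂ → ℂ} {y : ℂ} {r : ℝ} (hr : 0 < r)
    (hf : DifferentiableOn ℂ f (ball y r)) (hd : ball y r ⊆ disk) {S : Set ℂ}
    (hS : ball y r ⊆ S) (hfin : ∫⁻ x in S, ‖f x‖ₑ ^ 2 ∂diskArea ≠ ⊤) :
    ‖f y‖ ≤ √(∫⁻ x in S, ‖f x‖ₑ ^ 2 ∂diskArea).toReal / r := by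
  have h1 := (enorm_sq_mul_le_setLIntegral hf hd).trans (lintegral_mono_set hS)
  rw [← mul_pow, ← ofReal_norm, ← ENNReal.ofReal_mul (norm_nonneg _),
    ← ENNReal.ofReal_pow (by positivity), ENNReal.ofReal_le_iff_le_toReal hfin] at h1
  rw [le_div_iff₀ hr]
  exact Real.le_sqrt_of_sq_le h1

set_option maxHeartbeats 1000000 in
/-- At each point `w` either `|f w|` is small compared to the mean of `|f|` near `w`, or it is
controlled by `f ∘ φ`. -/
theorem exists_enorm_sq_le_or_le {φ : ℂ → ℂ} (hφ : DifferentiableOn ℂ φ disk)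
    (hm : MapsTo φ disk disk) {c₁ c₂ c₃ : ℝ} (hc₁ : 0 < c₁) (hc₂ : 0 < c₂) (hc₃ : 0 < c₃)
    (hnear : ∀ w ∈ disk, ∃ q ∈ disk, c₁ ≤ ‖deriv φ q‖ ∧
      c₂ * (1 - ‖w‖) ≤ 1 - ‖q‖ ∧ ‖φ q - w‖ ≤ c₃ * (1 - ‖w‖)) :
    ∃ k K : ℝ, 0 < k ∧ 0 < K ∧ ∀ ε : ℝ, 0 < ε → ∃ A : ℝ, 0 < A ∧ ∀ f : ℂ → ℂ,
      DifferentiableOn ℂ f disk → ∀ w ∈ disk,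
      ‖f w‖ₑ ^ 2 * ENNReal.ofReal ((1 - ‖w‖) ^ 2) ≤ ENNReal.ofReal ε *
        ∫⁻ x in {x | k * (1 - ‖w‖) ≤ 1 - ‖x‖ ∧ ‖x - w‖ ≤ K * (1 - ‖w‖)}, ‖f x‖ₑ ^ 2 ∂diskArea ∨
      ‖f w‖ₑ ^ 2 * ENNReal.ofReal ((1 - ‖w‖) ^ 2) ≤ ENNReal.ofReal A *
        ∫⁻ x in {x | k * (1 - ‖w‖) ≤ 1 - ‖x‖ ∧ ‖φ x - w‖ ≤ K * (1 - ‖w‖)},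
          ‖f (φ x)‖ₑ ^ 2 ∂diskArea := by
  obtain ⟨c, hc, hc1, hcφ⟩ := exists_mul_one_sub_norm_le hφ hm
  -- c₇D bounds 1 - |w| and 1 - |φ q| from below, so by convexity the whole segment from φ(q) to w
  -- keeps that distance from the circle.
  set c₇ : ℝ := min (c * c₂) 1 with hc₇
  have hc₇0 : 0 < c₇ := lt_min (by positivity) one_pos
  have hc₇1 : c₇ ≤ 1 := min_le_right _ _
  -- c₅D is the radius covered about φ(q) by `ball_subset_image_of_le_norm_deriv`, applied with
  -- radius c₂D/2 and oscillation 2(1 + c₃)D.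
  set c₅ : ℝ := c₁ ^ 2 * (c₂ / 2) ^ 2 / (24 * (2 * (1 + c₃))) with hc₅
  have hc₅0 : 0 < c₅ := by positivity
  -- The chain radius r = c₆D has to be below c₅D, and 5r at most c₇D/2.
  set c₆ : ℝ := min (c₅ / 2) (c₇ / 10) with hc₆
  have hc₆0 : 0 < c₆ := lt_min (by positivity) (by positivity)
  have hc₆5 : c₆ < c₅ := (min_le_left _ _).trans_lt (by linarith)
  have hc₆7 : c₆ ≤ c₇ / 10 := min_le_right _ _
  refine ⟨min (c₇ / 2) (c₂ / 2), 3 + 3 * c₃, by positivity, by positivity, fun ε hε => ?_⟩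
  -- Enough steps of length r/2 to get from φ(q) to w, as |φ(q) - w| ≤ c₃D.
  obtain ⟨N, hN⟩ := exists_nat_ge (2 * c₃ / c₆)
  obtain ⟨η, hη, hchain⟩ := exists_norm_le_mul_of_segment N (ε := √ε * c₆) (by positivity)
  -- 144 = 12²: below, m is √IP divided by R/6 with R = c₂D/2, so mD = 12√IP/c₂.
  refine ⟨144 / (c₂ ^ 2 * η ^ 2), by positivity, fun f hf w hw => ?_⟩
  have hw1 : ‖w‖ < 1 := by simpa using hw
  obtain ⟨q, hq, hq1, hq2, hq3⟩ := hnear w hw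
  set D := 1 - ‖w‖ with hD
  have hDpos : 0 < D := by linarith
  set k := min (c₇ / 2) (c₂ / 2) with hk
  set SQ : Set ℂ := {x | k * D ≤ 1 - ‖x‖ ∧ ‖x - w‖ ≤ (3 + 3 * c₃) * D} with hSQ
  set SP : Set ℂ := {x | k * D ≤ 1 - ‖x‖ ∧ ‖φ x - w‖ ≤ (3 + 3 * c₃) * D} with hSP
  set IQ := ∫⁻ x in SQ, ‖f x‖ₑ ^ 2 ∂diskArea with hIQ
  set IP := ∫⁻ x in SP, ‖f (φ x)‖ₑ ^ 2 ∂diskArea with hIP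
  by_cases hIQt : IQ = ⊤
  · left
    rw [hIQt, ENNReal.mul_top (by simpa using hε)]
    exact le_top
  by_cases hIPt : IP = ⊤
  · right
    rw [hIPt, ENNReal.mul_top (by
      simp only [ne_eq, ENNReal.ofReal_eq_zero, not_le]
      positivity)]
    exact le_top
  have hq1' : ‖q‖ < 1 := by simpa using hq
  have hφq : φ q ∈ disk := hm hq
  have hφq1 : ‖φ q‖ < 1 := by simpa using hφq
  set R : ℝ := c₂ / 2 * D with hR
  have hRpos : 0 < R := by positivity
  have hqball : ball q (1 - ‖q‖) ⊆ disk := ball_subset_ball' (by rw [dist_zero_right]; linarith)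
  have hRq : R ≤ (1 - ‖q‖) / 2 := by rw [hR]; linarith
  have hEq : 1 - ‖φ q‖ ≤ (1 + c₃) * D := by
    have := norm_sub_norm_le w (φ q)
    rw [norm_sub_rev] at this
    linarith
  have hEq2 : c₇ * D ≤ 1 - ‖φ q‖ := by
    refine le_trans ?_ (hcφ q hq)
    calc c₇ * D ≤ c * c₂ * D := by gcongr; exact min_le_left _ _
      _ = c * (c₂ * D) := by ring
      _ ≤ _ := by gcongr
  have hosc : ∀ x ∈ ball q R, ‖φ x - φ q‖ ≤ 2 * (1 + c₃) * D := by
    intro x hx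
    rw [mem_ball, dist_eq_norm] at hx
    refine (norm_sub_le_two_mul (hφ.mono hqball) (hm.mono_left hqball) (x := x) ?_
      (by linarith)).trans (by linarith)
    rw [mem_ball, dist_eq_norm]
    linarith
  have hRball : ball q R ⊆ disk := (ball_subset_ball (by linarith)).trans hqball
  obtain ⟨-, hs6, hcov⟩ := ball_subset_image_of_le_norm_deriv hRpos (hφ.mono hRball) hosc hc₁ hq1
  have hrad : c₁ ^ 2 * R ^ 2 / (24 * (2 * (1 + c₃) * D)) = c₅ * D := by
    rw [hR, hc₅]; field_simp
  rw [hrad] at hcov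
  set r : ℝ := c₆ * D with hr
  have hrpos : 0 < r := by positivity
  -- M bounds |f| within 4r of the segment. The number m bounds |f| on the closed r-ball about φ(q),
  -- each point of which is φ(x) with |x - q| ≤ R/6.
  set M : ℝ := √IQ.toReal / r with hM
  set m : ℝ := √IP.toReal / (R / 6) with hmdef
  have hM0 : 0 ≤ M := by positivity
  have hc₇D : c₇ * D ≤ D := mul_le_of_le_one_left hDpos.le hc₇1
  have hseg : segment ℝ (φ q) w ⊆ closedBall 0 (1 - c₇ * D) ∩ closedBall w (c₃ * D) := by
    refine ((convex_closedBall _ _).inter (convex_closedBall _ _)).segment_subset ⟨?_, ?_⟩ ⟨?_, ?_⟩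
    · rw [mem_closedBall_zero_iff]; linarith
    · rw [mem_closedBall, dist_eq_norm]; exact hq3
    · rw [mem_closedBall_zero_iff]; linarith
    · exact mem_closedBall_self (by positivity)
  have h5r : 5 * r ≤ c₇ * D / 2 := by
    have := mul_le_mul_of_nonneg_right hc₆7 hDpos.le
    rw [hr]
    linarith
  have hseg5 : ∀ x ∈ segment ℝ (φ q) w, ∀ y ∈ ball x (5 * r), y ∈ disk ∧ y ∈ SQ := by
    intro x hx y hy
    obtain ⟨h1, h2⟩ := hseg hx
    rw [mem_closedBall_zero_iff] at h1
    rw [mem_closedBall, dist_eq_norm] at h2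
    rw [mem_ball, dist_eq_norm] at hy
    have h3 : ‖y‖ ≤ ‖x‖ + ‖y - x‖ := norm_le_norm_add_norm_sub' y x
    have h4 : ‖y - w‖ ≤ ‖y - x‖ + ‖x - w‖ := norm_sub_le_norm_sub_add_norm_sub _ _ _
    have h5 : 0 < c₇ * D := by positivity
    have h6 : k * D ≤ c₇ * D / 2 := by
      have := mul_le_mul_of_nonneg_right (min_le_left _ _ : k ≤ c₇ / 2) hDpos.le
      linarith
    refine ⟨by rw [mem_ball_zero_iff]; linarith, by linarith, ?_⟩
    have : 0 < c₃ * D := by positivity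
    linarith
  have hbM : ∀ x ∈ segment ℝ (φ q) w, ∀ y ∈ closedBall x (4 * r), ‖f y‖ ≤ M := by
    intro x hx y hy
    have hsub : ball y r ⊆ ball x (5 * r) := ball_subset_ball' (by
      rw [mem_closedBall] at hy; linarith)
    exact norm_le_sqrt_div_of_ball_subset hrpos
      (hf.mono fun z hz => (hseg5 x hx z (hsub hz)).1)
      (fun z hz => (hseg5 x hx z (hsub hz)).1) (fun z hz => (hseg5 x hx z (hsub hz)).2) hIQt
  have hbm : ∀ y ∈ closedBall (φ q) r, ‖f y‖ ≤ m := by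
    intro y hy
    obtain ⟨x, hx, rfl⟩ := hcov (closedBall_subset_ball
      (show r < c₅ * D by rw [hr]; gcongr) hy)
    have hsub : ball x (R / 6) ⊆ ball q R := ball_subset_ball' (by
      rw [mem_closedBall] at hx; linarith)
    have hcomp : DifferentiableOn ℂ (fun x => f (φ x)) (ball x (R / 6)) :=
      (hf.comp hφ hm).mono (hsub.trans hRball)
    refine norm_le_sqrt_div_of_ball_subset (f := fun x => f (φ x)) (by positivity) hcomp
      (hsub.trans hRball) (fun z hz => ⟨?_, ?_⟩) hIPt
    · have h1 := hsub hz
      rw [mem_ball, dist_eq_norm] at h1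
      have h3 : ‖z‖ ≤ ‖q‖ + ‖z - q‖ := norm_le_norm_add_norm_sub' z q
      have h6 : k * D ≤ c₂ / 2 * D := by gcongr; exact min_le_right _ _
      linarith
    · have h1 := hosc z (hsub hz)
      have h4 : ‖φ z - w‖ ≤ ‖φ z - φ q‖ + ‖φ q - w‖ := norm_sub_le_norm_sub_add_norm_sub _ _ _
      have : 0 < c₃ * D := by positivity
      linarith
  have hconv : ∀ (I : ℝ≥0∞) (B : ℝ), I ≠ ⊤ → 0 ≤ B → (‖f w‖ * D) ^ 2 ≤ B * I.toReal →
      ‖f w‖ₑ ^ 2 * ENNReal.ofReal (D ^ 2) ≤ ENNReal.ofReal B * I := by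
    intro I B hI hB h
    rw [← ENNReal.ofReal_toReal hI, ← ENNReal.ofReal_mul hB, ← ofReal_norm,
      ← ENNReal.ofReal_pow (norm_nonneg _), ← ENNReal.ofReal_mul (by positivity), ← mul_pow]
    exact ENNReal.ofReal_le_ofReal h
  -- If m ≤ ηM, smallness propagates along the segment to w; otherwise M itself, and with it |f(w)|,
  -- is at most m/η.
  rcases le_or_gt m (η * M) with hcase | hcase
  · left
    refine hconv _ _ hIQt hε.le ?_
    have hfw := hchain f (φ q) w r M hrpos ?_ (fun x hx => hf.mono fun z hz => (hseg5 x hx z hz).1)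
      hbM (fun y hy => (hbm y hy).trans hcase)
    · calc (‖f w‖ * D) ^ 2 ≤ (√ε * c₆ * M * D) ^ 2 := by gcongr
        _ = (√ε) ^ 2 * (√IQ.toReal) ^ 2 := by rw [hM, hr]; field_simp
        _ = _ := by rw [Real.sq_sqrt hε.le, Real.sq_sqrt ENNReal.toReal_nonneg]
    · rw [norm_sub_rev]
      refine hq3.trans ?_
      rw [div_le_iff₀ hc₆0] at hN
      have := mul_le_mul_of_nonneg_right hN hDpos.le
      rw [hr]
      linarith
  · right
    refine hconv _ _ hIPt (by positivity) ?_
    have hfw : ‖f w‖ ≤ m / η := by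
      refine (hbM w (right_mem_segment ℝ _ _) w (mem_closedBall_self (by positivity))).trans ?_
      rw [le_div_iff₀ hη]
      linarith
    calc (‖f w‖ * D) ^ 2 ≤ (m / η * D) ^ 2 := by gcongr
      _ = 144 / (c₂ ^ 2 * η ^ 2) * (√IP.toReal) ^ 2 := by
        rw [hmdef, hR]; field_simp; ring
      _ = _ := by rw [Real.sq_sqrt ENNReal.toReal_nonneg]

/-! ### Local averages and the lower bound for composition -/

theorem measurable_setLIntegral_near {ψ : ℂ → ℂ} (hψ : Measurable ψ) (k K : ℝ) {G : ℂ → ℝ≥0∞}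
    (hG : Measurable G) :
    Measurable fun w => ∫⁻ x in {x | k * (1 - ‖w‖) ≤ 1 - ‖x‖ ∧ ‖ψ x - w‖ ≤ K * (1 - ‖w‖)},
      G x ∂diskArea := by
  set S : Set (ℂ × ℂ) := {p | k * (1 - ‖p.1‖) ≤ 1 - ‖p.2‖} ∩ {p | ‖ψ p.2 - p.1‖ ≤ K * (1 - ‖p.1‖)}
  have hS : MeasurableSet S := (measurableSet_le (by fun_prop) (by fun_prop)).inter
    (measurableSet_le (by fun_prop) (by fun_prop))
  have hm : Measurable (S.indicator fun p => G p.2) := Measurable.indicator (by fun_prop) hS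
  convert hm.lintegral_prod_right' (ν := diskArea) using 2 with w
  have hSw : MeasurableSet {x | k * (1 - ‖w‖) ≤ 1 - ‖x‖ ∧ ‖ψ x - w‖ ≤ K * (1 - ‖w‖)} :=
    measurable_prodMk_left hS
  rw [← lintegral_indicator hSw]
  rfl

/-- Averaging over regions of bounded hyperbolic size is bounded. -/
theorem exists_lintegral_average_le {ψ : ℂ → ℂ} (hψ : Measurable ψ) {c k K : ℝ} (hc : 0 < c)
    (hcψ : ∀ x ∈ disk, c * (1 - ‖x‖) ≤ 1 - ‖ψ x‖) (hk : 0 < k) (hK : 0 < K) :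
    ∃ C : ℝ, 0 < C ∧ ∀ G : ℂ → ℝ≥0∞, Measurable G →
      ∫⁻ w, ENNReal.ofReal (((1 - ‖w‖) ^ 2)⁻¹) *
        ∫⁻ x in {x | k * (1 - ‖w‖) ≤ 1 - ‖x‖ ∧ ‖ψ x - w‖ ≤ K * (1 - ‖w‖)}, G x ∂diskArea
        ∂diskArea ≤ ENNReal.ofReal C * ∫⁻ x, G x ∂diskArea := by
  -- By Fubini: for fixed x, the w whose region contains x lie within (K/k)(1 - |x|) of ψ(x),
  -- doubled to get an open ball, and satisfy 1 - |w| ≥ c(1 - |x|)/(1 + K).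
  refine ⟨((1 + K) / c) ^ 2 * (2 * K / k) ^ 2, by positivity, fun G hG => ?_⟩
  set S : Set (ℂ × ℂ) := {p | k * (1 - ‖p.1‖) ≤ 1 - ‖p.2‖} ∩ {p | ‖ψ p.2 - p.1‖ ≤ K * (1 - ‖p.1‖)}
    with hSdef
  have hS : MeasurableSet S := (measurableSet_le (by fun_prop) (by fun_prop)).inter
    (measurableSet_le (by fun_prop) (by fun_prop))
  set H : ℂ → ℂ → ℝ≥0∞ := fun w x =>
    S.indicator (fun p => ENNReal.ofReal (((1 - ‖p.1‖) ^ 2)⁻¹) * G p.2) (w, x) with hH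
  have hHm : Measurable (Function.uncurry H) := by
    have : Function.uncurry H =
        S.indicator (fun p => ENNReal.ofReal (((1 - ‖p.1‖) ^ 2)⁻¹) * G p.2) := by
      ext ⟨x, u⟩; rfl
    rw [this]
    exact Measurable.indicator (by fun_prop) hS
  calc _ = ∫⁻ w, ∫⁻ x, H w x ∂diskArea ∂diskArea := by
        refine lintegral_congr fun w => ?_
        have hSw : MeasurableSet {x | k * (1 - ‖w‖) ≤ 1 - ‖x‖ ∧ ‖ψ x - w‖ ≤ K * (1 - ‖w‖)} :=
          measurable_prodMk_left hS
        rw [← lintegral_const_mul' _ _ ENNReal.ofReal_ne_top, ← lintegral_indicator hSw]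
        rfl
    _ = ∫⁻ x, ∫⁻ w, H w x ∂diskArea ∂diskArea := lintegral_lintegral_swap hHm.aemeasurable
    _ ≤ ∫⁻ x, ENNReal.ofReal (((1 + K) / c) ^ 2 * (2 * K / k) ^ 2) * G x ∂diskArea := by
        refine lintegral_mono_ae (ae_mem_disk.mono fun x hx => ?_)
        have hx1 : ‖x‖ < 1 := by simpa using hx
        set t := 1 - ‖x‖ with ht
        have htpos : 0 < t := by linarith
        calc ∫⁻ w, H w x ∂diskArea ≤ ∫⁻ w, (ball (ψ x) (2 * K / k * t)).indicator
              (fun _ => ENNReal.ofReal (((1 + K) / (c * t)) ^ 2) * G x) w ∂diskArea := by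
              refine lintegral_mono_ae (ae_mem_disk.mono fun w hw => ?_)
              have hw1 : ‖w‖ < 1 := by simpa using hw
              by_cases hxS : (w, x) ∈ S
              · obtain ⟨h1, h2⟩ : k * (1 - ‖w‖) ≤ t ∧ ‖ψ x - w‖ ≤ K * (1 - ‖w‖) := id hxS
                have hDpos : 0 < 1 - ‖w‖ := by linarith
                have h3 : 1 - ‖w‖ ≤ t / k := by rw [le_div_iff₀ hk]; linarith
                have hball : w ∈ ball (ψ x) (2 * K / k * t) := by
                  rw [mem_ball, dist_comm, dist_eq_norm]
                  refine h2.trans_lt ?_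
                  calc K * (1 - ‖w‖) ≤ K * (t / k) := by gcongr
                    _ < 2 * (K * (t / k)) := by
                      have : 0 < K * (t / k) := by positivity
                      linarith
                    _ = _ := by ring
                simp only [hH]
                rw [indicator_of_mem hxS, indicator_of_mem hball]
                gcongr
                have h4 := hcψ x hx
                have h5 : ‖w‖ - ‖ψ x‖ ≤ ‖ψ x - w‖ := by
                  rw [norm_sub_rev]; exact norm_sub_norm_le _ _
                rw [← inv_pow]
                gcongr
                rw [inv_le_iff_one_le_mul₀ hDpos, div_mul_eq_mul_div, le_div_iff₀ (by positivity)]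
                linarith
              · simp only [hH]
                rw [indicator_of_notMem hxS]
                exact zero_le
          _ ≤ ENNReal.ofReal (((1 + K) / (c * t)) ^ 2) * G x *
              ENNReal.ofReal (2 * K / k * t) ^ 2 := by
              rw [lintegral_indicator measurableSet_ball, setLIntegral_const]
              gcongr
              exact diskArea_ball_le _ _
          _ = _ := by
              rw [mul_right_comm, ← ENNReal.ofReal_pow (by positivity),
                ← ENNReal.ofReal_mul (by positivity)]
              congr 2
              field_simp
    _ = _ := lintegral_const_mul _ hG

/-- If the kernels composed with `φ` are bounded below, then so is the composition with `φ`. -/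
theorem exists_lintegral_le_lintegral_comp {φ : ℂ → ℂ} (hφ : DifferentiableOn ℂ φ disk)
    (hm : MapsTo φ disk disk) (hφm : Measurable φ) (hconst : ¬ ∃ c : ℂ, ∀ z ∈ disk, φ z = c)
    {δ : ℝ} (hδ : 0 < δ)
    (hb : ∀ w ∈ disk, ENNReal.ofReal δ ≤
      ∫⁻ z, ENNReal.ofReal ((1 - ‖w‖) ^ 2 / ‖1 - starRingEnd ℂ w * φ z‖ ^ 4) ∂diskArea) :
    ∃ C : ℝ, 0 < C ∧ ∀ f : ℂ → ℂ, DifferentiableOn ℂ f disk →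
      ∫⁻ z, ‖f z‖ₑ ^ 2 ∂diskArea ≠ ⊤ →
      ∫⁻ z, ‖f z‖ₑ ^ 2 ∂diskArea ≤ ENNReal.ofReal C * ∫⁻ z, ‖f (φ z)‖ₑ ^ 2 ∂diskArea := by
  obtain ⟨c₁, c₂, c₃, hc₁, hc₂, hc₃, hnear⟩ := exists_le_norm_deriv_near hφ hm hφm hconst hδ hb
  obtain ⟨k, K, hk, hK, halt⟩ := exists_enorm_sq_le_or_le hφ hm hc₁ hc₂ hc₃ hnear
  obtain ⟨c, hc, -, hcφ⟩ := exists_mul_one_sub_norm_le hφ hm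
  obtain ⟨C₁, hC₁, h₁⟩ := exists_lintegral_average_le measurable_id one_pos
    (fun x _ => by simp) hk hK
  obtain ⟨C₂, hC₂, h₂⟩ := exists_lintegral_average_le hφm hc hcφ hk hK
  -- With this ε the first alternative contributes at most half of ∫ |f|², which can be absorbed
  -- because that integral is finite.
  obtain ⟨A, hA, halt⟩ := halt (1 / (2 * C₁)) (by positivity)
  refine ⟨2 * (A * C₂), by positivity, fun f hf hfin => ?_⟩
  set F := disk.indicator fun z => ‖f z‖ₑ ^ 2 with hF
  have hFm : Measurable F := measurable_indicator_enorm_sq hf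
  have hFφ : Measurable fun x => F (φ x) := hFm.comp hφm
  have hFint : ∫⁻ z, F z ∂diskArea = ∫⁻ z, ‖f z‖ₑ ^ 2 ∂diskArea := lintegral_indicator_disk _
  have e₁ : ∀ᵐ x ∂diskArea, ‖f x‖ₑ ^ 2 = F x := ae_mem_disk.mono fun x hx => by
    rw [hF, indicator_of_mem hx]
  have e₂ : ∀ᵐ x ∂diskArea, ‖f (φ x)‖ₑ ^ 2 = F (φ x) := ae_mem_disk.mono fun x hx => by
    rw [hF, indicator_of_mem (hm hx)]
  set Q : ℂ → ℝ≥0∞ := fun w =>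
    ∫⁻ x in {x | k * (1 - ‖w‖) ≤ 1 - ‖x‖ ∧ ‖id x - w‖ ≤ K * (1 - ‖w‖)}, F x ∂diskArea with hQ
  set P : ℂ → ℝ≥0∞ := fun w =>
    ∫⁻ x in {x | k * (1 - ‖w‖) ≤ 1 - ‖x‖ ∧ ‖φ x - w‖ ≤ K * (1 - ‖w‖)}, F (φ x) ∂diskArea with hP
  have hQm : Measurable Q := measurable_setLIntegral_near measurable_id k K hFm
  have hPm : Measurable P := measurable_setLIntegral_near hφm k K hFφ
  have hpt : ∀ w ∈ disk, ‖f w‖ₑ ^ 2 ≤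
      ENNReal.ofReal (1 / (2 * C₁)) * (ENNReal.ofReal (((1 - ‖w‖) ^ 2)⁻¹) * Q w) +
      ENNReal.ofReal A * (ENNReal.ofReal (((1 - ‖w‖) ^ 2)⁻¹) * P w) := by
    intro w hw
    have hw1 : ‖w‖ < 1 := by simpa using hw
    have hDpos : 0 < 1 - ‖w‖ := by linarith
    have hone : ENNReal.ofReal (((1 - ‖w‖) ^ 2)⁻¹) * ENNReal.ofReal ((1 - ‖w‖) ^ 2) = 1 := by
      rw [← ENNReal.ofReal_mul (by positivity), inv_mul_cancel₀ (by positivity), ENNReal.ofReal_one]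
    have hmul : ∀ B : ℝ≥0∞, ‖f w‖ₑ ^ 2 * ENNReal.ofReal ((1 - ‖w‖) ^ 2) ≤ B →
        ‖f w‖ₑ ^ 2 ≤ ENNReal.ofReal (((1 - ‖w‖) ^ 2)⁻¹) * B := by
      intro B hB
      calc ‖f w‖ₑ ^ 2 = ENNReal.ofReal (((1 - ‖w‖) ^ 2)⁻¹) *
            (‖f w‖ₑ ^ 2 * ENNReal.ofReal ((1 - ‖w‖) ^ 2)) := by
            rw [mul_left_comm, hone, mul_one]
        _ ≤ _ := by gcongr
    rcases halt f hf w hw with h | h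
    · rw [lintegral_congr_ae (ae_restrict_of_ae e₁)] at h
      refine (hmul _ h).trans (le_add_right (le_of_eq ?_))
      rw [mul_left_comm]
      rfl
    · rw [lintegral_congr_ae (ae_restrict_of_ae e₂)] at h
      refine (hmul _ h).trans (le_add_left (le_of_eq ?_))
      rw [mul_left_comm]
  set I := ∫⁻ z, ‖f z‖ₑ ^ 2 ∂diskArea with hI
  set J := ∫⁻ z, ‖f (φ z)‖ₑ ^ 2 ∂diskArea with hJ
  have hle : I ≤ ENNReal.ofReal (1 / 2) * I + ENNReal.ofReal (A * C₂) * J := by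
    calc I ≤ ∫⁻ w, (ENNReal.ofReal (1 / (2 * C₁)) * (ENNReal.ofReal (((1 - ‖w‖) ^ 2)⁻¹) * Q w) +
          ENNReal.ofReal A * (ENNReal.ofReal (((1 - ‖w‖) ^ 2)⁻¹) * P w)) ∂diskArea :=
          lintegral_mono_ae (ae_mem_disk.mono hpt)
      _ = ENNReal.ofReal (1 / (2 * C₁)) *
            ∫⁻ w, ENNReal.ofReal (((1 - ‖w‖) ^ 2)⁻¹) * Q w ∂diskArea +
          ENNReal.ofReal A * ∫⁻ w, ENNReal.ofReal (((1 - ‖w‖) ^ 2)⁻¹) * P w ∂diskArea := by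
          rw [lintegral_add_left (by fun_prop), lintegral_const_mul _ (by fun_prop),
            lintegral_const_mul _ (by fun_prop)]
      _ ≤ ENNReal.ofReal (1 / (2 * C₁)) * (ENNReal.ofReal C₁ * ∫⁻ x, F x ∂diskArea) +
          ENNReal.ofReal A * (ENNReal.ofReal C₂ * ∫⁻ x, F (φ x) ∂diskArea) := by
          gcongr
          · exact h₁ F hFm
          · exact h₂ _ hFφ
      _ = _ := by
          rw [hFint, ← lintegral_congr_ae e₂, ← mul_assoc, ← mul_assoc,
            ← ENNReal.ofReal_mul (by positivity), ← ENNReal.ofReal_mul (by positivity)]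
          congr 3
          field_simp
  have hhalf : I = ENNReal.ofReal (1 / 2) * I + ENNReal.ofReal (1 / 2) * I := by
    rw [← add_mul, ← ENNReal.ofReal_add (by norm_num) (by norm_num)]
    norm_num
  have h3 : ENNReal.ofReal (1 / 2) * I ≤ ENNReal.ofReal (A * C₂) * J := by
    refine (ENNReal.add_le_add_iff_left (a := ENNReal.ofReal (1 / 2) * I)
      (ENNReal.mul_ne_top ENNReal.ofReal_ne_top hfin)).1 ?_
    rw [← hhalf]
    exact hle
  rw [hhalf, ENNReal.ofReal_mul (by norm_num), ENNReal.ofReal_ofNat, two_mul, add_mul]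
  exact add_le_add h3 h3

/-! ### The reproducing formula -/

/-- Bochner integration over the disk in polar coordinates. -/
theorem integral_diskArea_eq_polar {h : ℂ → ℂ} (hc : ContinuousOn h disk)
    (hint : Integrable h diskArea) :
    ∫ z, h z ∂diskArea = (Real.pi)⁻¹ • ∫ s in Ioo (0 : ℝ) 1,
      s • ∫ θ in Ioo (-Real.pi) Real.pi, h (circleMap 0 s θ) := by
  classical
  set H : ℂ → ℂ := disk.indicator h with hH
  have hHm : Measurable H := by
    rw [hH, ← piecewise_eq_indicator]
    exact hc.measurable_piecewise continuousOn_const measurableSet_ball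
  have hp : ENNReal.ofReal Real.pi ≠ 0 := by simp [Real.pi_pos]
  have hHi : Integrable H volume := by
    rw [hH, integrable_indicator_iff measurableSet_ball]
    exact (integrable_smul_measure (ENNReal.inv_ne_zero.2 ENNReal.ofReal_ne_top)
      (ENNReal.inv_ne_top.2 hp)).1 hint
  have hpolar : ∀ s θ : ℝ, Complex.polarCoord.symm (s, θ) = circleMap 0 s θ := fun s θ => by
    rw [Complex.polarCoord_symm_apply, circleMap, Complex.exp_mul_I]
    push_cast
    ring
  have hmeas : Measurable fun p : ℝ × ℝ => p.1 • H (Complex.polarCoord.symm p) := by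
    simp only [Complex.polarCoord_symm_apply]
    fun_prop
  have hprod : Integrable (fun p : ℝ × ℝ => p.1 • H (Complex.polarCoord.symm p))
      ((volume.restrict (Ioi (0 : ℝ))).prod (volume.restrict (Ioo (-Real.pi) Real.pi))) := by
    refine ⟨hmeas.aestronglyMeasurable, ?_⟩
    rw [HasFiniteIntegral, Measure.prod_restrict, ← polarCoord_target, ← Measure.volume_eq_prod]
    calc _ = ∫⁻ p in polarCoord.target,
          ENNReal.ofReal p.1 • ‖H (Complex.polarCoord.symm p)‖ₑ := by
          refine setLIntegral_congr_fun polarCoord.open_target.measurableSet fun p hp => ?_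
          have : 0 < p.1 := hp.1
          simp only [enorm_smul, smul_eq_mul]
          rw [Real.enorm_eq_ofReal this.le]
      _ = ∫⁻ z, ‖H z‖ₑ := Complex.lintegral_comp_polarCoord_symm fun z => ‖H z‖ₑ
      _ < ⊤ := hHi.2
  rw [diskArea, integral_smul_measure, ENNReal.toReal_inv, ENNReal.toReal_ofReal Real.pi_pos.le]
  congr 1
  rw [← integral_indicator measurableSet_ball, ← hH, ← Complex.integral_comp_polarCoord_symm,
    polarCoord_target, Measure.volume_eq_prod, ← Measure.prod_restrict, integral_prod _ hprod]
  have hI : Ioo (0 : ℝ) 1 = Ioi 0 ∩ Iio 1 := rfl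
  rw [hI, inter_comm, ← Measure.restrict_restrict measurableSet_Iio,
    ← integral_indicator measurableSet_Iio]
  refine setIntegral_congr_fun measurableSet_Ioi fun s hs => ?_
  have hs : 0 < s := hs
  simp only [hpolar]
  rw [integral_smul]
  by_cases hs1 : s < 1
  · rw [indicator_of_mem (show s ∈ Iio 1 from hs1)]
    have hm : ∀ θ, circleMap 0 s θ ∈ disk := fun θ => by
      simpa [circleMap, abs_of_pos hs] using hs1
    simp only [hH, indicator_of_mem (hm _)]
  · rw [indicator_of_notMem (show s ∉ Iio 1 from hs1)]
    have hm : ∀ θ, circleMap 0 s θ ∉ disk := fun θ => by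
      simpa [circleMap, abs_of_pos hs] using hs1
    simp only [hH, indicator_of_notMem (hm _), integral_zero, smul_zero]

/-- Cauchy's formula for the derivative, on a circle about the origin, in terms of the Bergman
kernel. -/
theorem setIntegral_circleMap_div_eq {f : ℂ → ℂ} (hf : DifferentiableOn ℂ f disk) {z : ℂ}
    (hz : z ∈ disk) {s : ℝ} (hs : 0 < s) (hs1 : s < 1) :
    ∫ θ in Ioo (-Real.pi) Real.pi,
      f (circleMap 0 s θ) / (1 - z * starRingEnd ℂ (circleMap 0 s θ)) ^ 2 =
    2 * Real.pi * deriv (fun u => u * f u) (z * s ^ 2) := by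
  have hz1 : ‖z‖ < 1 := by simpa using hz
  have hP : DifferentiableOn ℂ (fun u => u * f u) disk := differentiableOn_id.mul hf
  have ha : z * (s : ℂ) ^ 2 ∈ ball (0 : ℂ) s := by
    rw [mem_ball_zero_iff, norm_mul, norm_pow, Complex.norm_real, Real.norm_of_nonneg hs.le]
    nlinarith [norm_nonneg z]
  have h1 := Complex.two_pi_I_inv_smul_circleIntegral_sub_sq_inv_smul_of_differentiable isOpen_ball
    (closedBall_subset_ball hs1 : closedBall (0 : ℂ) s ⊆ ball 0 1) hP ha
  have h2 : ∀ θ : ℝ, deriv (circleMap 0 s) θ • ((circleMap 0 s θ - z * (s : ℂ) ^ 2) ^ 2)⁻¹ •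
      (circleMap 0 s θ * f (circleMap 0 s θ)) =
      Complex.I * (f (circleMap 0 s θ) / (1 - z * starRingEnd ℂ (circleMap 0 s θ)) ^ 2) := by
    intro θ
    have hn : ‖circleMap 0 s θ‖ = s := by simp [circleMap, abs_of_pos hs]
    rw [deriv_circleMap]
    generalize circleMap 0 s θ = u at *
    have hu : u ≠ 0 := norm_pos_iff.1 (hn ▸ hs)
    have h3 : (s : ℂ) ^ 2 = u * starRingEnd ℂ u := by
      rw [Complex.mul_conj, Complex.normSq_eq_norm_sq, hn]
      push_cast
      rfl
    -- On |u| = s one has ū = s²/u, so the Bergman kernel turns into the Cauchy kernel for the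
    -- derivative of u f(u) at zs².
    have h4 : u - z * (s : ℂ) ^ 2 = u * (1 - z * starRingEnd ℂ u) := by rw [h3]; ring
    rw [h4, smul_eq_mul, smul_eq_mul, mul_pow, mul_inv]
    field_simp
  rw [circleIntegral] at h1
  simp only [h2] at h1
  rw [intervalIntegral.integral_const_mul] at h1
  have hper : Function.Periodic (fun θ : ℝ =>
      f (circleMap 0 s θ) / (1 - z * starRingEnd ℂ (circleMap 0 s θ)) ^ 2) (2 * Real.pi) :=
    fun θ => by simp only [periodic_circleMap 0 s θ]
  have h5 := hper.intervalIntegral_add_eq 0 (-Real.pi)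
  rw [zero_add, (by ring : -Real.pi + 2 * Real.pi = Real.pi)] at h5
  rw [← integral_Ioc_eq_integral_Ioo, ← intervalIntegral.integral_of_le (by linarith [Real.pi_pos]),
    ← h5, ← h1, smul_eq_mul]
  have hpi : (Real.pi : ℂ) ≠ 0 := by simp [Real.pi_ne_zero]
  field_simp

/-- The reproducing formula of the Bergman space. -/
theorem integral_div_eq {f : ℂ → ℂ} (hf : DifferentiableOn ℂ f disk) {z : ℂ} (hz : z ∈ disk)
    (hint : Integrable (fun w => f w / (1 - z * starRingEnd ℂ w) ^ 2) diskArea) :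
    ∫ w, f w / (1 - z * starRingEnd ℂ w) ^ 2 ∂diskArea = f z := by
  have hz1 : ‖z‖ < 1 := by simpa using hz
  have hc : ContinuousOn (fun w => f w / (1 - z * starRingEnd ℂ w) ^ 2) disk := by
    refine hf.continuousOn.div (by fun_prop) fun w hw => pow_ne_zero 2 ?_
    have hw1 : ‖w‖ < 1 := by simpa using hw
    rw [mul_comm]
    exact one_sub_conj_mul_ne_zero hw1 hz1.le
  rw [integral_diskArea_eq_polar hc hint]
  have h1 : ∫ s in Ioo (0 : ℝ) 1, s • ∫ θ in Ioo (-Real.pi) Real.pi,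
      f (circleMap 0 s θ) / (1 - z * starRingEnd ℂ (circleMap 0 s θ)) ^ 2 =
      ∫ s in Ioo (0 : ℝ) 1, (Real.pi : ℂ) *
        (2 * s * deriv (fun u => u * f u) (z * (s : ℂ) ^ 2)) := by
    refine setIntegral_congr_fun measurableSet_Ioo fun s hs => ?_
    rw [setIntegral_circleMap_div_eq hf hz hs.1 hs.2, Complex.real_smul]
    ring
  have hmem : ∀ s ∈ Icc (0 : ℝ) 1, z * (s : ℂ) ^ 2 ∈ disk := fun s hs => by
    rw [mem_ball_zero_iff, norm_mul, norm_pow, Complex.norm_real, Real.norm_of_nonneg hs.1]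
    have : s ^ 2 ≤ 1 := by nlinarith [hs.1, hs.2]
    nlinarith [norm_nonneg z]
  have hP : DifferentiableOn ℂ (fun u => u * f u) disk := differentiableOn_id.mul hf
  -- The integrand is the s-derivative of s² f(zs²). As |z| < 1, the point zs² stays in the disk up
  -- to s = 1, so no limit is needed.
  have hFTC : ∫ s in (0 : ℝ)..1, 2 * (s : ℂ) * deriv (fun u => u * f u) (z * (s : ℂ) ^ 2) =
      ((1 : ℝ) : ℂ) ^ 2 * f (z * ((1 : ℝ) : ℂ) ^ 2) -
        ((0 : ℝ) : ℂ) ^ 2 * f (z * ((0 : ℝ) : ℂ) ^ 2) := by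
    refine intervalIntegral.integral_eq_sub_of_hasDerivAt
      (f := fun s : ℝ => (s : ℂ) ^ 2 * f (z * (s : ℂ) ^ 2)) (fun s hs => ?_) ?_
    · rw [uIcc_of_le zero_le_one] at hs
      have hfd : HasDerivAt f (deriv f (z * (s : ℂ) ^ 2)) (z * (s : ℂ) ^ 2) :=
        (hf.differentiableAt (isOpen_ball.mem_nhds (hmem s hs))).hasDerivAt
      have hsq : HasDerivAt (fun t : ℂ => t ^ 2) (2 * (s : ℂ)) (s : ℂ) := by
        simpa using hasDerivAt_pow 2 (s : ℂ)
      have hcomp : HasDerivAt (fun t : ℂ => f (z * t ^ 2))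
          (deriv f (z * (s : ℂ) ^ 2) * (z * (2 * (s : ℂ)))) (s : ℂ) :=
        HasDerivAt.comp (s : ℂ) hfd (hsq.const_mul z)
      have hPd : deriv (fun u => u * f u) (z * (s : ℂ) ^ 2) =
          f (z * (s : ℂ) ^ 2) + z * (s : ℂ) ^ 2 * deriv f (z * (s : ℂ) ^ 2) := by
        have := ((hasDerivAt_id (z * (s : ℂ) ^ 2)).mul hfd).deriv
        rw [one_mul] at this
        exact this
      refine (hsq.mul hcomp).comp_ofReal.congr_deriv ?_
      rw [hPd]
      ring
    · refine ContinuousOn.intervalIntegrable ?_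
      rw [uIcc_of_le zero_le_one]
      have hcd : ContinuousOn (deriv fun u => u * f u) disk :=
        (hP.deriv isOpen_ball).continuousOn
      exact ContinuousOn.mul (by fun_prop) (hcd.comp (by fun_prop) hmem)
  rw [h1, integral_const_mul, ← integral_Ioc_eq_integral_Ioo,
    ← intervalIntegral.integral_of_le zero_le_one, hFTC, Complex.real_smul]
  have hpi : (Real.pi : ℂ) ≠ 0 := by simp [Real.pi_ne_zero]
  push_cast
  field_simp
  simp

/-! ### Elements of the Bergman space and the composition operator -/

theorem eLpNorm_two_sq (g : ℂ → ℂ) : eLpNorm g 2 diskArea ^ 2 = ∫⁻ z, ‖g z‖ₑ ^ 2 ∂diskArea := by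
  have h := eLpNorm_nnreal_pow_eq_lintegral (μ := diskArea) (f := g) (p := 2) two_ne_zero
  simpa using h

theorem memLp_two_of_lintegral_ne_top {g : ℂ → ℂ} (hg : AnalyticOnNhd ℂ g disk)
    (h : ∫⁻ z, ‖g z‖ₑ ^ 2 ∂diskArea ≠ ⊤) : MemLp g 2 diskArea := by
  refine ⟨(hg.continuousOn.aestronglyMeasurable measurableSet_ball).smul_measure _, ?_⟩
  rw [← eLpNorm_two_sq] at h
  exact lt_of_le_of_ne le_top fun h' => h (by rw [h']; simp)

/-- The element of the Bergman space given by a square integrable analytic function. -/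
noncomputable def ofAnalytic (g : ℂ → ℂ) (hg : AnalyticOnNhd ℂ g disk)
    (h : ∫⁻ z, ‖g z‖ₑ ^ 2 ∂diskArea ≠ ⊤) : bergmanSpace :=
  ⟨(memLp_two_of_lintegral_ne_top hg h).toLp g, g, hg, MemLp.coeFn_toLp _⟩

theorem toFun_ofAnalytic {g : ℂ → ℂ} (hg : AnalyticOnNhd ℂ g disk)
    (h : ∫⁻ z, ‖g z‖ₑ ^ 2 ∂diskArea ≠ ⊤) : EqOn (toFun (ofAnalytic g hg h)) g disk :=
  toFun_eq_of_ae hg (MemLp.coeFn_toLp (memLp_two_of_lintegral_ne_top hg h))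

theorem enorm_sq_eq_lintegral (f : bergmanSpace) :
    ENNReal.ofReal (‖f‖ ^ 2) = ∫⁻ z, ‖toFun f z‖ₑ ^ 2 ∂diskArea := by
  rw [ENNReal.ofReal_pow (norm_nonneg _), ofReal_norm, ← eLpNorm_two_sq,
    ← eLpNorm_congr_ae (coe_ae_eq_toFun f), ← Lp.enorm_def]
  rfl

theorem lintegral_toFun_ne_top (f : bergmanSpace) :
    ∫⁻ z, ‖toFun f z‖ₑ ^ 2 ∂diskArea ≠ ⊤ := by
  rw [← enorm_sq_eq_lintegral]
  exact ENNReal.ofReal_ne_top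

theorem toFun_add (f g : bergmanSpace) : EqOn (toFun (f + g)) (toFun f + toFun g) disk :=
  toFun_eq_of_ae ((toFun_analytic f).add (toFun_analytic g)) <|
    (Lp.coeFn_add _ _).trans ((coe_ae_eq_toFun f).add (coe_ae_eq_toFun g))

theorem toFun_smul (c : ℂ) (f : bergmanSpace) : EqOn (toFun (c • f)) (c • toFun f) disk :=
  toFun_eq_of_ae (fun z hz => analyticAt_const.smul (toFun_analytic f z hz)) <|
    (Lp.coeFn_smul _ _).trans ((coe_ae_eq_toFun f).const_smul c)

theorem toFun_zero : EqOn (toFun 0) 0 disk :=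
  toFun_eq_of_ae (fun _ _ => analyticAt_const) (Lp.coeFn_zero _ _ _)

/-- Every analytic self-map of the disk induces a bounded composition operator. -/
theorem exists_isCompositionOperator {φ : ℂ → ℂ} (hφ : AnalyticOnNhd ℂ φ disk)
    (hm : MapsTo φ disk disk) (hφm : Measurable φ) :
    ∃ C : bergmanSpace →L[ℂ] bergmanSpace, IsCompositionOperator φ C := by
  obtain ⟨B, hB, h⟩ := exists_lintegral_comp_le hφ.differentiableOn hm hφm
  have hcomp : ∀ f : bergmanSpace, AnalyticOnNhd ℂ (toFun f ∘ φ) disk := fun f =>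
    (toFun_analytic f).comp hφ hm
  have hfin : ∀ f : bergmanSpace, ∫⁻ z, ‖(toFun f ∘ φ) z‖ₑ ^ 2 ∂diskArea ≠ ⊤ := fun f =>
    ne_top_of_le_ne_top (ENNReal.mul_ne_top ENNReal.ofReal_ne_top (lintegral_toFun_ne_top f))
      (h _ (toFun_analytic f).differentiableOn)
  have hto : ∀ f : bergmanSpace, ∀ z ∈ disk,
      toFun (ofAnalytic _ (hcomp f) (hfin f)) z = toFun f (φ z) := fun f z hz =>
    toFun_ofAnalytic (hcomp f) (hfin f) hz
  let L : bergmanSpace →ₗ[ℂ] bergmanSpace :=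
    { toFun := fun f => ofAnalytic _ (hcomp f) (hfin f)
      map_add' := fun f g => ext_of_eqOn fun z hz => by
        rw [hto _ z hz, toFun_add _ _ (hm hz), toFun_add _ _ hz, Pi.add_apply, Pi.add_apply,
          hto _ z hz, hto _ z hz]
      map_smul' := fun c f => ext_of_eqOn fun z hz => by
        rw [hto _ z hz, toFun_smul _ _ (hm hz), RingHom.id_apply, toFun_smul _ _ hz,
          Pi.smul_apply, Pi.smul_apply, hto _ z hz] }
  refine ⟨L.mkContinuous (√B) fun f => ?_, fun f z hz => hto f z hz⟩
  refine abs_le_of_sq_le_sq' ?_ (by positivity) |>.2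
  have h1 : ENNReal.ofReal (‖L f‖ ^ 2) ≤ ENNReal.ofReal (B * ‖f‖ ^ 2) := by
    rw [ENNReal.ofReal_mul hB.le, enorm_sq_eq_lintegral, enorm_sq_eq_lintegral]
    refine le_trans (le_of_eq ?_) (h _ (toFun_analytic f).differentiableOn)
    refine lintegral_congr_ae (ae_mem_disk.mono fun z hz => ?_)
    beta_reduce
    rw [← hto f z hz]
    rfl
  rw [mul_pow, Real.sq_sqrt hB.le]
  exact (ENNReal.ofReal_le_ofReal_iff (by positivity)).1 h1

theorem IsCompositionOperator.enorm_sq_eq {φ : ℂ → ℂ} {C : bergmanSpace →L[ℂ] bergmanSpace}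
    (hC : IsCompositionOperator φ C) (f : bergmanSpace) :
    ENNReal.ofReal (‖C f‖ ^ 2) = ∫⁻ z, ‖toFun f (φ z)‖ₑ ^ 2 ∂diskArea := by
  rw [enorm_sq_eq_lintegral]
  exact lintegral_congr_ae (ae_mem_disk.mono fun z hz => by simp only [hC f z hz])

/-- If f ∘ φ = 0, then f vanishes on the image of φ, which is open by the open mapping theorem,
hence on the disk by the identity theorem. Closed range thereby becomes a lower bound. -/
theorem IsCompositionOperator.injective {φ : ℂ → ℂ} (hφ : AnalyticOnNhd ℂ φ disk)
    (hm : MapsTo φ disk disk) (hconst : ¬ ∃ c : ℂ, ∀ z ∈ disk, φ z = c)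
    {C : bergmanSpace →L[ℂ] bergmanSpace} (hC : IsCompositionOperator φ C) :
    Function.Injective C := by
  refine (injective_iff_map_eq_zero C).2 fun f hf => ext_of_eqOn fun z hz => ?_
  rw [toFun_zero hz]
  have h0 : ∀ x ∈ disk, toFun f (φ x) = 0 := fun x hx => by
    rw [← hC f x hx, hf, toFun_zero hx]; rfl
  have hpre : IsPreconnected disk := (convex_ball (0 : ℂ) 1).isPreconnected
  rcases hφ.is_constant_or_isOpen hpre with h | h
  · exact absurd h hconst
  · have himg := h disk subset_rfl isOpen_ball
    have hmem : φ 0 ∈ φ '' disk := mem_image_of_mem _ (mem_ball_self one_pos)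
    have hev : toFun f =ᶠ[𝓝 (φ 0)] 0 := by
      filter_upwards [himg.mem_nhds hmem]
      rintro _ ⟨x, hx, rfl⟩
      exact h0 x hx
    exact (toFun_analytic f).eqOn_zero_of_preconnected_of_eventuallyEq_zero hpre
      (hm (mem_ball_self one_pos)) hev hz

/-! ### Kernels as elements of the space, and the Toeplitz operator -/

theorem kernel_analyticOnNhd {z : ℂ} (hz : z ∈ disk) : AnalyticOnNhd ℂ (kernel z) disk := by
  have hz1 : ‖z‖ < 1 := by simpa using hz
  refine DifferentiableOn.analyticOnNhd ?_ isOpen_ball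
  refine DifferentiableOn.div (by fun_prop) (by fun_prop) fun w hw => pow_ne_zero 2 ?_
  have hw1 : ‖w‖ < 1 := by simpa using hw
  exact one_sub_conj_mul_ne_zero hz1 hw1.le

theorem enorm_kernel_sq (w z : ℂ) :
    ‖kernel w z‖ₑ ^ 2 = ENNReal.ofReal (1 / ‖1 - starRingEnd ℂ w * z‖ ^ 4) := by
  rw [← ofReal_norm, ← ENNReal.ofReal_pow (norm_nonneg _), kernel, norm_div, norm_one, norm_pow,
    div_pow, one_pow, ← pow_mul]

theorem norm_kernel_le {w z : ℂ} (hw : w ∈ disk) (hz : z ∈ disk) :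
    ‖kernel w z‖ ≤ 1 / (1 - ‖w‖) ^ 2 := by
  have hw1 : ‖w‖ < 1 := by simpa using hw
  have hz1 : ‖z‖ < 1 := by simpa using hz
  have hD : 0 < 1 - ‖w‖ := by linarith
  rw [kernel, norm_div, norm_one, norm_pow]
  gcongr
  exact one_sub_norm_le_norm_one_sub hz1.le

theorem lintegral_kernel_comp_ne_top {φ : ℂ → ℂ} (hm : MapsTo φ disk disk) {w : ℂ} (hw : w ∈ disk) :
    ∫⁻ z, ‖kernel w (φ z)‖ₑ ^ 2 ∂diskArea ≠ ⊤ := by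
  have h : ∫⁻ z, ‖kernel w (φ z)‖ₑ ^ 2 ∂diskArea ≤
      ∫⁻ _, ENNReal.ofReal (1 / (1 - ‖w‖) ^ 2) ^ 2 ∂diskArea := by
    refine lintegral_mono_ae (ae_mem_disk.mono fun z hz => ?_)
    rw [← ofReal_norm]
    gcongr
    exact norm_kernel_le hw (hm hz)
  refine ne_top_of_le_ne_top ?_ h
  rw [lintegral_const, measure_univ, mul_one]
  exact ENNReal.pow_ne_top ENNReal.ofReal_ne_top

/-- The reproducing kernel as an element of the Bergman space. -/
noncomputable def kernelElement (z : ℂ) (hz : z ∈ disk) : bergmanSpace :=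
  ofAnalytic (kernel z) (kernel_analyticOnNhd hz)
    (lintegral_kernel_comp_ne_top (φ := fun x => x) (mapsTo_id _) hz)

theorem toFun_kernelElement {z : ℂ} (hz : z ∈ disk) :
    EqOn (toFun (kernelElement z hz)) (kernel z) disk :=
  toFun_ofAnalytic _ _

theorem inner_eq_integral (f g : bergmanSpace) :
    inner ℂ f g = ∫ z, toFun g z * starRingEnd ℂ (toFun f z) ∂diskArea := by
  rw [Submodule.coe_inner, L2.inner_def]
  refine integral_congr_ae ?_
  filter_upwards [coe_ae_eq_toFun f, coe_ae_eq_toFun g] with z h1 h2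
  rw [h1, h2, RCLike.inner_apply]

theorem integrable_toFun_mul_conj (f g : bergmanSpace) :
    Integrable (fun z => toFun g z * starRingEnd ℂ (toFun f z)) diskArea := by
  refine (L2.integrable_inner (𝕜 := ℂ) (f : Lp ℂ 2 diskArea) (g : Lp ℂ 2 diskArea)).congr ?_
  filter_upwards [coe_ae_eq_toFun f, coe_ae_eq_toFun g] with z h1 h2
  rw [h1, h2, RCLike.inner_apply]

theorem mul_conj_kernel (a z w : ℂ) :
    a * starRingEnd ℂ (kernel z w) = a / (1 - z * starRingEnd ℂ w) ^ 2 := by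
  simp [kernel, div_eq_mul_inv]

/-- The reproducing property of the kernel. -/
theorem inner_kernelElement {z : ℂ} (hz : z ∈ disk) (g : bergmanSpace) :
    inner ℂ (kernelElement z hz) g = toFun g z := by
  have hae : (fun w => toFun g w * starRingEnd ℂ (toFun (kernelElement z hz) w)) =ᵐ[diskArea]
      fun w => toFun g w / (1 - z * starRingEnd ℂ w) ^ 2 :=
    ae_mem_disk.mono fun w hw => by
      simp only [toFun_kernelElement hz hw, mul_conj_kernel]
  rw [inner_eq_integral, integral_congr_ae hae]
  exact integral_div_eq (toFun_analytic g).differentiableOn hz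
    ((integrable_toFun_mul_conj _ _).congr hae)

theorem map_restrict_disk {φ : ℂ → ℂ} (hm : MapsTo φ disk disk) (hφm : Measurable φ) :
    (pullbackArea φ).restrict disk = pullbackArea φ := by
  refine Measure.restrict_eq_self_of_ae_mem ?_
  rw [pullbackArea, ae_map_iff (p := (· ∈ disk)) hφm.aemeasurable measurableSet_ball]
  exact ae_mem_disk.mono fun z hz => hm hz

/-- The Toeplitz operator of the pull-back measure is `C* C`. -/
theorem IsCompositionOperator.isToeplitzOperator {φ : ℂ → ℂ} (hm : MapsTo φ disk disk)
    (hφm : Measurable φ) {C : bergmanSpace →L[ℂ] bergmanSpace} (hC : IsCompositionOperator φ C) :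
    IsToeplitzOperator (pullbackArea φ) (ContinuousLinearMap.adjoint C ∘L C) := by
  intro f z hz
  have hz1 : ‖z‖ < 1 := by simpa using hz
  -- The value of C*C f at z is ⟨K_z, C*C f⟩ = ⟨C K_z, C f⟩, whose integrand is the Toeplitz
  -- integrand composed with φ.
  have hae : (fun x => toFun (C f) x * starRingEnd ℂ (toFun (C (kernelElement z hz)) x))
      =ᵐ[diskArea] (fun w => toFun f w / (1 - z * starRingEnd ℂ w) ^ 2) ∘ φ :=
    ae_mem_disk.mono fun x hx => by
      simp only [hC _ x hx, toFun_kernelElement hz (hm hx), mul_conj_kernel, Function.comp_apply]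
  have hcont : ContinuousOn (fun w => toFun f w / (1 - z * starRingEnd ℂ w) ^ 2) disk := by
    refine (toFun_analytic f).continuousOn.div (by fun_prop) fun w hw => pow_ne_zero 2 ?_
    have hw1 : ‖w‖ < 1 := by simpa using hw
    rw [mul_comm]
    exact one_sub_conj_mul_ne_zero hw1 hz1.le
  have hms : AEStronglyMeasurable (fun w => toFun f w / (1 - z * starRingEnd ℂ w) ^ 2)
      (Measure.map φ diskArea) := by
    rw [← pullbackArea, ← map_restrict_disk hm hφm]
    exact hcont.aestronglyMeasurable measurableSet_ball
  have hint := (integrable_toFun_mul_conj (C (kernelElement z hz)) (C f)).congr hae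
  refine ⟨?_, ?_⟩
  · rw [IntegrableOn, map_restrict_disk hm hφm, pullbackArea,
      integrable_map_measure hms hφm.aemeasurable]
    exact hint
  · rw [map_restrict_disk hm hφm, pullbackArea, integral_map hφm.aemeasurable hms,
      ← inner_kernelElement hz, ContinuousLinearMap.comp_apply,
      ContinuousLinearMap.adjoint_inner_right, inner_eq_integral]
    exact integral_congr_ae hae

/-! ### Bounded below operators on a Hilbert space -/

section Operators

variable {H : Type*} [NormedAddCommGroup H] [InnerProductSpace ℂ H] [CompleteSpace H]

/-- `C* C` is invertible if and only if `C` is bounded below. -/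
theorem isUnit_adjoint_comp_self_iff (C : H →L[ℂ] H) :
    IsUnit (ContinuousLinearMap.adjoint C ∘L C) ↔ ∃ c : ℝ, 0 < c ∧ ∀ f, c * ‖f‖ ^ 2 ≤ ‖C f‖ ^ 2 := by
  -- ‖C f‖² = ⟨C*C f, f⟩; so a lower bound for C passes to C*C.
  have hT : ∀ f, ‖C f‖ ^ 2 ≤ ‖(ContinuousLinearMap.adjoint C ∘L C) f‖ * ‖f‖ := fun f => by
    have h1 : inner ℂ ((ContinuousLinearMap.adjoint C ∘L C) f) f = inner ℂ (C f) (C f) := by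
      rw [ContinuousLinearMap.comp_apply, ContinuousLinearMap.adjoint_inner_left]
    have h2 := norm_inner_le_norm (𝕜 := ℂ) ((ContinuousLinearMap.adjoint C ∘L C) f) f
    rwa [h1, inner_self_eq_norm_sq_to_K, norm_pow, RCLike.norm_ofReal, abs_norm] at h2
  constructor
  · rintro ⟨u, hu⟩
    have hinv : ∀ f, ‖f‖ ≤ ‖(↑u⁻¹ : H →L[ℂ] H)‖ * (‖ContinuousLinearMap.adjoint C‖ * ‖C f‖) := by
      intro f
      have h1 : (↑u⁻¹ : H →L[ℂ] H) ((ContinuousLinearMap.adjoint C ∘L C) f) = f := by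
        rw [← hu, ← mul_apply_eq_comp, Units.inv_mul, one_apply_eq_self]
      calc ‖f‖ = ‖(↑u⁻¹ : H →L[ℂ] H) ((ContinuousLinearMap.adjoint C ∘L C) f)‖ := by rw [h1]
        _ ≤ ‖(↑u⁻¹ : H →L[ℂ] H)‖ * ‖(ContinuousLinearMap.adjoint C ∘L C) f‖ :=
          ContinuousLinearMap.le_opNorm _ _
        _ ≤ _ := by
          gcongr
          exact ContinuousLinearMap.le_opNorm (ContinuousLinearMap.adjoint C) (C f)
    set B := ‖(↑u⁻¹ : H →L[ℂ] H)‖ * ‖ContinuousLinearMap.adjoint C‖ with hB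
    refine ⟨1 / (B + 1) ^ 2, by positivity, fun f => ?_⟩
    have h1 : ‖f‖ ≤ (B + 1) * ‖C f‖ := by
      have := hinv f
      rw [← mul_assoc, ← hB] at this
      linarith [norm_nonneg (C f)]
    rw [one_div_mul_eq_div, div_le_iff₀ (by positivity), mul_comm, ← mul_pow]
    gcongr
  · rintro ⟨c, hc, h⟩
    set T := ContinuousLinearMap.adjoint C ∘L C with hTdef
    have hlow : ∀ f, c * ‖f‖ ≤ ‖T f‖ := by
      intro f
      rcases eq_or_ne f 0 with rfl | hf
      · simp
      · refine le_of_mul_le_mul_right ?_ (norm_pos_iff.2 hf)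
        have := (h f).trans (hT f)
        rwa [sq, ← mul_assoc] at this
    have hanti : AntilipschitzWith (Real.toNNReal c)⁻¹ T := by
      refine ContinuousLinearMap.antilipschitz_of_bound T fun f => ?_
      rw [NNReal.coe_inv, Real.coe_toNNReal c hc.le, ← div_eq_inv_mul, le_div_iff₀ hc]
      linarith [hlow f]
    have hsa : ContinuousLinearMap.adjoint T = T := by
      rw [hTdef, ContinuousLinearMap.adjoint_comp, ContinuousLinearMap.adjoint_adjoint]
    have hclosed : IsClosed (T.range : Set H) := by
      rw [LinearMap.coe_range]
      exact hanti.isClosed_range T.uniformContinuous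
    have hker : T.ker = ⊥ := LinearMap.ker_eq_bot.2 hanti.injective
    -- The range is closed, and its orthogonal complement is the kernel of T* = T, which is trivial.
    have hrange : T.range = ⊤ := by
      have := hclosed.completeSpace_coe
      rw [← Submodule.orthogonal_eq_bot_iff, ContinuousLinearMap.orthogonal_range, hsa, hker]
    rw [ContinuousLinearMap.isUnit_iff_bijective]
    exact ⟨hanti.injective, LinearMap.range_eq_top.1 hrange⟩

/-- An injective operator has closed range if and only if it is bounded below. -/
theorem isClosed_range_iff_of_injective (C : H →L[ℂ] H) (hinj : Function.Injective C) :
    IsClosed (Set.range C) ↔ ∃ c : ℝ, 0 < c ∧ ∀ f, c * ‖f‖ ^ 2 ≤ ‖C f‖ ^ 2 := by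
  rw [ContinuousLinearMap.isClosed_range_iff_antilipschitz_of_injective C hinj]
  constructor
  · rintro ⟨K, hK⟩
    refine ⟨1 / (K + 1) ^ 2, by positivity, fun f => ?_⟩
    have h1 : ‖f‖ ≤ K * ‖C f‖ := by
      simpa using hK.le_mul_dist f 0
    rw [one_div_mul_eq_div, div_le_iff₀ (by positivity), mul_comm, ← mul_pow]
    gcongr
    linarith [norm_nonneg (C f)]
  · rintro ⟨c, hc, h⟩
    refine ⟨(Real.toNNReal (√c))⁻¹, ContinuousLinearMap.antilipschitz_of_bound C fun f => ?_⟩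
    rw [NNReal.coe_inv, Real.coe_toNNReal _ (Real.sqrt_nonneg c), ← div_eq_inv_mul,
      le_div_iff₀ (by positivity)]
    refine abs_le_of_sq_le_sq' ?_ (norm_nonneg _) |>.2
    rw [mul_pow, Real.sq_sqrt hc.le]
    linarith [h f]

end Operators

/-! ### Reverse Carleson measures and the Berezin transform -/

theorem setLIntegral_pullbackArea {φ : ℂ → ℂ} (hm : MapsTo φ disk disk) (hφm : Measurable φ)
    {f : ℂ → ℂ} (hf : DifferentiableOn ℂ f disk) :
    ∫⁻ z in disk, ‖f z‖ₑ ^ 2 ∂(pullbackArea φ) = ∫⁻ z, ‖f (φ z)‖ₑ ^ 2 ∂diskArea := by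
  rw [← lintegral_indicator measurableSet_ball, pullbackArea,
    lintegral_map (measurable_indicator_enorm_sq hf) hφm]
  refine lintegral_congr_ae (ae_mem_disk.mono fun z hz => ?_)
  simp only [indicator_of_mem (hm hz)]

/-- `μ_φ` is a reverse Carleson measure if and only if `C_φ` is bounded below. -/
theorem IsCompositionOperator.isReverseCarleson_iff {φ : ℂ → ℂ} (hm : MapsTo φ disk disk)
    (hφm : Measurable φ) {C : bergmanSpace →L[ℂ] bergmanSpace} (hC : IsCompositionOperator φ C) :
    IsReverseCarleson (pullbackArea φ) ↔ ∃ c : ℝ, 0 < c ∧ ∀ f, c * ‖f‖ ^ 2 ≤ ‖C f‖ ^ 2 := by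
  refine exists_congr fun c => and_congr_right fun hc => forall_congr' fun f => ?_
  rw [setLIntegral_pullbackArea hm hφm (toFun_analytic f).differentiableOn, setLIntegral_disk,
    ← enorm_sq_eq_lintegral, ← hC.enorm_sq_eq, ← ENNReal.ofReal_mul hc.le,
    ENNReal.ofReal_le_ofReal_iff (by positivity)]

theorem lintegral_kernel_comp_eq {φ : ℂ → ℂ} {w : ℂ} :
    ∫⁻ z, ENNReal.ofReal ((1 - ‖w‖) ^ 2 / ‖1 - starRingEnd ℂ w * φ z‖ ^ 4) ∂diskArea =
      ENNReal.ofReal ((1 - ‖w‖) ^ 2) * ∫⁻ z, ‖kernel w (φ z)‖ₑ ^ 2 ∂diskArea := by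
  rw [← lintegral_const_mul' _ _ ENNReal.ofReal_ne_top]
  refine lintegral_congr fun z => ?_
  rw [enorm_kernel_sq, ← ENNReal.ofReal_mul (sq_nonneg _), mul_one_div]

theorem kernelNorm_sq (w : ℂ) :
    kernelNorm w ^ 2 = (∫⁻ z, ‖kernel w z‖ₑ ^ 2 ∂diskArea).toReal := by
  rw [kernelNorm, Real.sq_sqrt (integral_nonneg fun _ => sq_nonneg _),
    integral_eq_lintegral_of_nonneg_ae (Eventually.of_forall fun _ => sq_nonneg _), setLIntegral_disk]
  · congr 1
    refine lintegral_congr fun z => ?_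
    rw [ENNReal.ofReal_pow (norm_nonneg _), ofReal_norm]
  · unfold kernel
    exact Measurable.aestronglyMeasurable (by fun_prop)

/-- The sub-mean value property of K_w on the disc of radius 1 - |w| about w, with |K_w(w)| ≥ (2(1 -
|w|))⁻². It stands in for the exact value of ‖K_w‖. -/
theorem le_lintegral_kernel {w : ℂ} (hw : w ∈ disk) :
    1 / 16 ≤ (1 - ‖w‖) ^ 2 * (∫⁻ z, ‖kernel w z‖ₑ ^ 2 ∂diskArea).toReal := by
  have hw1 : ‖w‖ < 1 := by simpa using hw
  have hD : 0 < 1 - ‖w‖ := by linarith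
  have hsub : ball w (1 - ‖w‖) ⊆ disk := ball_subset_ball' (by rw [dist_zero_right]; linarith)
  have hfin := lintegral_kernel_comp_ne_top (φ := fun x => x) (mapsTo_id _) hw
  have h1 := norm_le_sqrt_div_of_ball_subset hD
    ((kernel_analyticOnNhd hw).differentiableOn.mono hsub) hsub (subset_univ _)
    (by rwa [setLIntegral_univ])
  rw [setLIntegral_univ, le_div_iff₀ hD] at h1
  have h2 : 1 / (2 * (1 - ‖w‖)) ^ 2 ≤ ‖kernel w w‖ := by
    rw [kernel, norm_div, norm_one, norm_pow]
    have h3 := norm_pos_iff.2 (one_sub_conj_mul_ne_zero hw1 hw1.le)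
    have h4 : ‖1 - starRingEnd ℂ w * w‖ ≤ 2 * (1 - ‖w‖) := by
      simpa using norm_one_sub_conj_mul_le (z := w) hw1.le
    gcongr
  have h5 : 1 / (4 * (1 - ‖w‖)) ≤ √(∫⁻ z, ‖kernel w z‖ₑ ^ 2 ∂diskArea).toReal := by
    refine le_trans (le_of_eq ?_) ((mul_le_mul_of_nonneg_right h2 hD.le).trans h1)
    field_simp
    norm_num
  calc (1 / 16 : ℝ) = (1 - ‖w‖) ^ 2 * (1 / (4 * (1 - ‖w‖))) ^ 2 := by field_simp; norm_num
    _ ≤ (1 - ‖w‖) ^ 2 * (√(∫⁻ z, ‖kernel w z‖ₑ ^ 2 ∂diskArea).toReal) ^ 2 := by gcongr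
    _ = _ := by rw [Real.sq_sqrt ENNReal.toReal_nonneg]

theorem berezin_pullbackArea {φ : ℂ → ℂ} (hm : MapsTo φ disk disk) (hφm : Measurable φ) {w : ℂ}
    (hw : w ∈ disk) :
    berezin (pullbackArea φ) w = (∫⁻ z, ‖kernel w (φ z)‖ₑ ^ 2 ∂diskArea).toReal /
      (∫⁻ z, ‖kernel w z‖ₑ ^ 2 ∂diskArea).toReal := by
  have hk : ∀ z, ‖normalizedKernel w z‖ ^ 2 = ‖kernel w z‖ ^ 2 / kernelNorm w ^ 2 := fun z => by
    rw [normalizedKernel, norm_div, div_pow, Complex.norm_real, Real.norm_eq_abs, sq_abs]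
  simp only [berezin, hk]
  rw [integral_div, kernelNorm_sq,
    integral_eq_lintegral_of_nonneg_ae (Eventually.of_forall fun _ => sq_nonneg _)]
  · congr 2
    rw [← setLIntegral_pullbackArea hm hφm (kernel_analyticOnNhd hw).differentiableOn]
    refine lintegral_congr fun z => ?_
    rw [ENNReal.ofReal_pow (norm_nonneg _), ofReal_norm]
  · unfold kernel
    exact Measurable.aestronglyMeasurable (by fun_prop)

/-- The Berezin transform is bounded below if and only if the masses of the kernels composed with
`φ` are. -/
theorem berezinBoundedBelow_iff {φ : ℂ → ℂ} (hm : MapsTo φ disk disk) (hφm : Measurable φ) :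
    BerezinBoundedBelow (pullbackArea φ) ↔ ∃ δ : ℝ, 0 < δ ∧ ∀ w ∈ disk, ENNReal.ofReal δ ≤
      ∫⁻ z, ENNReal.ofReal ((1 - ‖w‖) ^ 2 / ‖1 - starRingEnd ℂ w * φ z‖ ^ 4) ∂diskArea := by
  have hconv : ∀ w ∈ disk, ∀ δ : ℝ, (ENNReal.ofReal δ ≤
      ∫⁻ z, ENNReal.ofReal ((1 - ‖w‖) ^ 2 / ‖1 - starRingEnd ℂ w * φ z‖ ^ 4) ∂diskArea) ↔
      δ ≤ (1 - ‖w‖) ^ 2 * (∫⁻ z, ‖kernel w (φ z)‖ₑ ^ 2 ∂diskArea).toReal := by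
    intro w hw δ
    rw [lintegral_kernel_comp_eq, ENNReal.ofReal_le_iff_le_toReal
      (ENNReal.mul_ne_top ENNReal.ofReal_ne_top (lintegral_kernel_comp_ne_top hm hw)),
      ENNReal.toReal_mul, ENNReal.toReal_ofReal (sq_nonneg _)]
  -- The identity map gives ‖K_w‖² ≤ B(1 - |w|)⁻², the counterpart of `le_lintegral_kernel`.
  obtain ⟨B, hB, hid⟩ := exists_lintegral_kernel_comp_le (φ := fun z => z) differentiableOn_id
    (mapsTo_id _) measurable_id
  have hpos : ∀ w ∈ disk, 0 < (1 - ‖w‖) ^ 2 ∧ 0 < (∫⁻ z, ‖kernel w z‖ₑ ^ 2 ∂diskArea).toReal ∧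
      (1 - ‖w‖) ^ 2 * (∫⁻ z, ‖kernel w z‖ₑ ^ 2 ∂diskArea).toReal ≤ B := by
    intro w hw
    have hw1 : ‖w‖ < 1 := by simpa using hw
    have hD : 0 < 1 - ‖w‖ := by linarith
    have hD2 : 0 < (1 - ‖w‖) ^ 2 := by positivity
    refine ⟨hD2, pos_of_mul_pos_right (lt_of_lt_of_le (by norm_num) (le_lintegral_kernel hw))
      hD2.le, ?_⟩
    have h1 := hid w hw
    rw [lintegral_kernel_comp_eq] at h1
    have h2 := ENNReal.toReal_mono ENNReal.ofReal_ne_top h1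
    rwa [ENNReal.toReal_mul, ENNReal.toReal_ofReal (sq_nonneg _), ENNReal.toReal_ofReal hB.le] at h2
  constructor
  · rintro ⟨δ, hδ, h⟩
    refine ⟨δ / 16, by positivity, fun w hw => (hconv w hw _).2 ?_⟩
    obtain ⟨h1, h2, -⟩ := hpos w hw
    have h3 := h w hw
    rw [berezin_pullbackArea hm hφm hw, le_div_iff₀ h2] at h3
    have h4 := le_lintegral_kernel hw
    nlinarith [mul_le_mul_of_nonneg_left h3 h1.le]
  · rintro ⟨δ, hδ, h⟩
    refine ⟨δ / B, by positivity, fun w hw => ?_⟩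
    obtain ⟨h1, h2, h3⟩ := hpos w hw
    have h4 := (hconv w hw _).1 (h w hw)
    rw [berezin_pullbackArea hm hφm hw, div_le_div_iff₀ hB h2]
    refine le_of_mul_le_mul_left ?_ h1
    nlinarith

/-! ### Pseudo-hyperbolic disks -/

theorem norm_one_sub_conj_mul_comm (z w : ℂ) :
    ‖1 - starRingEnd ℂ z * w‖ = ‖1 - starRingEnd ℂ w * z‖ := by
  rw [← RCLike.norm_conj (1 - starRingEnd ℂ z * w)]
  simp [mul_comm]

theorem mem_pseudoDisk_iff {w z : ℂ} (hw : w ∈ disk) {r : ℝ} :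
    z ∈ pseudoDisk w r ↔ z ∈ disk ∧ ‖w - z‖ < r * ‖1 - starRingEnd ℂ w * z‖ := by
  refine and_congr_right fun hz => ?_
  have hw1 : ‖w‖ < 1 := by simpa using hw
  have hz1 : ‖z‖ < 1 := by simpa using hz
  rw [pseudoDist, moebius, norm_div, norm_one_sub_conj_mul_comm, norm_sub_rev z w,
    div_lt_iff₀ (norm_pos_iff.2 (one_sub_conj_mul_ne_zero hw1 hz1.le))]

theorem measurableSet_pseudoDisk {w : ℂ} (hw : w ∈ disk) (r : ℝ) :
    MeasurableSet (pseudoDisk w r) := by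
  have : pseudoDisk w r = disk ∩ {z | ‖w - z‖ < r * ‖1 - starRingEnd ℂ w * z‖} := by
    ext z
    exact mem_pseudoDisk_iff hw
  rw [this]
  exact measurableSet_ball.inter (measurableSet_lt (by fun_prop) (by fun_prop))

/-- With X = |1 - w̄ z|, one has X ≤ 2(1 - |w|) + |w - z| and |w - z| < rX; the last term is
absorbed. -/
theorem norm_one_sub_le_of_mem_pseudoDisk {w z : ℂ} (hw : w ∈ disk) {r : ℝ} (hr1 : r < 1)
    (hz : z ∈ pseudoDisk w r) : ‖1 - starRingEnd ℂ w * z‖ ≤ 2 / (1 - r) * (1 - ‖w‖) := by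
  have hw1 : ‖w‖ < 1 := by simpa using hw
  have h1 := ((mem_pseudoDisk_iff hw).1 hz).2
  have h2 := norm_one_sub_conj_mul_le (z := z) hw1.le
  rw [div_mul_eq_mul_div, le_div_iff₀ (by linarith)]
  linarith

theorem ball_subset_pseudoDisk {w : ℂ} (hw : w ∈ disk) {r : ℝ} (hr : 0 < r) (hr1 : r < 1) :
    ball w (r * (1 - ‖w‖)) ⊆ pseudoDisk w r := by
  intro z hz
  have hw1 : ‖w‖ < 1 := by simpa using hw
  rw [mem_ball, dist_comm, dist_eq_norm] at hz
  have hz1 : ‖z‖ < 1 := by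
    have := norm_sub_norm_le z w
    rw [norm_sub_rev] at this
    nlinarith
  refine (mem_pseudoDisk_iff hw).2 ⟨by simpa using hz1, hz.trans_le ?_⟩
  gcongr
  exact one_sub_norm_le_norm_one_sub hz1.le

theorem le_diskArea_pseudoDisk {w : ℂ} (hw : w ∈ disk) {r : ℝ} (hr : 0 < r) (hr1 : r < 1) :
    ENNReal.ofReal (r ^ 2 * (1 - ‖w‖) ^ 2) ≤ diskArea (pseudoDisk w r) := by
  have hw1 : ‖w‖ < 1 := by simpa using hw
  have hsub := ball_subset_pseudoDisk hw hr hr1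
  have hD : 0 < 1 - ‖w‖ := by linarith
  rw [← mul_pow, ENNReal.ofReal_pow (by positivity),
    ← diskArea_ball (hsub.trans fun z hz => hz.1)]
  exact measure_mono hsub

theorem diskArea_pseudoDisk_le {w : ℂ} (hw : w ∈ disk) {r : ℝ} (hr : 0 < r) (hr1 : r < 1) :
    diskArea (pseudoDisk w r) ≤ ENNReal.ofReal ((2 / (1 - r)) ^ 2 * (1 - ‖w‖) ^ 2) := by
  have hw1 : ‖w‖ < 1 := by simpa using hw
  have hD : 0 < 1 - ‖w‖ := by linarith
  have h1r : 0 < 1 - r := by linarith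
  rw [← mul_pow, ENNReal.ofReal_pow (by positivity)]
  refine le_trans (measure_mono fun z hz => ?_) (diskArea_ball_le w _)
  have h1 := ((mem_pseudoDisk_iff hw).1 hz).2
  have h2 := norm_one_sub_le_of_mem_pseudoDisk hw hr1 hz
  have h3 : 0 < 2 / (1 - r) * (1 - ‖w‖) := by positivity
  rw [mem_ball, dist_comm, dist_eq_norm]
  nlinarith [norm_nonneg (1 - starRingEnd ℂ w * z)]

/-- On a pseudo-hyperbolic disk the mass of the kernel controls the measure of the disk. -/
theorem pullbackArea_pseudoDisk_mul_le {φ : ℂ → ℂ} (hφm : Measurable φ) {w : ℂ}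
    (hw : w ∈ disk) {r : ℝ} (hr1 : r < 1) :
    pullbackArea φ (pseudoDisk w r) *
      ENNReal.ofReal ((1 - r) ^ 4 / 16 * ((1 - ‖w‖) ^ 2)⁻¹) ≤
    ∫⁻ z, ENNReal.ofReal ((1 - ‖w‖) ^ 2 / ‖1 - starRingEnd ℂ w * φ z‖ ^ 4) ∂diskArea := by
  have hw1 : ‖w‖ < 1 := by simpa using hw
  have hD : 0 < 1 - ‖w‖ := by linarith
  have h1r : 0 < 1 - r := by linarith
  have hE := measurableSet_pseudoDisk hw r
  rw [pullbackArea, Measure.map_apply hφm hE, mul_comm, ← setLIntegral_const]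
  refine le_trans (setLIntegral_mono' (hφm hE) fun z hz => ?_) (setLIntegral_le_lintegral _ _)
  refine ENNReal.ofReal_le_ofReal ?_
  have hφz : φ z ∈ pseudoDisk w r := hz
  have h1 := norm_one_sub_le_of_mem_pseudoDisk hw hr1 hφz
  have hz1 : ‖φ z‖ < 1 := by simpa using hφz.1
  have h2 := norm_pos_iff.2 (one_sub_conj_mul_ne_zero hw1 hz1.le)
  rw [le_div_iff₀ (by positivity)]
  calc (1 - r) ^ 4 / 16 * ((1 - ‖w‖) ^ 2)⁻¹ * ‖1 - starRingEnd ℂ w * φ z‖ ^ 4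
      ≤ (1 - r) ^ 4 / 16 * ((1 - ‖w‖) ^ 2)⁻¹ * (2 / (1 - r) * (1 - ‖w‖)) ^ 4 := by gcongr
    _ = _ := by field_simp; norm_num

/-- The reverse Carleson condition holds if and only if the masses of the kernels composed with
`φ` are bounded below. -/
theorem reverseCarlesonCondition_iff {φ : ℂ → ℂ} (hφ : DifferentiableOn ℂ φ disk)
    (hm : MapsTo φ disk disk) (hφm : Measurable φ) :
    ReverseCarlesonCondition (pullbackArea φ) ↔ ∃ δ : ℝ, 0 < δ ∧ ∀ w ∈ disk, ENNReal.ofReal δ ≤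
      ∫⁻ z, ENNReal.ofReal ((1 - ‖w‖) ^ 2 / ‖1 - starRingEnd ℂ w * φ z‖ ^ 4) ∂diskArea := by
  have hDpos : ∀ w ∈ disk, 0 < 1 - ‖w‖ := fun w hw => by
    have hw1 : ‖w‖ < 1 := by simpa using hw
    linarith
  have hA0 : ∀ w ∈ disk, ∀ r : ℝ, 0 < r → r < 1 → diskArea (pseudoDisk w r) ≠ 0 := by
    intro w hw r hr hr1
    have := hDpos w hw
    exact (lt_of_lt_of_le (ENNReal.ofReal_pos.2 (by positivity))
      (le_diskArea_pseudoDisk hw hr hr1)).ne'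
  constructor
  · rintro ⟨r, hr, hr1, C, hC, h⟩
    have h1r : 0 < 1 - r := by linarith
    refine ⟨C⁻¹ * r ^ 2 * ((1 - r) ^ 4 / 16), by positivity, fun w hw => ?_⟩
    have hD := hDpos w hw
    refine le_trans ?_ (pullbackArea_pseudoDisk_mul_le hφm hw hr1)
    have h1 := (h w hw).1
    rw [ENNReal.le_div_iff_mul_le (Or.inl (hA0 w hw r hr hr1)) (Or.inl (measure_ne_top _ _))] at h1
    calc ENNReal.ofReal (C⁻¹ * r ^ 2 * ((1 - r) ^ 4 / 16))
        = ENNReal.ofReal C⁻¹ * ENNReal.ofReal (r ^ 2 * (1 - ‖w‖) ^ 2) *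
          ENNReal.ofReal ((1 - r) ^ 4 / 16 * ((1 - ‖w‖) ^ 2)⁻¹) := by
          rw [← ENNReal.ofReal_mul (by positivity), ← ENNReal.ofReal_mul (by positivity)]
          congr 1
          field_simp
      _ ≤ ENNReal.ofReal C⁻¹ * diskArea (pseudoDisk w r) *
          ENNReal.ofReal ((1 - r) ^ 4 / 16 * ((1 - ‖w‖) ^ 2)⁻¹) := by
          gcongr
          exact le_diskArea_pseudoDisk hw hr hr1
      _ ≤ _ := by gcongr
  · rintro ⟨δ, hδ, hb⟩
    obtain ⟨κ, η, hκ, hη, hnear⟩ := exists_le_setLIntegral_near hφ hm hφm hδ hb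
    obtain ⟨B, hB, hup⟩ := exists_lintegral_kernel_comp_le hφ hm hφm
    -- As |w - ζ|² = |1 - w̄ ζ|² - (1 - |w|²)(1 - |ζ|²), the near set is mapped into the
    -- pseudo-hyperbolic disk of radius √(1 - η'). Cutting η at 1/2 keeps this radius positive.
    set η' := min η (1 / 2) with hη'
    have hη'0 : 0 < η' := lt_min hη (by norm_num)
    have hη'1 : η' ≤ 1 / 2 := min_le_right _ _
    set r := √(1 - η') with hr
    have hr0 : 0 < r := Real.sqrt_pos.2 (by linarith)
    have hr1 : r < 1 := by
      rw [hr, Real.sqrt_lt' one_pos]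
      linarith
    have hrsq : r ^ 2 = 1 - η' := Real.sq_sqrt (by linarith)
    have h1r : 0 < 1 - r := by linarith
    set C₁ := (2 / (1 - r)) ^ 2 * (2 / δ) with hC₁
    set C₂ := 16 * B / (1 - r) ^ 4 / r ^ 2 with hC₂
    have hC₁0 : 0 < C₁ := by positivity
    refine ⟨r, hr0, hr1, max C₁ C₂, lt_max_of_lt_left hC₁0, fun w hw => ?_⟩
    have hD := hDpos w hw
    have hw1 : ‖w‖ < 1 := by linarith
    have hE := measurableSet_pseudoDisk hw r
    constructor
    · rw [ENNReal.le_div_iff_mul_le (Or.inl (hA0 w hw r hr0 hr1)) (Or.inl (measure_ne_top _ _))]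
      have hlow : ENNReal.ofReal (δ / 2) ≤
          ENNReal.ofReal (((1 - ‖w‖) ^ 2)⁻¹) * pullbackArea φ (pseudoDisk w r) := by
        refine (hnear w hw).trans ?_
        set S := {z | κ * (1 - ‖w‖) < 1 - ‖z‖ ∧
          η * ‖1 - starRingEnd ℂ w * φ z‖ ^ 2 < (1 - ‖w‖ ^ 2) * (1 - ‖φ z‖ ^ 2)} with hS
        have hsub : S ≤ᵐ[diskArea] φ ⁻¹' pseudoDisk w r := by
          refine ae_mem_disk.mono fun z hz hzS => ?_
          have h1 : η * ‖1 - starRingEnd ℂ w * φ z‖ ^ 2 < (1 - ‖w‖ ^ 2) * (1 - ‖φ z‖ ^ 2) := hzS.2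
          refine (mem_pseudoDisk_iff hw).2 ⟨hm hz, ?_⟩
          rw [← norm_one_sub_conj_mul_sq_sub] at h1
          have h2 : η' * ‖1 - starRingEnd ℂ w * φ z‖ ^ 2 ≤ η * ‖1 - starRingEnd ℂ w * φ z‖ ^ 2 := by
            gcongr
            exact min_le_left _ _
          refine (sq_lt_sq₀ (norm_nonneg _) (by positivity)).1 ?_
          rw [mul_pow, hrsq]
          linarith
        refine (lintegral_mono_set' hsub).trans ?_
        rw [pullbackArea, Measure.map_apply hφm hE, ← setLIntegral_const]
        refine setLIntegral_mono' (hφm hE) fun z hz => ENNReal.ofReal_le_ofReal ?_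
        have hφz : φ z ∈ pseudoDisk w r := hz
        have hz1 : ‖φ z‖ < 1 := by simpa using hφz.1
        have h3 : 1 - ‖w‖ ≤ ‖1 - starRingEnd ℂ w * φ z‖ := one_sub_norm_le_norm_one_sub hz1.le
        calc (1 - ‖w‖) ^ 2 / ‖1 - starRingEnd ℂ w * φ z‖ ^ 4
            ≤ (1 - ‖w‖) ^ 2 / (1 - ‖w‖) ^ 4 := by gcongr
          _ = _ := by field_simp
      calc ENNReal.ofReal (max C₁ C₂)⁻¹ * diskArea (pseudoDisk w r)
          ≤ ENNReal.ofReal C₁⁻¹ * ENNReal.ofReal ((2 / (1 - r)) ^ 2 * (1 - ‖w‖) ^ 2) := by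
            gcongr
            · exact le_max_left _ _
            · exact diskArea_pseudoDisk_le hw hr0 hr1
        _ = ENNReal.ofReal ((1 - ‖w‖) ^ 2) * ENNReal.ofReal (δ / 2) := by
            rw [← ENNReal.ofReal_mul (by positivity), ← ENNReal.ofReal_mul (by positivity), hC₁]
            congr 1
            field_simp
        _ ≤ ENNReal.ofReal ((1 - ‖w‖) ^ 2) *
            (ENNReal.ofReal (((1 - ‖w‖) ^ 2)⁻¹) * pullbackArea φ (pseudoDisk w r)) := by gcongr
        _ = _ := by
            rw [← mul_assoc, ← ENNReal.ofReal_mul (by positivity),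
              mul_inv_cancel₀ (by positivity), ENNReal.ofReal_one, one_mul]
    -- The upper half of the condition needs no lower bound on kernel masses: it follows from their
    -- uniform upper bound B.
    · rw [ENNReal.div_le_iff_le_mul (Or.inl (hA0 w hw r hr0 hr1)) (Or.inl (measure_ne_top _ _))]
      have h1 := (pullbackArea_pseudoDisk_mul_le hφm hw hr1).trans (hup w hw)
      calc pullbackArea φ (pseudoDisk w r)
          = pullbackArea φ (pseudoDisk w r) *
            ENNReal.ofReal ((1 - r) ^ 4 / 16 * ((1 - ‖w‖) ^ 2)⁻¹) *
            ENNReal.ofReal (16 / (1 - r) ^ 4 * (1 - ‖w‖) ^ 2) := by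
            rw [mul_assoc, ← ENNReal.ofReal_mul (by positivity)]
            have : (1 - r) ^ 4 / 16 * ((1 - ‖w‖) ^ 2)⁻¹ * (16 / (1 - r) ^ 4 * (1 - ‖w‖) ^ 2) = 1 := by
              field_simp
            rw [this, ENNReal.ofReal_one, mul_one]
        _ ≤ ENNReal.ofReal B * ENNReal.ofReal (16 / (1 - r) ^ 4 * (1 - ‖w‖) ^ 2) := by gcongr
        _ = ENNReal.ofReal C₂ * ENNReal.ofReal (r ^ 2 * (1 - ‖w‖) ^ 2) := by
            rw [← ENNReal.ofReal_mul (by positivity), ← ENNReal.ofReal_mul (by positivity), hC₂]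
            congr 1
            field_simp
        _ ≤ _ := by
            gcongr
            · exact le_max_right _ _
            · exact le_diskArea_pseudoDisk hw hr0 hr1

/-! ### The kernel test and the assembly of the equivalences -/

/-- `C_φ` is bounded below if and only if the masses of the kernels composed with `φ` are. -/
theorem IsCompositionOperator.boundedBelow_iff {φ : ℂ → ℂ} (hφ : DifferentiableOn ℂ φ disk)
    (hm : MapsTo φ disk disk) (hφm : Measurable φ) (hconst : ¬ ∃ c : ℂ, ∀ z ∈ disk, φ z = c)
    {C : bergmanSpace →L[ℂ] bergmanSpace} (hC : IsCompositionOperator φ C) :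
    (∃ c : ℝ, 0 < c ∧ ∀ f, c * ‖f‖ ^ 2 ≤ ‖C f‖ ^ 2) ↔
      ∃ δ : ℝ, 0 < δ ∧ ∀ w ∈ disk, ENNReal.ofReal δ ≤
        ∫⁻ z, ENNReal.ofReal ((1 - ‖w‖) ^ 2 / ‖1 - starRingEnd ℂ w * φ z‖ ^ 4) ∂diskArea := by
  constructor
  · rintro ⟨c, hc, h⟩
    -- The lower bound is tested on K_w, with ‖K_w‖² ≥ 1/(16(1 - |w|)²).
    refine ⟨c / 16, by positivity, fun w hw => ?_⟩
    have h1 := ENNReal.ofReal_le_ofReal (h (kernelElement w hw))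
    rw [ENNReal.ofReal_mul hc.le, enorm_sq_eq_lintegral, hC.enorm_sq_eq] at h1
    have e₁ : ∫⁻ z, ‖toFun (kernelElement w hw) z‖ₑ ^ 2 ∂diskArea =
        ∫⁻ z, ‖kernel w z‖ₑ ^ 2 ∂diskArea := lintegral_congr_ae <| ae_mem_disk.mono fun z hz => by
      simp only [toFun_kernelElement hw hz]
    have e₂ : ∫⁻ z, ‖toFun (kernelElement w hw) (φ z)‖ₑ ^ 2 ∂diskArea =
        ∫⁻ z, ‖kernel w (φ z)‖ₑ ^ 2 ∂diskArea :=
      lintegral_congr_ae <| ae_mem_disk.mono fun z hz => by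
        simp only [toFun_kernelElement hw (hm hz)]
    rw [e₁, e₂] at h1
    have h2 := le_lintegral_kernel hw
    have hfin := lintegral_kernel_comp_ne_top (φ := fun x => x) (mapsTo_id _) hw
    rw [lintegral_kernel_comp_eq]
    calc ENNReal.ofReal (c / 16) ≤ ENNReal.ofReal ((1 - ‖w‖) ^ 2 *
          (c * (∫⁻ z, ‖kernel w z‖ₑ ^ 2 ∂diskArea).toReal)) := by
          refine ENNReal.ofReal_le_ofReal ?_
          have := mul_le_mul_of_nonneg_left h2 hc.le
          linarith
      _ = ENNReal.ofReal ((1 - ‖w‖) ^ 2) *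
          (ENNReal.ofReal c * ∫⁻ z, ‖kernel w z‖ₑ ^ 2 ∂diskArea) := by
          rw [ENNReal.ofReal_mul (sq_nonneg _), ENNReal.ofReal_mul hc.le, ENNReal.ofReal_toReal hfin]
      _ ≤ _ := by gcongr
  · rintro ⟨δ, hδ, hb⟩
    obtain ⟨B, hB, h⟩ := exists_lintegral_le_lintegral_comp hφ hm hφm hconst hδ hb
    refine ⟨1 / B, by positivity, fun f => ?_⟩
    have h1 := h (toFun f) (toFun_analytic f).differentiableOn (lintegral_toFun_ne_top f)
    rw [← enorm_sq_eq_lintegral, ← hC.enorm_sq_eq, ← ENNReal.ofReal_mul hB.le,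
      ENNReal.ofReal_le_ofReal_iff (by positivity)] at h1
    rw [one_div_mul_eq_div, div_le_iff₀ hB]
    linarith

/-- The symbol is arbitrary off the disk and need not be measurable there; replacing it by ψ changes
neither the composition operator nor the pull-back measure. -/
theorem exists_measurable_eqOn_disk {φ : ℂ → ℂ} (hφ : ContinuousOn φ disk) :
    ∃ ψ : ℂ → ℂ, Measurable ψ ∧ EqOn ψ φ disk := by
  classical
  exact ⟨disk.piecewise φ (fun _ => 0),
    hφ.measurable_piecewise continuousOn_const measurableSet_ball, piecewise_eqOn _ _ _⟩

end Bergman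

theorem theoremM2 (φ : ℂ → ℂ)
    (hφ : AnalyticOnNhd ℂ φ Bergman.disk)
    (hmaps : Set.MapsTo φ Bergman.disk Bergman.disk)
    (hconst : ¬ ∃ c : ℂ, ∀ z ∈ Bergman.disk, φ z = c) :
    ∃ C T : Bergman.bergmanSpace →L[ℂ] Bergman.bergmanSpace,
      Bergman.IsCompositionOperator φ C ∧
      Bergman.IsToeplitzOperator (Bergman.pullbackArea φ) T ∧
      T = ContinuousLinearMap.adjoint C ∘L C ∧
      List.TFAE [
        IsUnit T,
        Bergman.BerezinBoundedBelow (Bergman.pullbackArea φ),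
        Bergman.ReverseCarlesonCondition (Bergman.pullbackArea φ),
        IsClosed (Set.range C),
        Bergman.IsReverseCarleson (Bergman.pullbackArea φ)] := by
  obtain ⟨ψ, hψm, hψ⟩ := Bergman.exists_measurable_eqOn_disk hφ.continuousOn
  have hψa : AnalyticOnNhd ℂ ψ Bergman.disk :=
    (hφ.differentiableOn.congr hψ).analyticOnNhd isOpen_ball
  have hψmaps : Set.MapsTo ψ Bergman.disk Bergman.disk := hmaps.congr hψ.symm
  have hψconst : ¬ ∃ c : ℂ, ∀ z ∈ Bergman.disk, ψ z = c := fun ⟨c, hc⟩ =>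
    hconst ⟨c, fun z hz => by rw [← hψ hz, hc z hz]⟩
  have hpull : Bergman.pullbackArea φ = Bergman.pullbackArea ψ :=
    Measure.map_congr (Bergman.ae_mem_disk.mono fun z hz => (hψ hz).symm)
  obtain ⟨C, hC⟩ := Bergman.exists_isCompositionOperator hψa hψmaps hψm
  have hinj := hC.injective hψa hψmaps hψconst
  rw [hpull]
  refine ⟨C, _, fun f z hz => by rw [hC f z hz, hψ hz], hC.isToeplitzOperator hψmaps hψm, rfl, ?_⟩
  have hbelow := hC.boundedBelow_iff hψa.differentiableOn hψmaps hψm hψconst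
  tfae_have 1 ↔ 5 := (Bergman.isUnit_adjoint_comp_self_iff C).trans
    (hC.isReverseCarleson_iff hψmaps hψm).symm
  tfae_have 4 ↔ 5 := (Bergman.isClosed_range_iff_of_injective C hinj).trans
    (hC.isReverseCarleson_iff hψmaps hψm).symm
  tfae_have 2 ↔ 5 := (Bergman.berezinBoundedBelow_iff hψmaps hψm).trans
    (hbelow.symm.trans (hC.isReverseCarleson_iff hψmaps hψm).symm)
  tfae_have 3 ↔ 5 := (Bergman.reverseCarlesonCondition_iff hψa.differentiableOn hψmaps hψm).trans
    (hbelow.symm.trans (hC.isReverseCarleson_iff hψmaps hψm).symm)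
  tfae_finish
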